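/- A drilled ananas is a $3$-manifold with boundary $N$, homeomorphic to $T^2\times[0,\infty)\setminus\{x\}$ with $x\in T^2\times\{0\}$, with a complete hyperbolic metric such that (i) for some $y>0$ the end $T^2\times[y,\infty)$ is isometric to a horocusp (the quotient of a closed horoball by a discrete group $\mathbb Z\times\mathbb Z$ of parabolic isometries), each cross-section $T^2\times\{y'\}$, $y'>y$, being a horotorus; (ii) $\partial N=T^2\times\{0\}\setminus\{x\}$ consists of two totally geodesic ideal triangles with vertices at $x$, glued isometrically along their edges to form a standard two-triangle triangulation of the once-punctured torus; bending along the edges is allowed, with interior angles in $(0,2\pi)$ (possibly equal to $\pi$). A sub-ananas of $N$ is a closed subset of $N$ containing a neighborhood of its cusp that is itself a drilled ananas with the induced hyperbolic structure. A geometric ideal triangulation of $N$ is a finite decomposition of $N$ into geometric ideal tetrahedra (convex hulls of four non-coplanar points of $\partial\mathbb H^3$) glued along faces. A geometric $2$--$3$ move replaces two distinct tetrahedra of a geometric ideal triangulation that are glued along a face $F$ by three tetrahedra around a central edge dual to $F$, and keeps all other tetrahedra, such that the result is again a geometric ideal triangulation. Lemma. Every drilled ananas $N$ admits an infinite sequence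 $\mathcal T_0,\mathcal T_1,\mathcal T_2,\dots$ of pairwise distinct geometric ideal triangulations such that $\mathcal T_{i+1}$ is the result of a geometric $2$--$3$ move on $\mathcal T_i$ for every $i\ge 0$. Moreover, the moves can be obtained by repeated diagonal exchanges: there are sub-ananas $N=N_0, N_1, N_2,\dots$ of $N$ such that, for every $i\ge 0$, $N_i$ is the union of the tetrahedra of $\mathcal T_i$ that have an ideal vertex at the cusp; there are exactly two such tetrahedra; and there is an edge $\beta_i$ of $\partial N_i$ at which the interior angle of $N_i$ is less than $\pi$, such that the move from $\mathcal T_i$ to $\mathcal T_{i+1}$ is made along the face that joins $\beta_i$ to the cusp, and the edges of $\partial N_{i+1}$ are those of $\partial N_i$ with $\beta_i$ replaced by the new central edge $\beta_i'$. -/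

import Mathlib

open Set Filter Topology
open scoped NNReal ENNReal

noncomputable section

namespace Ananas

/-! ### Hyperbolic space -/

/-- Hyperbolic 3-space, in the upper half-space model `ℂ × (0, ∞)`. -/
@[ext]
structure H3 where
  /-- the horizontal coordinate -/
  z : ℂ
  /-- the height -/
  t : ℝ
  pos : 0 < t

/-- The hyperbolic distance, `2 arsinh (|p - q| / (2 √(t s)))` with `|p - q|` Euclidean. -/
instance : Dist H3 :=
  ⟨fun p q => 2 * Real.arsinh (√(‖p.z - q.z‖ ^ 2 + (p.t - q.t) ^ 2) / (2 * √(p.t * q.t)))⟩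

theorem H3.dist_def (p q : H3) : dist p q =
    2 * Real.arsinh (√(‖p.z - q.z‖ ^ 2 + (p.t - q.t) ^ 2) / (2 * √(p.t * q.t))) := rfl

/-- The point of the upper half-plane with the given coordinates. -/
def planePoint (x t : ℝ) (ht : 0 < t) : UpperHalfPlane := ⟨⟨x, t⟩, ht⟩

theorem dist_planePoint (x y t s : ℝ) (ht : 0 < t) (hs : 0 < s) :
    dist (planePoint x t ht) (planePoint y s hs) =
      2 * Real.arsinh (√((x - y) ^ 2 + (t - s) ^ 2) / (2 * √(t * s))) := by
  rw [UpperHalfPlane.dist_eq]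
  simp only [planePoint, UpperHalfPlane.im, Complex.dist_eq_re_im]

theorem H3.dist_le_planePoint (p q : H3) (x y : ℝ) (h : ‖p.z - q.z‖ ≤ |x - y|) :
    dist p q ≤ dist (planePoint x p.t p.pos) (planePoint y q.t q.pos) := by
  rw [dist_planePoint, H3.dist_def]
  have h2 : ‖p.z - q.z‖ ^ 2 ≤ (x - y) ^ 2 := by
    rw [← sq_abs (x - y)]
    gcongr
  have h3 := Real.arsinh_strictMono.monotone
    (div_le_div_of_nonneg_right (Real.sqrt_le_sqrt (add_le_add_left h2 ((p.t - q.t) ^ 2)))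
      (by positivity : (0 : ℝ) ≤ 2 * √(p.t * q.t)))
  linarith

theorem H3.dist_eq_planePoint (p q : H3) (x y : ℝ) (h : ‖p.z - q.z‖ = |x - y|) :
    dist p q = dist (planePoint x p.t p.pos) (planePoint y q.t q.pos) := by
  rw [dist_planePoint, H3.dist_def, h, sq_abs]

instance : MetricSpace H3 where
  dist_self p := by simp [H3.dist_def]
  dist_comm p q := by
    rw [H3.dist_def, H3.dist_def, norm_sub_rev, mul_comm p.t, ← neg_sub p.t q.t, neg_sq]
  dist_triangle p q r := by
    have h1 := H3.dist_le_planePoint p r 0 (‖p.z - q.z‖ + ‖q.z - r.z‖) (by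
      rw [zero_sub, abs_neg, abs_of_nonneg (by positivity)]
      exact norm_sub_le_norm_sub_add_norm_sub _ _ _)
    have h2 := H3.dist_eq_planePoint p q 0 ‖p.z - q.z‖ (by simp)
    have h3 := H3.dist_eq_planePoint q r ‖p.z - q.z‖ (‖p.z - q.z‖ + ‖q.z - r.z‖) (by simp)
    rw [h2, h3]
    exact h1.trans (dist_triangle _ _ _)
  eq_of_dist_eq_zero := by
    intro p q h
    rw [H3.dist_eq_planePoint p q 0 ‖p.z - q.z‖ (by simp)] at h
    have h2 := congrArg UpperHalfPlane.coe (dist_eq_zero.mp h)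
    simp only [planePoint, Complex.mk.injEq] at h2
    exact H3.ext (sub_eq_zero.mp (norm_eq_zero.mp h2.1.symm)) h2.2

/-- The sphere at infinity of hyperbolic 3-space. -/
abbrev Ideal := OnePoint ℂ

/-- Minkowski space of dimension 4: `(A, w, C)` stands for the Hermitian matrix with diagonal
entries `A`, `C` and off-diagonal entries `w` and its conjugate. -/
abbrev Mink := ℝ × ℂ × ℝ

/-- The Lorentz form of signature `(3, 1)` on `Mink`, namely the polarization of
`|w| ^ 2 - A C` (minus the determinant). -/
def lorentz (x y : Mink) : ℝ :=
  (x.2.1 * (starRingEnd ℂ) y.2.1).re - (x.1 * y.2.2 + y.1 * x.2.2) / 2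

/-- The timelike ray of `Mink` that represents a point of hyperbolic space: a positive multiple
of the corresponding point of the hyperboloid model. -/
def H3.vec (p : H3) : Mink := (‖p.z‖ ^ 2 + p.t ^ 2, p.z, 1)

/-- The lightlike ray of `Mink` that represents an ideal point. -/
def light (a : Ideal) : Mink := OnePoint.elim a (1, 0, 0) (fun w => (‖w‖ ^ 2, w, 1))

/-- The hyperbolic convex hull in `H3` of a set of ideal points (the ideal points themselves are
not part of it): in the projective model, it is cut out by the convex cone over the points. -/
def hull (V : Set Ideal) : Set H3 := {p | p.vec ∈ Submodule.span ℝ≥0 (light '' V)}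

/-- Component of `x` orthogonal to the plane spanned by the lightlike vectors `u`, `v`. -/
def normalPart (u v x : Mink) : Mink :=
  x - (lorentz x v / lorentz u v) • u - (lorentz x u / lorentz u v) • v

/-- The dihedral angle, along the geodesic with ends `a`, `b`, between the half-planes that are
bounded by this geodesic and have `c` and `d` at infinity. -/
def dihedral (a b c d : Ideal) : ℝ :=
  Real.arccos
    (lorentz (normalPart (light a) (light b) (light c)) (normalPart (light a) (light b) (light d)) /
      (√(lorentz (normalPart (light a) (light b) (light c))
            (normalPart (light a) (light b) (light c))) *
        √(lorentz (normalPart (light a) (light b) (light d))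
            (normalPart (light a) (light b) (light d)))))

/-! ### The universal cover of `T² × [0, ∞) ∖ {x}` -/

/-- The universal cover of `T² × [0, ∞) ∖ {x}`, where `T² = ℝ² / ℤ²` and `x = (0, 0)`:
it is `ℝ² × [0, ∞)` without the points of `ℤ² × {0}`. -/
abbrev Cover := {p : (ℝ × ℝ) × ℝ // 0 ≤ p.2 ∧ (p.2 = 0 → ¬ ∃ m n : ℤ, p.1 = ((m : ℝ), (n : ℝ)))}

/-- The deck transformation of the universal cover that corresponds to `v ∈ ℤ²`. -/
def shift (v : ℤ × ℤ) (x : Cover) : Cover :=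
  ⟨((x.1.1.1 + v.1, x.1.1.2 + v.2), x.1.2), x.2.1, fun h => by
    rintro ⟨m, n, hmn⟩
    refine x.2.2 h ⟨m - v.1, n - v.2, ?_⟩
    rw [Prod.mk.injEq] at hmn
    ext
    · push_cast
      linarith [hmn.1]
    · push_cast
      linarith [hmn.2]⟩

/-- The set of all lifts of the image in `N` of a subset of the universal cover. -/
def orbit (C : Set Cover) : Set (Set Cover) := range fun v : ℤ × ℤ => shift v '' C

/-- The Euclidean simplex in `ℝ² × {0}` with vertex set `S ⊆ ℤ²`, without its vertices. -/
def boundaryCell (S : Set (ℤ × ℤ)) : Set Cover :=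
  {x | x.1.2 = 0 ∧ x.1.1 ∈ convexHull ℝ ((fun v : ℤ × ℤ => ((v.1 : ℝ), (v.2 : ℝ))) '' S)}

/-- Vertex sets of the edges of the lift to `ℝ²` of the standard triangulation of the torus with
one vertex, three edges and two triangles. -/
def IsStdEdge (S : Set (ℤ × ℤ)) : Prop :=
  ∃ v, S = {v, v + (1, 0)} ∨ S = {v, v + (0, 1)} ∨ S = {v, v + (1, 1)}

/-- Vertex sets of the triangles of the lift to `ℝ²` of the standard triangulation. -/
def IsStdTriangle (S : Set (ℤ × ℤ)) : Prop :=
  ∃ v, S = {v, v + (1, 0), v + (1, 1)} ∨ S = {v, v + (0, 1), v + (1, 1)}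

/-- The set `C` is developed homeomorphically onto the convex hull of the set `V` of ideal
points: if `V` has 2, 3 or 4 (non-coplanar) points, then `C` is a geodesic, a totally geodesic
ideal triangle, or a geometric ideal tetrahedron. -/
def IsIdealCell (dev : Cover → H3) (C : Set Cover) (V : Set Ideal) : Prop :=
  ∃ σ : H3 → Cover, ContinuousOn σ (hull V) ∧ (∀ p ∈ hull V, dev (σ p) = p) ∧ σ '' hull V = C

/-- The length of the path `γ` in the metric that is pulled back by `dev`. -/
def pathLength (dev : Cover → H3) {x y : Cover} (γ : Path x y) : ℝ≥0∞ :=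
  eVariationOn (fun s => dev (γ s)) univ

/-- The path metric that is pulled back by `dev`. -/
def pathDist (dev : Cover → H3) (x y : Cover) : ℝ≥0∞ := ⨅ γ : Path x y, pathLength dev γ

/-- Completeness of the pulled back path metric: every Cauchy sequence converges. -/
def IsCompleteDev (dev : Cover → H3) : Prop :=
  ∀ u : ℕ → Cover,
    (∀ ε : ℝ≥0∞, 0 < ε → ∃ n₀, ∀ m ≥ n₀, ∀ n ≥ n₀, pathDist dev (u m) (u n) < ε) →
      ∃ x, Tendsto u atTop (𝓝 x)

/-! ### Drilled ananas -/

/-- A drilled ananas, that is, a complete hyperbolic structure on the manifold with boundary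
`N = T² × [0, ∞) ∖ {x}`, `x ∈ T² × {0}`, whose end is a horocusp and whose boundary consists of two
totally geodesic ideal triangles with vertices at `x`. The hyperbolic structure is given by its
developing map from the universal cover of `N` to hyperbolic space, positioned so that the horocusp
lifts to a horoball at `∞`; the deck group `ℤ²` then acts on hyperbolic space by a discrete group
`ℤ ω₁ + ℤ ω₂` of horizontal translations. The homeomorphism from `N` to `T² × [0, ∞) ∖ {x}` is
chosen such that the triangulation of the boundary is the standard one. -/
structure DrilledAnanas where
  /-- the developing map of the hyperbolic structure -/
  dev : Cover → H3
  continuous_dev : Continuous dev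
  /-- hyperbolic structure on the interior -/
  isLocalHomeomorphOn_dev : IsLocalHomeomorphOn dev {x | 0 < x.1.2}
  /-- hyperbolic structure near the (bent) boundary: the developing map is a local embedding -/
  locally_injective : ∀ x, ∃ U ∈ 𝓝 x, InjOn dev U
  /-- the parabolic holonomy of the first generator -/
  ω₁ : ℂ
  /-- the parabolic holonomy of the second generator -/
  ω₂ : ℂ
  linearIndependent : LinearIndependent ℝ ![ω₁, ω₂]
  dev_shift_z : ∀ v x, (dev (shift v x)).z = (dev x).z + v.1 * ω₁ + v.2 * ω₂
  dev_shift_t : ∀ v x, (dev (shift v x)).t = (dev x).t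
  /-- the hyperbolic metric is complete -/
  complete : IsCompleteDev dev
  /-- for some `y > 0`, the end `T² × [y, ∞)` is isometric to a horocusp, and the cross-sections
  `T² × {y'}` for `y' > y` are horotori -/
  horocusp : ∃ y > 0, InjOn dev {x | y ≤ x.1.2} ∧
    (∃ h > 0, dev '' {x | y ≤ x.1.2} = {p | h ≤ p.t}) ∧
    ∀ y' > y, ∃ h', dev '' {x | x.1.2 = y'} = {p | p.t = h'}
  /-- the ideal points to which the lifts of `x` develop -/
  vert : ℤ × ℤ → Ideal
  /-- the three ideal vertices of a boundary triangle are distinct -/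
  injOn_vert : ∀ S, IsStdTriangle S → InjOn vert S
  /-- the boundary triangles are totally geodesic ideal triangles -/
  boundary_triangle : ∀ S, IsStdTriangle S → IsIdealCell dev (boundaryCell S) (vert '' S)
  /-- the sides of the boundary triangles are the sides of these ideal triangles -/
  boundary_edge : ∀ S, IsStdEdge S → IsIdealCell dev (boundaryCell S) (vert '' S)

/-- `τ` is (a lift of) a geometric ideal tetrahedron in `N` with set of ideal vertices `V`: four
ideal points that do not lie on a plane. -/
def IsTet (A : DrilledAnanas) (τ : Set Cover) (V : Set Ideal) : Prop :=
  (∃ a b c d, V = {a, b, c, d} ∧ LinearIndependent ℝ ![light a, light b, light c, light d]) ∧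
    IsIdealCell A.dev τ V

/-- A geometric ideal triangulation of a drilled ananas `N`, given by all lifts of its
tetrahedra to the universal cover. -/
structure GeometricTriangulation (A : DrilledAnanas) where
  /-- the lifts of the tetrahedra -/
  tets : Set (Set Cover)
  isTet : ∀ τ ∈ tets, ∃ V, IsTet A τ V
  /-- the tetrahedra of `N` are finitely many, and all their lifts are listed -/
  finite : ∃ F : Set (Set Cover), F.Finite ∧ tets = ⋃ τ ∈ F, orbit τ
  /-- the tetrahedra cover `N` -/
  cover : ⋃₀ tets = univ
  /-- two tetrahedra meet in a common face, a common edge, or not at all -/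
  face_to_face : ∀ τ ∈ tets, ∀ τ' ∈ tets, τ ≠ τ' →
    ∃ V V' W, IsTet A τ V ∧ IsTet A τ' V' ∧ W ⊆ V ∩ V' ∧ IsIdealCell A.dev (τ ∩ τ') W

/-- A geometric `2`--`3` move: the two distinct tetrahedra that are glued along (the image in `N`
of) the face `F` are replaced by three tetrahedra around a central edge `e` dual to `F`, while all
other tetrahedra stay the same. -/
def IsTwoThreeMove {A : DrilledAnanas} (𝒯 𝒯' : GeometricTriangulation A) (F e : Set Cover) : Prop :=
  ∃ (τ τ' σ₁ σ₂ σ₃ : Set Cover) (a b c d d' : Ideal),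
    τ ∈ 𝒯.tets ∧ τ' ∈ 𝒯.tets ∧ τ' ∉ orbit τ ∧
    IsTet A τ {a, b, c, d} ∧ IsTet A τ' {a, b, c, d'} ∧
    τ ∩ τ' = F ∧ IsIdealCell A.dev F {a, b, c} ∧
    IsTet A σ₁ {d, d', b, c} ∧ IsTet A σ₂ {d, d', c, a} ∧ IsTet A σ₃ {d, d', a, b} ∧
    σ₁ ∩ σ₂ ∩ σ₃ = e ∧ IsIdealCell A.dev e {d, d'} ∧
    σ₁ ∪ σ₂ ∪ σ₃ = τ ∪ τ' ∧
    σ₂ ∉ orbit σ₁ ∧ σ₃ ∉ orbit σ₁ ∧ σ₃ ∉ orbit σ₂ ∧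
    𝒯'.tets = (𝒯.tets \ (orbit τ ∪ orbit τ')) ∪ (orbit σ₁ ∪ orbit σ₂ ∪ orbit σ₃)

/-- The (lifts of the) tetrahedra with an ideal vertex at the lift `∞` of the cusp. -/
def cuspTets {A : DrilledAnanas} (𝒯 : GeometricTriangulation A) : Set (Set Cover) :=
  {τ | τ ∈ 𝒯.tets ∧ ∃ V, IsTet A τ V ∧ OnePoint.infty ∈ V}

/-- The interior angle at the edge `β` of the region that is formed by the tetrahedra with an ideal
vertex at the cusp is `θ`: it is the sum of the dihedral angles at `β` of those tetrahedra of the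
region that contain `β`. -/
def HasInteriorAngle {A : DrilledAnanas} (𝒯 : GeometricTriangulation A) (β : Set Cover) (θ : ℝ) :
    Prop :=
  ∃ (q r : Ideal) (F : Finset (Set Cover)) (c d : Set Cover → Ideal),
    IsIdealCell A.dev β {q, r} ∧
    (∀ τ, τ ∈ F ↔ τ ∈ cuspTets 𝒯 ∧ β ⊆ τ) ∧
    (∀ τ ∈ F, IsTet A τ {q, r, c τ, d τ}) ∧
    θ = ∑ τ ∈ F, dihedral q r (c τ) (d τ)

/-- The ideal triangle `F` is the join of the edge `β` and the cusp. -/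
def IsJoinWithCusp (A : DrilledAnanas) (F β : Set Cover) : Prop :=
  ∃ q r : Ideal, IsIdealCell A.dev β {q, r} ∧ IsIdealCell A.dev F {q, r, OnePoint.infty} ∧ β ⊆ F

/-- A sub-ananas of the drilled ananas `A` (with the same cusp): a closed subset that is itself a
drilled ananas with the hyperbolic structure of `A`. -/
structure SubAnanas (A : DrilledAnanas) where
  /-- the sub-ananas as a drilled ananas -/
  ananas : DrilledAnanas
  /-- the inclusion, lifted to universal covers -/
  incl : Cover → Cover
  isClosedEmbedding : IsClosedEmbedding incl
  /-- the isomorphism of fundamental groups that is induced by the inclusion -/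
  deck : (ℤ × ℤ) ≃+ (ℤ × ℤ)
  equivariant : ∀ v x, incl (shift v x) = shift (deck v) (incl x)
  dev_eq : ∀ x, ananas.dev x = A.dev (incl x)

/-- The (preimage in the universal cover of the) subset of `N` that is formed by a sub-ananas. -/
def SubAnanas.carrier {A : DrilledAnanas} (B : SubAnanas A) : Set Cover := range B.incl

/-- The (lifts of the) three edges of the boundary of a sub-ananas. -/
def SubAnanas.boundaryEdges {A : DrilledAnanas} (B : SubAnanas A) : Set (Set Cover) :=
  {β | ∃ S, IsStdEdge S ∧ β = B.incl '' boundaryCell S}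

end Ananas

end

/-!
In the upper half-space model with the cusp at `∞`, the deck group of a drilled ananas acts by a
lattice of horizontal translations. The ideal vertices of the boundary form a translate of this
lattice: a vertex is the common end of two edges, and translations map edges to edges. Lifting a
point `(z, t)` to `(z, |z|² + t²)` turns hyperbolic convexity into affine convexity, so a point of
the hull of lattice points and `∞` is described by barycentric weights (`Frame.Rep`) subject to four
linear equations: mass, two coordinates, and energy. In these terms the boundary is the graph of an
explicit function `Frame.height` over `ℂ`.

*The developing map is an embedding whose image is the region above this graph*
(`DrilledAnanas.exists_region`). Invert the developing map on the horoball of the cusp and extend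
the inverse downwards along vertical rays to a maximal domain. Completeness gives a limit at each
point that bounds the domain from below on its ray, and the inverse extends further unless the limit
is a boundary point, in which case the ray has reached the graph. By connectedness of the interior
the inverse takes all interior points as values, and no boundary point develops into its domain: as
a limit of interior points it would be a value of the inverse and hence interior. So the
domain is exactly the open region above the graph. Conversely, each such region carries a drilled
ananas (`Frame.model`), which yields the sub-ananas.

*The moves.* Among the sides of the boundary triangles, choose a basis `u`, `v` of the lattice whose
inner product is negative. For `i ≥ 0` the inner product `u · v - i |u|²` of `u` and `v - i u` is
negative as well. In the parallelogram spanned by this basis the angle between the sides is obtuse,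
so the dihedral angles at the short diagonal of the two cusp tetrahedra over the parallelogram are
acute, and the interior angle at that diagonal is less than `π`. Exchanging this diagonal for the
other one is a geometric move from two to three tetrahedra, because the unique linear relation
among the five vertices has positive coefficients at `∞` and at the ends of the first diagonal and
negative ones at the ends of the second (`Frame.hull_cone_quadr_old`, `Frame.hull_cone_quadr_new`).
The result is the same picture for the basis `u`, `v - (i + 1) u`, with one more layer of tetrahedra
below the surface.

That the layers form a triangulation follows from the uniqueness of barycentric weights supported on
cells (`Frame.Rep.unique`). In a horizontal strip of the lattice the mass and the two coordinates
leave one parameter, the first moment on the lower row. If two systems of weights had different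
lower moments, the convexity of squares on the integers and the negative inner product would force
the energies to differ (`Frame.Slab.not_lowMoment_lt`). Hence two tetrahedra meet in the hull of
their common vertices.
-/

noncomputable section

namespace Ananas

/-! ### The topology of the upper half-space -/

theorem H3.dist_of_z_eq {p q : H3} (h : p.z = q.z) :
    dist p q = |Real.log p.t - Real.log q.t| := by
  rw [H3.dist_eq_planePoint p q 0 0 (by simp [h]), UpperHalfPlane.dist_of_re_eq
      (z := planePoint 0 p.t p.pos) (w := planePoint 0 q.t q.pos) rfl]
  rfl

theorem H3.abs_log_sub_le_dist (p q : H3) : |Real.log p.t - Real.log q.t| ≤ dist p q := by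
  have h := H3.dist_le_planePoint ⟨0, p.t, p.pos⟩ ⟨0, q.t, q.pos⟩ 0 ‖p.z - q.z‖ (by simp)
  have h2 := H3.dist_eq_planePoint p q 0 ‖p.z - q.z‖ (by simp)
  have h3 := H3.dist_of_z_eq (p := ⟨0, p.t, p.pos⟩) (q := ⟨0, q.t, q.pos⟩) rfl
  rw [h2, ← h3]
  exact h

theorem H3.norm_sub_le (p q : H3) :
    ‖p.z - q.z‖ ≤ 2 * √(p.t * q.t) * Real.sinh (dist p q / 2) := by
  have hp := p.pos
  have hq := q.pos
  have h0 : 0 < 2 * √(p.t * q.t) := by positivity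
  rw [H3.dist_def, mul_div_cancel_left₀ _ (two_ne_zero' ℝ), Real.sinh_arsinh,
    mul_div_cancel₀ _ h0.ne']
  apply Real.le_sqrt_of_sq_le
  nlinarith [sq_nonneg (p.t - q.t)]

theorem H3.dist_le_of_t_eq {p q : H3} (h : p.t = q.t) : dist p q ≤ ‖p.z - q.z‖ / p.t := by
  have hq := p.pos
  rw [H3.dist_def, ← h, sub_self, zero_pow two_ne_zero, add_zero, Real.sqrt_sq (norm_nonneg _),
    Real.sqrt_mul_self hq.le]
  have h1 : Real.arsinh (‖p.z - q.z‖ / (2 * p.t)) ≤ ‖p.z - q.z‖ / (2 * p.t) := by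
    rw [← Real.sinh_le_sinh, Real.sinh_arsinh, Real.self_le_sinh_iff]
    positivity
  calc _ ≤ 2 * (‖p.z - q.z‖ / (2 * p.t)) := by linarith
    _ = _ := by field_simp

theorem H3.continuous_t : Continuous H3.t := by
  have h : LipschitzWith 1 fun p : H3 => Real.log p.t := by
    apply LipschitzWith.of_dist_le_mul
    intro p q
    rw [Real.dist_eq, NNReal.coe_one, one_mul]
    exact H3.abs_log_sub_le_dist p q
  have h2 : H3.t = fun p => Real.exp (Real.log p.t) := by
    ext p
    rw [Real.exp_log p.pos]
  rw [h2]
  exact h.continuous.rexp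

theorem H3.continuous_z : Continuous H3.z := by
  rw [continuous_iff_continuousAt]
  intro p
  rw [ContinuousAt, tendsto_iff_norm_sub_tendsto_zero]
  have h : Tendsto (fun q : H3 => 2 * √(q.t * p.t) * Real.sinh (dist q p / 2)) (𝓝 p)
      (𝓝 (2 * √(p.t * p.t) * Real.sinh (dist p p / 2))) := by
    apply Continuous.tendsto
    have := H3.continuous_t
    have h1 : Continuous fun q : H3 => dist q p := continuous_id.dist continuous_const
    exact (continuous_const.mul (this.mul continuous_const).sqrt).mul
      (Real.continuous_sinh.comp (h1.div_const 2))
  rw [dist_self, zero_div, Real.sinh_zero, mul_zero] at h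
  exact squeeze_zero (fun _ => norm_nonneg _) (fun q => H3.norm_sub_le q p) h

theorem H3.tendsto_nhds_iff {α : Type*} {l : Filter α} {f : α → H3} {p : H3} :
    Tendsto f l (𝓝 p) ↔ Tendsto (fun a => (f a).z) l (𝓝 p.z) ∧
      Tendsto (fun a => (f a).t) l (𝓝 p.t) := by
  refine ⟨fun h => ⟨(H3.continuous_z.tendsto p).comp h, (H3.continuous_t.tendsto p).comp h⟩, ?_⟩
  rintro ⟨hz, ht⟩
  rw [tendsto_iff_dist_tendsto_zero]
  simp only [H3.dist_def]
  have hp := p.pos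
  have h1 : Tendsto (fun a => √(‖(f a).z - p.z‖ ^ 2 + ((f a).t - p.t) ^ 2)) l
      (𝓝 √(‖p.z - p.z‖ ^ 2 + (p.t - p.t) ^ 2)) :=
    (((hz.sub tendsto_const_nhds).norm.pow 2).add ((ht.sub tendsto_const_nhds).pow 2)).sqrt
  have h2 : Tendsto (fun a => 2 * √((f a).t * p.t)) l (𝓝 (2 * √(p.t * p.t))) :=
    ((ht.mul_const _).sqrt).const_mul 2
  have h3 := ((h1.div h2 (by positivity)).arsinh).const_mul 2
  simpa using h3

theorem H3.isInducing_coords : IsInducing fun p : H3 => (p.z, p.t) := by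
  rw [isInducing_iff_nhds]
  intro p
  apply le_antisymm
  · exact (H3.continuous_z.prodMk H3.continuous_t).continuousAt.tendsto.le_comap
  · have : Tendsto (id : H3 → H3) (comap (fun p : H3 => (p.z, p.t)) (𝓝 (p.z, p.t))) (𝓝 p) := by
      rw [H3.tendsto_nhds_iff]
      have h : Tendsto (fun p : H3 => (p.z, p.t)) (comap (fun p : H3 => (p.z, p.t))
        (𝓝 (p.z, p.t))) (𝓝 (p.z, p.t)) := tendsto_comap
      exact ⟨(continuous_fst.tendsto _).comp h, (continuous_snd.tendsto _).comp h⟩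
    simpa [Tendsto] using this

theorem H3.continuous_iff {X : Type*} [TopologicalSpace X] {f : X → H3} :
    Continuous f ↔ Continuous (fun x => (f x).z) ∧ Continuous (fun x => (f x).t) := by
  rw [H3.isInducing_coords.continuous_iff]
  exact continuous_prodMk

/-- Euclidean boxes form a neighbourhood basis. -/
theorem H3.exists_box {p : H3} {U : Set H3} (hU : U ∈ 𝓝 p) :
    ∃ ε > 0, ∀ q : H3, ‖q.z - p.z‖ < ε → |q.t - p.t| < ε → q ∈ U := by
  rw [H3.isInducing_coords.nhds_eq_comap, Filter.mem_comap] at hU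
  obtain ⟨V, hV, hVU⟩ := hU
  obtain ⟨ε, hε, hb⟩ := Metric.mem_nhds_iff.mp hV
  refine ⟨ε, hε, fun q h1 h2 => hVU (hb ?_)⟩
  rw [Metric.mem_ball, Prod.dist_eq, max_lt_iff, dist_eq_norm, Real.dist_eq]
  exact ⟨h1, h2⟩

theorem H3.box_mem_nhds (p : H3) {ε : ℝ} (hε : 0 < ε) :
    {q : H3 | ‖q.z - p.z‖ < ε ∧ |q.t - p.t| < ε} ∈ 𝓝 p := by
  have h1 : Continuous fun q : H3 => ‖q.z - p.z‖ := (H3.continuous_z.sub continuous_const).norm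
  have h2 : Continuous fun q : H3 => |q.t - p.t| := (H3.continuous_t.sub continuous_const).abs
  exact ((isOpen_lt h1 continuous_const).inter (isOpen_lt h2 continuous_const)).mem_nhds
    (by simpa using hε)

instance : CompleteSpace H3 := by
  apply Metric.complete_of_cauchySeq_tendsto
  intro u hu
  have hlog : CauchySeq fun n => Real.log (u n).t := by
    rw [Metric.cauchySeq_iff] at hu ⊢
    intro ε hε
    obtain ⟨N, hN⟩ := hu ε hε
    exact ⟨N, fun m hm n hn =>
      lt_of_le_of_lt (H3.abs_log_sub_le_dist (u m) (u n)) (hN m hm n hn)⟩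
  obtain ⟨ℓ, hℓ⟩ := cauchySeq_tendsto_of_complete hlog
  have ht : Tendsto (fun n => (u n).t) atTop (𝓝 (Real.exp ℓ)) := by
    refine ((Real.continuous_exp.tendsto _).comp hℓ).congr fun n => ?_
    simp [Real.exp_log (u n).pos]
  obtain ⟨M, hM⟩ := ht.bddAbove_range
  have hM' : ∀ n, (u n).t ≤ M := fun n => hM ⟨n, rfl⟩
  have hM0 : 0 < M := (u 0).pos.trans_le (hM' 0)
  have hz : CauchySeq fun n => (u n).z := by
    rw [Metric.cauchySeq_iff] at hu ⊢
    intro ε hε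
    obtain ⟨N, hN⟩ := hu (2 * Real.arsinh (ε / (2 * M)))
      (mul_pos two_pos (Real.arsinh_pos_iff.mpr (by positivity)))
    refine ⟨N, fun m hm n hn => ?_⟩
    rw [dist_eq_norm]
    have h1 := H3.norm_sub_le (u m) (u n)
    have h2 : √((u m).t * (u n).t) ≤ M := by
      rw [Real.sqrt_le_left hM0.le]
      nlinarith [hM' m, hM' n, (u m).pos, (u n).pos]
    have h3 : Real.sinh (dist (u m) (u n) / 2) < ε / (2 * M) := by
      rw [← Real.arsinh_lt_arsinh, Real.arsinh_sinh]
      linarith [hN m hm n hn]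
    have h4 : 0 ≤ Real.sinh (dist (u m) (u n) / 2) := Real.sinh_nonneg_iff.mpr (by positivity)
    calc _ ≤ _ := h1
      _ ≤ 2 * M * Real.sinh (dist (u m) (u n) / 2) := by gcongr
      _ < 2 * M * (ε / (2 * M)) := by gcongr
      _ = ε := by field_simp
  obtain ⟨z, hz⟩ := cauchySeq_tendsto_of_complete hz
  exact ⟨⟨z, Real.exp ℓ, Real.exp_pos _⟩, H3.tendsto_nhds_iff.mpr ⟨hz, ht⟩⟩

/-! ### The path metric of a developing map -/

theorem pathDist_comm (dev : Cover → H3) (x y : Cover) :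
    pathDist dev x y = pathDist dev y x := by
  have key : ∀ x y, pathDist dev x y ≤ pathDist dev y x := by
    intro x y
    refine le_iInf fun γ => (iInf_le _ γ.symm).trans ?_
    unfold pathLength
    exact eVariationOn.comp_le_of_antitoneOn (fun s => dev (γ s)) unitInterval.symm
      (fun a _ b _ hab => by
        rw [unitInterval.symm_le_symm]
        exact hab) (mapsTo_univ _ _)
  exact le_antisymm (key x y) (key y x)

theorem pathDist_triangle (dev : Cover → H3) (x y w : Cover) :
    pathDist dev x w ≤ pathDist dev x y + pathDist dev y w := by
  unfold pathDist
  refine ENNReal.le_iInf_add_iInf fun γ γ' => (iInf_le _ (γ.trans γ')).trans ?_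
  unfold pathLength
  let m : unitInterval := ⟨1 / 2, by norm_num, by norm_num⟩
  have hu : (univ : Set unitInterval) = Iic m ∪ Ici m := Iic_union_Ici.symm
  have h := eVariationOn.union (fun s => dev (γ.trans γ' s)) (x := m) isGreatest_Iic isLeast_Ici
  rw [← hu] at h
  rw [h]
  gcongr
  · let φ : unitInterval → unitInterval := fun s => projIcc 0 1 zero_le_one (2 * (s : ℝ))
    rw [eVariationOn.congr (g := (fun s => dev (γ s)) ∘ φ)]
    · exact eVariationOn.comp_le_of_monotoneOn _ φ
        (fun a _ b _ hab => monotone_projIcc _ (by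
          have : (a : ℝ) ≤ b := hab
          linarith)) (mapsTo_univ _ _)
    · intro s hs
      have hs' : (s : ℝ) ≤ 1 / 2 := hs
      simp only [Path.trans_apply, hs', dif_pos, Function.comp_apply, φ]
      rw [projIcc_of_mem zero_le_one ⟨by linarith [s.2.1], by linarith⟩]
  · let φ : unitInterval → unitInterval := fun s => projIcc 0 1 zero_le_one (2 * (s : ℝ) - 1)
    rw [eVariationOn.congr (g := (fun s => dev (γ' s)) ∘ φ)]
    · exact eVariationOn.comp_le_of_monotoneOn _ φ
        (fun a _ b _ hab => monotone_projIcc _ (by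
          have : (a : ℝ) ≤ b := hab
          linarith)) (mapsTo_univ _ _)
    · intro s hs
      have hs' : 1 / 2 ≤ (s : ℝ) := hs
      simp only [Path.trans_apply, Function.comp_apply, φ]
      split_ifs with h
      · have h2 : (s : ℝ) = 1 / 2 := le_antisymm h hs'
        simp [h2, projIcc]
      · rw [projIcc_of_mem zero_le_one ⟨by linarith, by linarith [s.2.2]⟩]

theorem edist_le_pathDist (dev : Cover → H3) (x y : Cover) :
    edist (dev x) (dev y) ≤ pathDist dev x y := by
  refine le_iInf fun γ => ?_
  have h := eVariationOn.edist_le (fun s => dev (γ s)) (mem_univ (0 : unitInterval))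
    (mem_univ (1 : unitInterval))
  simp only [Path.source, Path.target] at h
  exact h

/-- A curve in `H3` of bounded speed that is lifted by a local section `σ` of the developing map
bounds the path distance of the ends of the lift. -/
theorem pathDist_le_of_lipschitz {dev : Cover → H3} {D : Set H3} {σ : H3 → Cover}
    (hσ : ContinuousOn σ D) (hdev : ∀ p ∈ D, dev (σ p) = p) {c : ℝ → H3} {K : ℝ≥0}
    (hc : ∀ s ∈ Icc (0 : ℝ) 1, ∀ s' ∈ Icc (0 : ℝ) 1, dist (c s) (c s') ≤ K * |s - s'|)
    (hD : ∀ s ∈ Icc (0 : ℝ) 1, c s ∈ D) :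
    pathDist dev (σ (c 0)) (σ (c 1)) ≤ K := by
  have hlip : LipschitzOnWith K c (Icc 0 1) :=
    LipschitzOnWith.of_dist_le_mul fun x hx y hy => hc x hx y hy
  let γ : Path (σ (c 0)) (σ (c 1)) :=
    { toFun := fun s => σ (c s)
      continuous_toFun := by
        have h := hσ.comp hlip.continuousOn hD
        exact continuousOn_iff_continuous_domRestrict.mp h
      source' := by simp
      target' := by simp }
  refine (iInf_le _ γ).trans ?_
  unfold pathLength
  have h1 : (fun s => dev (γ s)) = c ∘ (fun s : unitInterval => (s : ℝ)) := by
    ext1 s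
    exact hdev _ (hD s s.2)
  rw [h1]
  refine (hlip.comp_eVariationOn_le (g := fun s : unitInterval => (s : ℝ))
    (fun s _ => s.2)).trans ?_
  have hm : MonotoneOn (fun s : unitInterval => (s : ℝ)) univ := fun a _ b _ hab => hab
  have h2 := hm.eVariationOn_eq (mem_univ 0) (mem_univ 1)
  rw [univ_inter, show Icc (0 : unitInterval) 1 = univ from Icc_bot_top] at h2
  calc _ ≤ (K : ℝ≥0∞) * ENNReal.ofReal ((1 : unitInterval) - (0 : unitInterval) : ℝ) := by
        gcongr
        exact h2.le
    _ = K := by simp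

/-! ### Convex hulls of ideal points -/

@[simp] theorem light_infty : light OnePoint.infty = (1, 0, 0) := rfl

@[simp] theorem light_coe (w : ℂ) : light (w : Ideal) = (‖w‖ ^ 2, w, 1) := rfl

theorem mem_hull {p : H3} {V : Set Ideal} : p ∈ hull V ↔ p.vec ∈ Submodule.span ℝ≥0 (light '' V) :=
  Iff.rfl

theorem hull_mono {V W : Set Ideal} (h : V ⊆ W) : hull V ⊆ hull W :=
  fun _ hp => Submodule.span_mono (image_mono h) hp

/-- Horizontal translation of hyperbolic space. -/
def H3.translate (τ : ℂ) (p : H3) : H3 := ⟨p.z + τ, p.t, p.pos⟩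

@[simp] theorem H3.translate_z (τ : ℂ) (p : H3) : (p.translate τ).z = p.z + τ := rfl

theorem H3.translate_translate (τ τ' : ℂ) (p : H3) :
    (p.translate τ).translate τ' = p.translate (τ + τ') :=
  H3.ext (add_assoc _ _ _) rfl

theorem H3.translate_zero (p : H3) : p.translate 0 = p := H3.ext (add_zero _) rfl

/-- Extension of the translation by `τ` to the sphere at infinity; it fixes `∞`. -/
def idealTranslate (τ : ℂ) (a : Ideal) : Ideal := OnePoint.map (· + τ) a

@[simp] theorem idealTranslate_infty (τ : ℂ) :
    idealTranslate τ OnePoint.infty = OnePoint.infty := rfl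

@[simp] theorem idealTranslate_coe (τ w : ℂ) : idealTranslate τ (w : Ideal) = ((w + τ : ℂ) : Ideal)
    :=
  rfl

/-- Extension of the translation by `τ` to Minkowski space. -/
def minkTranslate (τ : ℂ) : Mink →ₗ[ℝ≥0] Mink where
  toFun x := (x.1 + 2 * (x.2.1 * (starRingEnd ℂ) τ).re + ‖τ‖ ^ 2 * x.2.2,
    x.2.1 + (x.2.2 : ℂ) * τ, x.2.2)
  map_add' x y := by
    ext <;> simp <;> ring
  map_smul' a x := by
    ext <;> simp [NNReal.smul_def] <;> ring

theorem norm_add_sq_complex (w τ : ℂ) :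
    ‖w + τ‖ ^ 2 = ‖w‖ ^ 2 + 2 * (w * (starRingEnd ℂ) τ).re + ‖τ‖ ^ 2 := by
  rw [← Complex.normSq_eq_norm_sq, Complex.normSq_add, Complex.normSq_eq_norm_sq,
    Complex.normSq_eq_norm_sq]
  ring

theorem minkTranslate_light (τ : ℂ) (a : Ideal) :
    minkTranslate τ (light a) = light (idealTranslate τ a) := by
  induction a using OnePoint.rec with
  | infty => simp [minkTranslate]
  | coe w => simp [minkTranslate, norm_add_sq_complex]

theorem minkTranslate_vec (τ : ℂ) (p : H3) : minkTranslate τ p.vec = (p.translate τ).vec := by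
  simp only [minkTranslate, H3.vec, LinearMap.coe_mk, AddHom.coe_mk, H3.translate,
    norm_add_sq_complex]
  ext <;> simp
  ring

theorem translate_mem_hull {τ : ℂ} {p : H3} {V : Set Ideal} (h : p ∈ hull V) :
    p.translate τ ∈ hull (idealTranslate τ '' V) := by
  rw [mem_hull] at h ⊢
  rw [← minkTranslate_vec]
  have h2 := Submodule.mem_map_of_mem (f := minkTranslate τ) h
  rw [Submodule.map_span, image_image] at h2
  rw [image_image]
  simpa only [minkTranslate_light] using h2

theorem idealTranslate_idealTranslate (τ τ' : ℂ) (a : Ideal) :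
    idealTranslate τ' (idealTranslate τ a) = idealTranslate (τ + τ') a := by
  induction a using OnePoint.rec with
  | infty => rfl
  | coe w => simp [add_assoc]

theorem idealTranslate_zero (a : Ideal) : idealTranslate 0 a = a := by
  induction a using OnePoint.rec with
  | infty => rfl
  | coe w => simp

theorem hull_idealTranslate (τ : ℂ) (V : Set Ideal) :
    hull (idealTranslate τ '' V) = H3.translate τ '' hull V := by
  ext p
  constructor
  · intro h
    refine ⟨p.translate (-τ), ?_, by simp [H3.translate_translate, H3.translate_zero]⟩
    have h2 := translate_mem_hull (τ := -τ) h
    simpa [image_image, idealTranslate_idealTranslate, idealTranslate_zero] using h2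
  · rintro ⟨q, hq, rfl⟩
    exact translate_mem_hull hq

theorem mem_hull_infty_coe {p : H3} {a : ℂ} : p ∈ hull {OnePoint.infty, (a : Ideal)} ↔ p.z = a := by
  have hp := p.pos
  simp only [mem_hull, image_pair, light_infty, light_coe, Submodule.mem_span_pair, H3.vec,
    NNReal.smul_def, Prod.smul_mk, Prod.mk_add_mk, Prod.mk.injEq, smul_eq_mul, smul_zero, zero_add,
    mul_one, Complex.real_smul]
  constructor
  · rintro ⟨r, s, -, h2, h3⟩
    rw [← h2, h3]
    simp
  · intro h
    refine ⟨(p.t ^ 2).toNNReal, 1, ?_, ?_, ?_⟩ <;> simp [h, sq_nonneg]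
    ring

theorem mem_hull_coe_coe {p : H3} {a b : ℂ} : p ∈ hull {(a : Ideal), (b : Ideal)} ↔
    ∃ s ∈ Icc (0 : ℝ) 1, p.z = a + s * (b - a) ∧ p.t ^ 2 = s * (1 - s) * ‖b - a‖ ^ 2 := by
  have hp := p.pos
  have key : ∀ s : ℝ, ‖a + s * (b - a)‖ ^ 2 + s * (1 - s) * ‖b - a‖ ^ 2
      = (1 - s) * ‖a‖ ^ 2 + s * ‖b‖ ^ 2 := by
    intro s
    simp only [← Complex.normSq_eq_norm_sq, Complex.normSq_apply, Complex.add_re, Complex.mul_re,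
      Complex.sub_re, Complex.ofReal_re, Complex.ofReal_im, Complex.add_im, Complex.mul_im,
      Complex.sub_im]
    ring
  simp only [mem_hull, image_pair, light_coe, Submodule.mem_span_pair, H3.vec,
    NNReal.smul_def, Prod.smul_mk, Prod.mk_add_mk, Prod.mk.injEq, smul_eq_mul, mul_one,
    Complex.real_smul]
  constructor
  · rintro ⟨r, s, h1, h2, h3⟩
    have h4 : (r : ℝ) = 1 - s := by linarith
    have h5 : p.z = a + (s : ℝ) * (b - a) := by
      rw [← h2, h4]
      push_cast
      ring
    refine ⟨s, ⟨s.2, by linarith [r.2]⟩, h5, ?_⟩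
    have h6 := key s
    rw [← h5] at h6
    rw [h4] at h1
    linarith
  · rintro ⟨s, ⟨hs0, hs1⟩, h1, h2⟩
    refine ⟨(1 - s).toNNReal, s.toNNReal, ?_, ?_, ?_⟩ <;>
      rw [Real.coe_toNNReal _ (by linarith), Real.coe_toNNReal _ hs0]
    · have h6 := key s
      rw [← h1] at h6
      linarith
    · rw [h1]
      push_cast
      ring
    · ring

theorem exists_mem_hull_coe_coe {a b : ℂ} (hab : a ≠ b) {s : ℝ} (hs0 : 0 < s) (hs1 : s < 1) :
    ∃ p ∈ hull {(a : Ideal), (b : Ideal)}, p.z = a + s * (b - a) ∧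
      p.t ^ 2 = s * (1 - s) * ‖b - a‖ ^ 2 := by
  have h0 : 0 < ‖b - a‖ := norm_pos_iff.mpr (sub_ne_zero.mpr hab.symm)
  have h1 : 0 < 1 - s := by linarith
  refine ⟨⟨a + s * (b - a), √(s * (1 - s) * ‖b - a‖ ^ 2), by positivity⟩, ?_, rfl,
    Real.sq_sqrt (by positivity)⟩
  exact mem_hull_coe_coe.mpr ⟨s, ⟨hs0.le, hs1.le⟩, rfl, Real.sq_sqrt (by positivity)⟩

theorem hull_infty_coe_ne {a b c : ℂ} : hull {OnePoint.infty, (a : Ideal)} ≠ hull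
    {(b : Ideal), (c : Ideal)} := by
  intro h
  have h1 : (⟨a, ‖c - b‖ + 1, by positivity⟩ : H3) ∈ hull {OnePoint.infty, (a : Ideal)} :=
    mem_hull_infty_coe.mpr rfl
  rw [h, mem_hull_coe_coe] at h1
  obtain ⟨s, ⟨hs0, hs1⟩, -, h2⟩ := h1
  nlinarith [norm_nonneg (c - b), mul_nonneg hs0 hs0, sq_nonneg ‖c - b‖]

theorem pair_eq_of_hull_coe_eq {a b a' b' : ℂ} (hab : a ≠ b) (hab' : a' ≠ b')
    (h : hull {(a : Ideal), (b : Ideal)} = hull {(a' : Ideal), (b' : Ideal)}) :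
    a = a' ∧ b = b' ∨ a = b' ∧ b = a' := by
  -- the midpoint of the half-circle is its highest point, so both radii and both centres agree
  have key : ∀ {a b a' b' : ℂ}, a ≠ b →
      hull {(a : Ideal), (b : Ideal)} = hull {(a' : Ideal), (b' : Ideal)} →
      ‖b - a‖ ^ 2 ≤ ‖b' - a'‖ ^ 2 := by
    intro a b a' b' hab h
    obtain ⟨p, hp, -, h2⟩ := exists_mem_hull_coe_coe hab (s := 1 / 2) (by norm_num) (by norm_num)
    rw [h, mem_hull_coe_coe] at hp
    obtain ⟨s, -, -, h4⟩ := hp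
    nlinarith [mul_nonneg (sq_nonneg (2 * s - 1)) (sq_nonneg ‖b' - a'‖)]
  have hd := le_antisymm (key hab h) (key hab' h.symm)
  have hpos : 0 < ‖b' - a'‖ ^ 2 := by
    have := norm_pos_iff.mpr (sub_ne_zero.mpr hab'.symm)
    positivity
  obtain ⟨p, hp, h1, h2⟩ := exists_mem_hull_coe_coe hab (s := 1 / 2) (by norm_num) (by norm_num)
  rw [h, mem_hull_coe_coe] at hp
  obtain ⟨s, -, h3, h4⟩ := hp
  have hs : s = 1 / 2 := by
    rw [h2, hd] at h4
    have : (1 / 2 * (1 - 1 / 2) - s * (1 - s)) * ‖b' - a'‖ ^ 2 = 0 := by linarith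
    rcases mul_eq_zero.mp this with h5 | h5
    · nlinarith
    · exact absurd h5 hpos.ne'
  rw [h1, hs] at h3
  -- a further point determines the direction
  obtain ⟨p, hp, h1, h2⟩ := exists_mem_hull_coe_coe hab (s := 1 / 4) (by norm_num) (by norm_num)
  rw [h, mem_hull_coe_coe] at hp
  obtain ⟨r, -, h6, h4⟩ := hp
  have hr : r = 1 / 4 ∨ r = 3 / 4 := by
    rw [h2, hd] at h4
    have : (1 / 4 * (1 - 1 / 4) - r * (1 - r)) * ‖b' - a'‖ ^ 2 = 0 := by linarith
    rcases mul_eq_zero.mp this with h5 | h5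
    · have : (r - 1 / 4) * (r - 3 / 4) = 0 := by linarith
      rcases mul_eq_zero.mp this with h | h
      · left; linarith
      · right; linarith
    · exact absurd h5 hpos.ne'
  rw [h1] at h6
  push_cast at h3 h6
  rcases hr with rfl | rfl
  · left
    push_cast at h6
    constructor
    · linear_combination 2 * h6 - h3
    · linear_combination 3 * h3 - 2 * h6
  · right
    push_cast at h6
    constructor
    · linear_combination 2 * h6 - h3
    · linear_combination 3 * h3 - 2 * h6

/-- A geodesic determines its pair of ends. -/
theorem pair_eq_of_hull_eq {q r q' r' : Ideal} (hqr : q ≠ r) (hqr' : q' ≠ r')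
    (h : hull {q, r} = hull {q', r'}) : ({q, r} : Set Ideal) = {q', r'} := by
  have key : ∀ {a : ℂ} {q r : Ideal}, q ≠ r → hull {OnePoint.infty, (a : Ideal)} = hull {q, r} →
      ({OnePoint.infty, (a : Ideal)} : Set Ideal) = {q, r} := by
    have key2 : ∀ {a b : ℂ},
        hull {OnePoint.infty, (a : Ideal)} = hull {OnePoint.infty, (b : Ideal)} → a = b := by
      intro a b h
      have h1 : (⟨a, 1, one_pos⟩ : H3) ∈ hull {OnePoint.infty, (a : Ideal)} :=
        mem_hull_infty_coe.mpr rfl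
      rw [h, mem_hull_infty_coe] at h1
      exact h1
    intro a q r hqr h
    induction q using OnePoint.rec with
    | infty =>
      induction r using OnePoint.rec with
      | infty => exact absurd rfl hqr
      | coe b => rw [key2 h]
    | coe b =>
      induction r using OnePoint.rec with
      | infty =>
        rw [pair_comm (b : Ideal)] at h ⊢
        rw [key2 h]
      | coe c => exact absurd h hull_infty_coe_ne
  induction q using OnePoint.rec with
  | infty =>
    induction r using OnePoint.rec with
    | infty => exact absurd rfl hqr
    | coe b => exact key hqr' h
  | coe a =>
    induction r using OnePoint.rec with
    | infty =>
      rw [pair_comm (a : Ideal)] at h ⊢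
      exact key hqr' h
    | coe b =>
      induction q' using OnePoint.rec with
      | infty =>
        induction r' using OnePoint.rec with
        | infty => exact absurd rfl hqr'
        | coe c => exact (key hqr h.symm).symm
      | coe c =>
        induction r' using OnePoint.rec with
        | infty =>
          rw [pair_comm (c : Ideal)] at h ⊢
          exact (key hqr h.symm).symm
        | coe d =>
          rcases pair_eq_of_hull_coe_eq (by simpa using hqr) (by simpa using hqr') h with
            ⟨rfl, rfl⟩ | ⟨rfl, rfl⟩
          · rfl
          · rw [pair_comm]

/-! ### Lattices of ideal points and barycentric weights -/

/-- A lattice `c + ℤ u + ℤ v` in `ℂ` with a chosen basis. -/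
@[ext]
structure Frame where
  /-- the origin -/
  c : ℂ
  /-- the first basis vector -/
  u : ℂ
  /-- the second basis vector -/
  v : ℂ
  cross_ne : u.re * v.im - u.im * v.re ≠ 0

namespace Frame

/-- The point of `ℂ` with the given real coordinates in the frame. -/
def pt (F : Frame) (q : ℝ × ℝ) : ℂ := F.c + q.1 * F.u + q.2 * F.v

/-- The real coordinates of a point of `ℂ`, by Cramer's rule. -/
def crd (F : Frame) (z : ℂ) : ℝ × ℝ :=
  (((z - F.c).re * F.v.im - (z - F.c).im * F.v.re) / (F.u.re * F.v.im - F.u.im * F.v.re),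
    (F.u.re * (z - F.c).im - F.u.im * (z - F.c).re) / (F.u.re * F.v.im - F.u.im * F.v.re))

theorem crd_pt (F : Frame) (q : ℝ × ℝ) : F.crd (F.pt q) = q := by
  have h := F.cross_ne
  ext <;> simp only [crd, pt] <;> rw [div_eq_iff h] <;> simp <;> ring

theorem pt_crd (F : Frame) (z : ℂ) : F.pt (F.crd z) = z := by
  have h := mul_inv_cancel₀ F.cross_ne
  apply Complex.ext <;> simp only [crd, pt, Complex.add_re, Complex.add_im, Complex.mul_re,
    Complex.mul_im, Complex.ofReal_re, Complex.ofReal_im, Complex.sub_re, Complex.sub_im,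
    div_eq_mul_inv]
  · linear_combination (z.re - F.c.re) * h
  · linear_combination (z.im - F.c.im) * h

theorem pt_injective (F : Frame) : Function.Injective F.pt := fun q q' h => by
  rw [← F.crd_pt q, h, F.crd_pt]

theorem continuous_pt (F : Frame) : Continuous F.pt := by
  unfold pt
  fun_prop

theorem continuous_crd (F : Frame) : Continuous F.crd := by
  have := Complex.continuous_re
  have := Complex.continuous_im
  unfold crd
  fun_prop

/-- The inner product of the two basis vectors. -/
def inn (F : Frame) : ℝ := F.u.re * F.v.re + F.u.im * F.v.im

/-- The squared length of `q.1 u + q.2 v`. -/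
def quad (F : Frame) (q : ℝ × ℝ) : ℝ :=
  Complex.normSq F.u * q.1 ^ 2 + 2 * F.inn * q.1 * q.2 + Complex.normSq F.v * q.2 ^ 2

theorem quad_eq (F : Frame) (q : ℝ × ℝ) : F.quad q = ‖(q.1 : ℂ) * F.u + q.2 * F.v‖ ^ 2 := by
  rw [← Complex.normSq_eq_norm_sq]
  simp [quad, inn, Complex.normSq_apply]
  ring

theorem u_ne_zero (F : Frame) : F.u ≠ 0 := fun h => F.cross_ne (by simp [h])

theorem quad_pos (F : Frame) {q : ℝ × ℝ} (hq : q ≠ 0) : 0 < F.quad q := by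
  rw [quad_eq]
  have h : (q.1 : ℂ) * F.u + q.2 * F.v ≠ 0 := by
    intro h
    apply hq
    apply F.pt_injective
    have : F.pt (0 : ℝ × ℝ) = F.c := by simp [pt]
    rw [this, pt, add_assoc, h, add_zero]
  have := norm_pos_iff.mpr h
  positivity

theorem norm_pt_sq (F : Frame) (q : ℝ × ℝ) : ‖F.pt q‖ ^ 2 =
    F.quad q + ‖F.c‖ ^ 2 + 2 * (F.c.re * F.u.re + F.c.im * F.u.im) * q.1 +
      2 * (F.c.re * F.v.re + F.c.im * F.v.im) * q.2 := by
  rw [← Complex.normSq_eq_norm_sq, ← Complex.normSq_eq_norm_sq]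
  simp [quad, inn, pt, Complex.normSq_apply]
  ring

/-- The real coordinates of a lattice point. -/
def cast (w : ℤ × ℤ) : ℝ × ℝ := (w.1, w.2)

theorem cast_injective : Function.Injective cast := fun w w' h => by
  simp only [cast, Prod.mk.injEq, Int.cast_inj] at h
  exact Prod.ext h.1 h.2

theorem cast_add (w w' : ℤ × ℤ) : cast (w + w') = cast w + cast w' := by
  simp [cast]

/-- The ideal points of the frame: the lattice points, and `none` stands for `∞`. -/
def ideal (F : Frame) : Option (ℤ × ℤ) → Ideal
  | none => OnePoint.infty
  | some w => ((F.pt (cast w) : ℂ) : Ideal)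

@[simp] theorem ideal_none (F : Frame) : F.ideal none = OnePoint.infty := rfl

@[simp] theorem ideal_some (F : Frame) (w : ℤ × ℤ) :
    F.ideal (some w) = ((F.pt (cast w) : ℂ) : Ideal) := rfl

theorem ideal_injective (F : Frame) : Function.Injective F.ideal := by
  rintro (_ | w) (_ | w') h
  · rfl
  · simp at h
  · simp at h
  · simp only [ideal_some, OnePoint.coe_eq_coe] at h
    rw [cast_injective (F.pt_injective h)]

/-- The mass of a vertex: `∞` counts as a direction, not as a point. -/
def mass : Option (ℤ × ℤ) → ℝ
  | none => 0
  | some _ => 1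

/-- First coordinate of a vertex. -/
def posX : Option (ℤ × ℤ) → ℝ
  | none => 0
  | some w => w.1

/-- Second coordinate of a vertex. -/
def posY : Option (ℤ × ℤ) → ℝ
  | none => 0
  | some w => w.2

/-- Height of a vertex in the affine model in which hyperbolic space is the region above the
paraboloid `s = quad`; the ideal point `∞` is the vertical direction. -/
def energy (F : Frame) : Option (ℤ × ℤ) → ℝ
  | none => 1
  | some w => F.quad (cast w)

theorem light_ideal (F : Frame) (o : Option (ℤ × ℤ)) : light (F.ideal o) =
    (F.energy o + mass o * ‖F.c‖ ^ 2 + 2 * (F.c.re * F.u.re + F.c.im * F.u.im) * posX o +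
      2 * (F.c.re * F.v.re + F.c.im * F.v.im) * posY o,
      mass o * F.c + posX o * F.u + posY o * F.v, mass o) := by
  cases o with
  | none => simp [mass, posX, posY, energy]
  | some w =>
    rw [ideal_some, light_coe, norm_pt_sq]
    simp [mass, posX, posY, energy, pt, cast]

/-- The function `a` is a system of barycentric weights, supported on the set `S` of vertices, of
the point `p` of hyperbolic space. -/
structure Rep (F : Frame) (a : Option (ℤ × ℤ) → ℝ) (S : Finset (Option (ℤ × ℤ))) (p : H3) : Prop
    where
  nonneg : ∀ o, 0 ≤ a o
  supp : ∀ o ∉ S, a o = 0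
  mass_eq : ∑ o ∈ S, a o * mass o = 1
  posX_eq : ∑ o ∈ S, a o * posX o = (F.crd p.z).1
  posY_eq : ∑ o ∈ S, a o * posY o = (F.crd p.z).2
  energy_eq : ∑ o ∈ S, a o * F.energy o = F.quad (F.crd p.z) + p.t ^ 2

theorem rep_iff (F : Frame) {a : Option (ℤ × ℤ) → ℝ} {S : Finset (Option (ℤ × ℤ))} {p : H3} :
    F.Rep a S p ↔ (∀ o, 0 ≤ a o) ∧ (∀ o ∉ S, a o = 0) ∧
      ∑ o ∈ S, a o • light (F.ideal o) = p.vec := by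
  have hsum : ∑ o ∈ S, a o • light (F.ideal o) =
      ((∑ o ∈ S, a o * F.energy o) + (∑ o ∈ S, a o * mass o) * ‖F.c‖ ^ 2 +
        2 * (F.c.re * F.u.re + F.c.im * F.u.im) * (∑ o ∈ S, a o * posX o) +
        2 * (F.c.re * F.v.re + F.c.im * F.v.im) * (∑ o ∈ S, a o * posY o),
      ((∑ o ∈ S, a o * mass o : ℝ) : ℂ) * F.c + ((∑ o ∈ S, a o * posX o : ℝ) : ℂ) * F.u +
        ((∑ o ∈ S, a o * posY o : ℝ) : ℂ) * F.v, ∑ o ∈ S, a o * mass o) := by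
    simp only [light_ideal]
    refine Prod.ext ?_ (Prod.ext ?_ ?_) <;> simp only [Prod.fst_sum, Prod.snd_sum, Prod.smul_fst,
      Prod.smul_snd, smul_eq_mul, Complex.real_smul]
    · simp only [Finset.mul_sum, Finset.sum_mul, ← Finset.sum_add_distrib]
      exact Finset.sum_congr rfl fun o _ => by ring
    · push_cast
      simp only [Finset.sum_mul, ← Finset.sum_add_distrib]
      exact Finset.sum_congr rfl fun o _ => by ring
  have hvec : p.vec = (F.quad (F.crd p.z) + p.t ^ 2 + 1 * ‖F.c‖ ^ 2 +
        2 * (F.c.re * F.u.re + F.c.im * F.u.im) * (F.crd p.z).1 +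
        2 * (F.c.re * F.v.re + F.c.im * F.v.im) * (F.crd p.z).2,
      ((1 : ℝ) : ℂ) * F.c + ((F.crd p.z).1 : ℂ) * F.u + ((F.crd p.z).2 : ℂ) * F.v, 1) := by
    have h1 := F.norm_pt_sq (F.crd p.z)
    have h2 := F.pt_crd p.z
    rw [h2] at h1
    rw [H3.vec, h1]
    refine Prod.ext ?_ (Prod.ext ?_ rfl)
    · simp only
      ring
    · conv_lhs => rw [← h2]
      simp [pt]
  constructor
  · rintro ⟨h1, h2, h3, h4, h5, h6⟩
    refine ⟨h1, h2, ?_⟩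
    rw [hsum, hvec, h3, h4, h5, h6]
  · rintro ⟨h1, h2, h3⟩
    rw [hsum, hvec, Prod.mk.injEq, Prod.mk.injEq] at h3
    obtain ⟨h3, h4, h5⟩ := h3
    rw [h5] at h3 h4
    have h6 : F.pt (∑ o ∈ S, a o * posX o, ∑ o ∈ S, a o * posY o) = F.pt (F.crd p.z) := by
      simpa only [pt, Complex.ofReal_one, one_mul] using h4
    have h7 := F.pt_injective h6
    have h8 := congrArg Prod.fst h7
    have h9 := congrArg Prod.snd h7
    simp only at h8 h9
    refine ⟨h1, h2, h5, h8, h9, ?_⟩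
    rw [h8, h9] at h3
    linarith

theorem mem_hull_iff (F : Frame) {S : Finset (Option (ℤ × ℤ))} {p : H3} :
    p ∈ hull (F.ideal '' S) ↔ ∃ a, F.Rep a S p := by
  rw [mem_hull, image_image, Submodule.mem_span_image_finset_iff_exists_fun']
  simp only [rep_iff]
  constructor
  · rintro ⟨c, hc⟩
    refine ⟨fun o => if o ∈ S then (c o : ℝ) else 0, fun o => ?_, fun o ho => by simp [ho], ?_⟩
    · dsimp only
      split_ifs
      · exact (c o).2
      · exact le_rfl
    · rw [← hc]
      exact Finset.sum_congr rfl fun o ho => by simp [ho, NNReal.smul_def]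
  · rintro ⟨a, h1, -, h3⟩
    refine ⟨fun o => (a o).toNNReal, ?_⟩
    rw [← h3]
    exact Finset.sum_congr rfl fun o _ => by rw [NNReal.smul_def, Real.coe_toNNReal _ (h1 o)]

theorem Rep.mem_hull {F : Frame} {a : Option (ℤ × ℤ) → ℝ} {S : Finset (Option (ℤ × ℤ))} {p : H3}
    (h : F.Rep a S p) : p ∈ hull (F.ideal '' S) := F.mem_hull_iff.mpr ⟨a, h⟩

theorem Rep.sum_eq {F : Frame} {a : Option (ℤ × ℤ) → ℝ} {S T : Finset (Option (ℤ × ℤ))} {p : H3}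
    (h : F.Rep a S p) (hT : ∀ o ∉ T, a o = 0) (g : Option (ℤ × ℤ) → ℝ) :
    ∑ o ∈ T, a o * g o = ∑ o ∈ S, a o * g o := by
  have h1 := Finset.sum_subset (f := fun o => a o * g o)
    (Finset.subset_union_left (s₁ := T) (s₂ := S)) fun o _ ho => by simp [hT o ho]
  have h2 := Finset.sum_subset (f := fun o => a o * g o)
    (Finset.subset_union_right (s₁ := T) (s₂ := S)) fun o _ ho => by simp [h.supp o ho]
  rw [h1, h2]

theorem Rep.of_supp {F : Frame} {a : Option (ℤ × ℤ) → ℝ} {S T : Finset (Option (ℤ × ℤ))} {p : H3}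
    (h : F.Rep a S p) (hT : ∀ o ∉ T, a o = 0) : F.Rep a T p where
  nonneg := h.nonneg
  supp := hT
  mass_eq := by rw [h.sum_eq hT, h.mass_eq]
  posX_eq := by rw [h.sum_eq hT, h.posX_eq]
  posY_eq := by rw [h.sum_eq hT, h.posY_eq]
  energy_eq := by rw [h.sum_eq hT, h.energy_eq]

theorem Rep.mono {F : Frame} {a : Option (ℤ × ℤ) → ℝ} {S T : Finset (Option (ℤ × ℤ))} {p : H3}
    (h : F.Rep a S p) (hST : S ⊆ T) : F.Rep a T p :=
  h.of_supp fun o ho => h.supp o fun h' => ho (hST h')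

theorem Rep.inter {F : Frame} {a : Option (ℤ × ℤ) → ℝ} {S T : Finset (Option (ℤ × ℤ))} {p : H3}
    (h : F.Rep a S p) (h' : F.Rep a T p) : F.Rep a (S ∩ T) p := by
  refine h.of_supp fun o ho => ?_
  by_cases hS : o ∈ S
  · exact h'.supp o fun hT => ho (Finset.mem_inter.mpr ⟨hS, hT⟩)
  · exact h.supp o hS

theorem crd_z_unique {F : Frame} {q : ℝ × ℝ} {p : H3} (h : p.z = F.pt q) : F.crd p.z = q := by
  rw [h, crd_pt]

end Frame

/-! ### The piecewise hemispherical surface over a lattice triangulation -/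

/-- The gap `x ↦ {x} (1 - {x})` between `x ^ 2` and its piecewise linear interpolation at the
integers. -/
def bump (x : ℝ) : ℝ := Int.fract x * (1 - Int.fract x)

theorem bump_nonneg (x : ℝ) : 0 ≤ bump x :=
  mul_nonneg (Int.fract_nonneg x) (by linarith [Int.fract_lt_one x])

theorem bump_le_one (x : ℝ) : bump x ≤ 1 := by
  unfold bump
  nlinarith [Int.fract_nonneg x, Int.fract_lt_one x]

theorem bump_int_add (n : ℤ) {a : ℝ} (h0 : 0 ≤ a) (h1 : a ≤ 1) : bump (n + a) = a * (1 - a) := by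
  rw [bump, Int.fract_intCast_add]
  rcases h1.lt_or_eq with h | rfl
  · rw [Int.fract_eq_self.mpr ⟨h0, h⟩]
  · simp

theorem bump_neg (x : ℝ) : bump (-x) = bump x := by
  have h := bump_int_add (-⌊x⌋ - 1) (a := 1 - Int.fract x) (by linarith [Int.fract_lt_one x])
    (by linarith [Int.fract_nonneg x])
  have h2 : ((-⌊x⌋ - 1 : ℤ) : ℝ) + (1 - Int.fract x) = -x := by
    rw [Int.fract]
    push_cast
    ring
  rw [h2] at h
  rw [h, bump]
  ring

theorem continuous_bump : Continuous bump := by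
  have h : ContinuousOn (fun a : ℝ => a * (1 - a)) (Icc 0 1) := by fun_prop
  exact h.comp_fract'' (by norm_num)

namespace Frame

/-- Barycentric coordinates, with respect to the finite set `S` of lattice points, of the point
with coordinates `q`. -/
structure Bary (a : ℤ × ℤ → ℝ) (S : Finset (ℤ × ℤ)) (q : ℝ × ℝ) : Prop where
  nonneg : ∀ w, 0 ≤ a w
  supp : ∀ w ∉ S, a w = 0
  sum_eq : ∑ w ∈ S, a w = 1
  fst_eq : ∑ w ∈ S, a w * w.1 = q.1
  snd_eq : ∑ w ∈ S, a w * w.2 = q.2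

theorem Bary.sum_of_supp {a : ℤ × ℤ → ℝ} {S T : Finset (ℤ × ℤ)} {q : ℝ × ℝ} (h : Bary a S q)
    (hT : ∀ w ∉ T, a w = 0) (g : ℤ × ℤ → ℝ) : ∑ w ∈ T, a w * g w = ∑ w ∈ S, a w * g w := by
  have h1 := Finset.sum_subset (f := fun o => a o * g o)
    (Finset.subset_union_left (s₁ := T) (s₂ := S)) fun o _ ho => by simp [hT o ho]
  have h2 := Finset.sum_subset (f := fun o => a o * g o)
    (Finset.subset_union_right (s₁ := T) (s₂ := S)) fun o _ ho => by simp [h.supp o ho]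
  rw [h1, h2]

theorem Bary.of_supp {a : ℤ × ℤ → ℝ} {S T : Finset (ℤ × ℤ)} {q : ℝ × ℝ} (h : Bary a S q)
    (hT : ∀ w ∉ T, a w = 0) : Bary a T q where
  nonneg := h.nonneg
  supp := hT
  sum_eq := by
    have := h.sum_of_supp hT fun _ => 1
    simp only [mul_one] at this
    rw [this, h.sum_eq]
  fst_eq := by rw [h.sum_of_supp hT, h.fst_eq]
  snd_eq := by rw [h.sum_of_supp hT, h.snd_eq]

theorem Bary.mono {a : ℤ × ℤ → ℝ} {S T : Finset (ℤ × ℤ)} {q : ℝ × ℝ} (h : Bary a S q)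
    (hST : S ⊆ T) : Bary a T q :=
  h.of_supp fun o ho => h.supp o fun h' => ho (hST h')

theorem mem_convexHull_iff {S : Finset (ℤ × ℤ)} {q : ℝ × ℝ} :
    q ∈ convexHull ℝ (cast '' S) ↔ ∃ a, Bary a S q := by
  have h : cast '' S = ((S.map ⟨cast, cast_injective⟩ : Finset (ℝ × ℝ)) : Set (ℝ × ℝ)) := by simp
  rw [h, Finset.mem_convexHull']
  simp only [Finset.sum_map, Function.Embedding.coeFn_mk, Finset.forall_mem_map]
  constructor
  · rintro ⟨w, h1, h2, h3⟩
    have hs : ∀ g : ℤ × ℤ → ℝ, ∑ x ∈ S, (if x ∈ S then w (cast x) else 0) * g x =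
        ∑ x ∈ S, w (cast x) * g x := fun g => Finset.sum_congr rfl fun x hx => by simp [hx]
    refine ⟨fun x => if x ∈ S then w (cast x) else 0, fun x => ?_, fun x hx => by simp [hx], ?_, ?_,
        ?_⟩
    · split_ifs with hx
      · exact h1 x hx
      · exact le_rfl
    · simpa only [mul_one, h2] using hs fun _ => 1
    · rw [hs, ← h3]
      simp [Prod.fst_sum, cast]
    · rw [hs, ← h3]
      simp [Prod.snd_sum, cast]
  · rintro ⟨a, h1, -, h3, h4, h5⟩
    have hinv : ∀ x, a (Function.invFun cast (cast x)) = a x := fun x => by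
      rw [Function.leftInverse_invFun cast_injective x]
    refine ⟨fun x => a (Function.invFun cast x), fun x _ => h1 _, by simp only [hinv, h3], ?_⟩
    simp only [hinv]
    ext
    · simpa [Prod.fst_sum, cast] using h4
    · simpa [Prod.snd_sum, cast] using h5

/-- The finite vertices `S`, as elements of `Option (ℤ × ℤ)`. -/
def face (S : Finset (ℤ × ℤ)) : Finset (Option (ℤ × ℤ)) := S.map Function.Embedding.some

/-- The vertices `S` together with `∞`. -/
def cone (S : Finset (ℤ × ℤ)) : Finset (Option (ℤ × ℤ)) := Finset.insertNone S

@[simp] theorem some_mem_face {S : Finset (ℤ × ℤ)} {w : ℤ × ℤ} : some w ∈ face S ↔ w ∈ S := by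
  simp [face]

@[simp] theorem none_notMem_face {S : Finset (ℤ × ℤ)} : none ∉ face S := by simp [face]

@[simp] theorem some_mem_cone {S : Finset (ℤ × ℤ)} {w : ℤ × ℤ} : some w ∈ cone S ↔ w ∈ S := by
  simp [cone]

@[simp] theorem none_mem_cone {S : Finset (ℤ × ℤ)} : none ∈ cone S := by simp [cone]

theorem face_subset_cone (S : Finset (ℤ × ℤ)) : face S ⊆ cone S := by
  rintro (_ | w) <;> simp

theorem mem_hull_face (F : Frame) {S : Finset (ℤ × ℤ)} {p : H3} : p ∈ hull (F.ideal '' face S) ↔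
    ∃ a, Bary a S (F.crd p.z) ∧ ∑ w ∈ S, a w * F.quad (cast w) = F.quad (F.crd p.z) + p.t ^ 2 := by
  rw [F.mem_hull_iff]
  constructor
  · rintro ⟨a, h1, h2, h3, h4, h5, h6⟩
    simp only [face, Finset.sum_map, Function.Embedding.some_apply, mass, posX, posY, energy,
      mul_one] at h3 h4 h5 h6
    exact ⟨fun w => a (some w), ⟨fun w => h1 _, fun w hw => h2 _ (by simpa using hw), h3, h4, h5⟩,
        h6⟩
  · rintro ⟨a, ⟨h1, h2, h3, h4, h5⟩, h6⟩
    refine ⟨fun o => o.elim 0 a, ?_, ?_, ?_, ?_, ?_, ?_⟩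
    · rintro (_ | w)
      · exact le_rfl
      · exact h1 w
    · rintro (_ | w) hw
      · rfl
      · exact h2 w (by simpa using hw)
    all_goals simpa only [face, Finset.sum_map, Function.Embedding.some_apply, mass, posX, posY,
      energy, mul_one, Option.elim_some]

theorem mem_hull_cone (F : Frame) {S : Finset (ℤ × ℤ)} {p : H3} : p ∈ hull (F.ideal '' cone S) ↔
    ∃ a, Bary a S (F.crd p.z) ∧ ∑ w ∈ S, a w * F.quad (cast w) ≤ F.quad (F.crd p.z) + p.t ^ 2 := by
  rw [F.mem_hull_iff]
  constructor
  · rintro ⟨a, h1, h2, h3, h4, h5, h6⟩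
    simp only [cone, Finset.sum_insertNone, mass, posX, posY, energy, mul_one, mul_zero,
      zero_add] at h3 h4 h5 h6
    exact ⟨fun w => a (some w), ⟨fun w => h1 _, fun w hw => h2 _ (by simpa using hw), h3, h4, h5⟩,
      by linarith [h1 none]⟩
  · rintro ⟨a, ⟨h1, h2, h3, h4, h5⟩, h6⟩
    refine ⟨fun o => o.elim (F.quad (F.crd p.z) + p.t ^ 2 - ∑ w ∈ S, a w * F.quad (cast w)) a,
      ?_, ?_, ?_, ?_, ?_, ?_⟩
    · rintro (_ | w)
      · simpa using h6
      · exact h1 w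
    · rintro (_ | w) hw
      · simp at hw
      · exact h2 w (by simpa using hw)
    all_goals simp only [cone, Finset.sum_insertNone, mass, posX, posY,
      energy, mul_one, mul_zero, zero_add, Option.elim_some, Option.elim_none, sub_add_cancel]
    exacts [h3, h4, h5]

/-- The vertices of the lattice triangle with vertices `w`, `w + u`, `w + u + (v - i u)`. -/
def triUp (i : ℤ) (w : ℤ × ℤ) : Finset (ℤ × ℤ) := {w, w + (1, 0), w + (1 - i, 1)}

/-- The vertices of the lattice triangle with vertices `w`, `w + (v - i u)`, `w + u + (v - i u)`. -/
def triDown (i : ℤ) (w : ℤ × ℤ) : Finset (ℤ × ℤ) := {w, w + (-i, 1), w + (1 - i, 1)}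

/-- `S` is the vertex set of a triangle of the standard triangulation of the lattice. -/
def IsTri (S : Finset (ℤ × ℤ)) : Prop := ∃ w, S = triUp 0 w ∨ S = triDown 0 w

/-- The difference between the piecewise linear interpolation on the standard triangulation of the
quadratic form at the lattice points and the quadratic form itself. The form is a combination of
the squares of the three linear functions that are constant on the edges of the triangulation, so
that the interpolation is a combination of one-dimensional ones. -/
def gap (F : Frame) (q : ℝ × ℝ) : ℝ :=
  (Complex.normSq F.u + F.inn) * bump q.1 + (Complex.normSq F.v + F.inn) * bump q.2 -
    F.inn * bump (q.1 - q.2)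

theorem gap_up (F : Frame) (w : ℤ × ℤ) {l₁ l₂ : ℝ} (h1 : 0 ≤ l₁) (h2 : 0 ≤ l₂) (h3 : l₁ + l₂ ≤ 1) :
    F.gap (w.1 + (l₁ + l₂), w.2 + l₂) = (1 - l₁ - l₂) * l₁ * F.quad (1, 0) +
      l₁ * l₂ * F.quad (0, 1) + (1 - l₁ - l₂) * l₂ * F.quad (1, 1) := by
  have h4 : (w.1 + (l₁ + l₂) - (w.2 + l₂) : ℝ) = ((w.1 - w.2 : ℤ) : ℝ) + l₁ := by push_cast; ring
  simp only [gap]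
  rw [h4, bump_int_add _ (by linarith) h3, bump_int_add _ h2 (by linarith),
    bump_int_add _ h1 (by linarith)]
  simp only [quad]
  ring

theorem gap_down (F : Frame) (w : ℤ × ℤ) {l₁ l₂ : ℝ} (h1 : 0 ≤ l₁) (h2 : 0 ≤ l₂)
    (h3 : l₁ + l₂ ≤ 1) :
    F.gap (w.1 + l₂, w.2 + (l₁ + l₂)) = (1 - l₁ - l₂) * l₁ * F.quad (0, 1) +
      l₁ * l₂ * F.quad (1, 0) + (1 - l₁ - l₂) * l₂ * F.quad (1, 1) := by
  have h4 : (w.1 + l₂ - (w.2 + (l₁ + l₂)) : ℝ) = -(((w.2 - w.1 : ℤ) : ℝ) + l₁) := by push_cast; ring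
  simp only [gap]
  rw [h4, bump_neg, bump_int_add _ (by linarith) h3, bump_int_add _ h2 (by linarith),
    bump_int_add _ h1 (by linarith)]
  simp only [quad]
  ring

theorem sum_triUp (i : ℤ) (w : ℤ × ℤ) (g : ℤ × ℤ → ℝ) :
    ∑ x ∈ triUp i w, g x = g w + (g (w + (1, 0)) + g (w + (1 - i, 1))) := by
  rw [triUp, Finset.sum_insert, Finset.sum_insert, Finset.sum_singleton] <;> simp

theorem sum_triDown (i : ℤ) (w : ℤ × ℤ) (g : ℤ × ℤ → ℝ) :
    ∑ x ∈ triDown i w, g x = g w + (g (w + (-i, 1)) + g (w + (1 - i, 1))) := by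
  rw [triDown, Finset.sum_insert, Finset.sum_insert, Finset.sum_singleton] <;> simp
  omega

/-- Over a triangle, the interpolated quadratic form exceeds the form by `gap`. -/
theorem Bary.sum_quad (F : Frame) {a : ℤ × ℤ → ℝ} {S T : Finset (ℤ × ℤ)} {q : ℝ × ℝ}
    (h : Bary a S q) (hT : IsTri T) (hST : S ⊆ T) :
    ∑ w ∈ S, a w * F.quad (cast w) = F.quad q + F.gap q := by
  have h' := h.mono hST
  rw [← h.sum_of_supp (h.mono hST).supp]
  obtain ⟨w, rfl | rfl⟩ := hT
  · obtain ⟨h1, -, h3, h4, h5⟩ := h'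
    rw [sum_triUp] at h3 h4 h5 ⊢
    have e0 : a w = 1 - a (w + (1, 0)) - a (w + (1 - 0, 1)) := by linarith
    have hq : q = (w.1 + (a (w + (1, 0)) + a (w + (1 - 0, 1))), w.2 + a (w + (1 - 0, 1))) := by
      ext
      · rw [← h4, e0]
        simp
        ring
      · rw [← h5, e0]
        simp
        ring
    rw [hq, F.gap_up w (h1 _) (h1 _) (by linarith [h1 w]), e0]
    simp [quad, cast]
    ring
  · obtain ⟨h1, -, h3, h4, h5⟩ := h'
    rw [sum_triDown] at h3 h4 h5 ⊢
    have e0 : a w = 1 - a (w + (-0, 1)) - a (w + (1 - 0, 1)) := by linarith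
    have hq : q = (w.1 + a (w + (1 - 0, 1)), w.2 + (a (w + (-0, 1)) + a (w + (1 - 0, 1)))) := by
      ext
      · rw [← h4, e0]
        simp
        ring
      · rw [← h5, e0]
        simp
        ring
    rw [hq, F.gap_down w (h1 _) (h1 _) (by linarith [h1 w]), e0]
    simp [quad, cast]
    ring

theorem mem_hull_face_iff (F : Frame) {S T : Finset (ℤ × ℤ)} {p : H3} (hT : IsTri T)
    (hST : S ⊆ T) : p ∈ hull (F.ideal '' face S) ↔
      F.crd p.z ∈ convexHull ℝ (cast '' S) ∧ p.t ^ 2 = F.gap (F.crd p.z) := by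
  rw [mem_hull_face, mem_convexHull_iff]
  constructor
  · rintro ⟨a, h1, h2⟩
    rw [h1.sum_quad F hT hST] at h2
    exact ⟨⟨a, h1⟩, by linarith⟩
  · rintro ⟨⟨a, h1⟩, h2⟩
    exact ⟨a, h1, by rw [h1.sum_quad F hT hST, h2]⟩

theorem mem_hull_cone_iff (F : Frame) {S T : Finset (ℤ × ℤ)} {p : H3} (hT : IsTri T)
    (hST : S ⊆ T) : p ∈ hull (F.ideal '' cone S) ↔
      F.crd p.z ∈ convexHull ℝ (cast '' S) ∧ F.gap (F.crd p.z) ≤ p.t ^ 2 := by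
  rw [mem_hull_cone, mem_convexHull_iff]
  constructor
  · rintro ⟨a, h1, h2⟩
    rw [h1.sum_quad F hT hST] at h2
    exact ⟨⟨a, h1⟩, by linarith⟩
  · rintro ⟨⟨a, h1⟩, h2⟩
    exact ⟨a, h1, by rw [h1.sum_quad F hT hST]; linarith⟩

/-- Every point lies in a triangle, given by its integral and fractional parts. -/
theorem exists_coords (q : ℝ × ℝ) : ∃ (w : ℤ × ℤ) (l₁ l₂ : ℝ), 0 ≤ l₁ ∧ 0 ≤ l₂ ∧ l₁ + l₂ < 1 ∧
    (q = (w.1 + (l₁ + l₂), w.2 + l₂) ∨ q = (w.1 + l₂, w.2 + (l₁ + l₂))) := by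
  rcases le_total (Int.fract q.2) (Int.fract q.1) with h | h
  · refine ⟨(⌊q.1⌋, ⌊q.2⌋), Int.fract q.1 - Int.fract q.2, Int.fract q.2, by linarith,
      Int.fract_nonneg _, by linarith [Int.fract_lt_one q.1], Or.inl ?_⟩
    ext <;> simp
  · refine ⟨(⌊q.1⌋, ⌊q.2⌋), Int.fract q.2 - Int.fract q.1, Int.fract q.1, by linarith,
      Int.fract_nonneg _, by linarith [Int.fract_lt_one q.2], Or.inr ?_⟩
    ext <;> simp

theorem exists_tri (q : ℝ × ℝ) : ∃ T, IsTri T ∧ q ∈ convexHull ℝ (cast '' (T : Set (ℤ × ℤ))) := by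
  obtain ⟨w, l₁, l₂, h1, h2, h3, rfl | rfl⟩ := exists_coords q
  · refine ⟨triUp 0 w, ⟨w, Or.inl rfl⟩, mem_convexHull_iff.mpr
      ⟨fun x => if x = w then 1 - l₁ - l₂ else if x = w + (1, 0) then l₁ else
        if x = w + (1, 1) then l₂ else 0, ?_, ?_, ?_, ?_, ?_⟩⟩
    · intro x
      split_ifs <;> linarith
    · intro x hx
      simp only [triUp, Finset.mem_insert, Finset.mem_singleton, not_or, sub_zero] at hx
      simp [hx.1, hx.2.1, hx.2.2]
    all_goals
      rw [sum_triUp]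
      simp
    all_goals ring
  · refine ⟨triDown 0 w, ⟨w, Or.inr rfl⟩, mem_convexHull_iff.mpr
      ⟨fun x => if x = w then 1 - l₁ - l₂ else if x = w + (0, 1) then l₁ else
        if x = w + (1, 1) then l₂ else 0, ?_, ?_, ?_, ?_, ?_⟩⟩
    · intro x
      split_ifs <;> linarith
    · intro x hx
      simp only [triDown, Finset.mem_insert, Finset.mem_singleton, not_or, sub_zero, neg_zero] at hx
      simp [hx.1, hx.2.1, hx.2.2]
    all_goals
      rw [sum_triDown]
      simp
    all_goals ring

theorem quad_one_zero_pos (F : Frame) : 0 < F.quad (1, 0) := F.quad_pos (by simp)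

theorem quad_zero_one_pos (F : Frame) : 0 < F.quad (0, 1) := F.quad_pos (by simp)

theorem quad_one_one_pos (F : Frame) : 0 < F.quad (1, 1) := F.quad_pos (by simp)

theorem gap_nonneg (F : Frame) (q : ℝ × ℝ) : 0 ≤ F.gap q := by
  have := F.quad_one_zero_pos
  have := F.quad_zero_one_pos
  have := F.quad_one_one_pos
  obtain ⟨w, l₁, l₂, h1, h2, h3, rfl | rfl⟩ := exists_coords q
  · have : 0 < 1 - l₁ - l₂ := by linarith
    rw [F.gap_up w h1 h2 h3.le]
    positivity
  · have : 0 < 1 - l₁ - l₂ := by linarith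
    rw [F.gap_down w h1 h2 h3.le]
    positivity

theorem gap_pos (F : Frame) {q : ℝ × ℝ} (hq : q ∉ range cast) : 0 < F.gap q := by
  have := F.quad_one_zero_pos
  have := F.quad_zero_one_pos
  have := F.quad_one_one_pos
  obtain ⟨w, l₁, l₂, h1, h2, h3, rfl | rfl⟩ := exists_coords q
  · have h4 : 0 < 1 - l₁ - l₂ := by linarith
    rw [F.gap_up w h1 h2 h3.le]
    rcases h1.eq_or_lt with rfl | h1
    · rcases h2.eq_or_lt with rfl | h2
      · exact absurd ⟨w, by simp [cast]⟩ hq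
      · positivity
    · positivity
  · have h4 : 0 < 1 - l₁ - l₂ := by linarith
    rw [F.gap_down w h1 h2 h3.le]
    rcases h1.eq_or_lt with rfl | h1
    · rcases h2.eq_or_lt with rfl | h2
      · exact absurd ⟨w, by simp [cast]⟩ hq
      · positivity
    · positivity

theorem bump_int (n : ℤ) : bump n = 0 := by simp [bump]

theorem gap_cast (F : Frame) (w : ℤ × ℤ) : F.gap (cast w) = 0 := by
  have h : (cast w).1 - (cast w).2 = ((w.1 - w.2 : ℤ) : ℝ) := by simp [cast]
  rw [gap, h, cast, bump_int, bump_int, bump_int]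
  ring

theorem continuous_gap (F : Frame) : Continuous F.gap := by
  have := continuous_bump
  unfold gap
  fun_prop

theorem gap_add_cast (F : Frame) (q : ℝ × ℝ) (w : ℤ × ℤ) : F.gap (q + cast w) = F.gap q := by
  have h : ∀ (x : ℝ) (n : ℤ), bump (x + n) = bump x := fun x n => by simp [bump]
  have h2 : (q + cast w).1 - (q + cast w).2 = q.1 - q.2 + ((w.1 - w.2 : ℤ) : ℝ) := by
    simp [cast]
    ring
  simp only [gap]
  rw [h2, h]
  simp [cast, h]

/-- The height of the surface over the point `z`, extended by zero over the lattice points. -/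
def height (F : Frame) (z : ℂ) : ℝ := √(F.gap (F.crd z))

theorem height_nonneg (F : Frame) (z : ℂ) : 0 ≤ F.height z := Real.sqrt_nonneg _

theorem height_sq (F : Frame) (z : ℂ) : F.height z ^ 2 = F.gap (F.crd z) :=
  Real.sq_sqrt (F.gap_nonneg _)

theorem height_pos (F : Frame) {z : ℂ} (h : F.crd z ∉ range cast) : 0 < F.height z :=
  Real.sqrt_pos.mpr (F.gap_pos h)

theorem continuous_height (F : Frame) : Continuous F.height :=
  (F.continuous_gap.comp F.continuous_crd).sqrt

/-- A bound for the height of the surface. -/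
def top (F : Frame) : ℝ :=
  1 + |Complex.normSq F.u + F.inn| + |Complex.normSq F.v + F.inn| + |F.inn|

theorem one_le_top (F : Frame) : 1 ≤ F.top := by
  unfold top
  linarith [abs_nonneg (Complex.normSq F.u + F.inn), abs_nonneg (Complex.normSq F.v + F.inn),
    abs_nonneg F.inn]

theorem height_lt_top (F : Frame) (z : ℂ) : F.height z < F.top := by
  have key : ∀ (c x : ℝ), c * bump x ≤ |c| := fun c x => by
    calc c * bump x ≤ |c| * bump x := by gcongr; exacts [bump_nonneg x, le_abs_self c]
      _ ≤ |c| * 1 := by gcongr; exact bump_le_one x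
      _ = |c| := mul_one _
  have h1 := F.one_le_top
  rw [height, Real.sqrt_lt' (by linarith)]
  have h2 : F.gap (F.crd z) ≤ F.top - 1 := by
    have h3 := key (Complex.normSq F.u + F.inn) (F.crd z).1
    have h4 := key (Complex.normSq F.v + F.inn) (F.crd z).2
    have h5 := key (-F.inn) ((F.crd z).1 - (F.crd z).2)
    rw [abs_neg] at h5
    unfold gap top
    linarith
  nlinarith

/-- The region above the surface. -/
def region (F : Frame) : Set H3 := {p | F.height p.z ≤ p.t}

theorem mem_region {F : Frame} {p : H3} : p ∈ F.region ↔ F.height p.z ≤ p.t := Iff.rfl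

theorem isClosed_region (F : Frame) : IsClosed F.region :=
  isClosed_le (F.continuous_height.comp H3.continuous_z) H3.continuous_t

theorem height_le_iff (F : Frame) {p : H3} : F.height p.z ≤ p.t ↔ F.gap (F.crd p.z) ≤ p.t ^ 2 := by
  rw [← F.height_sq, sq_le_sq₀ (F.height_nonneg _) p.pos.le]

theorem height_eq_iff (F : Frame) {p : H3} : F.height p.z = p.t ↔ p.t ^ 2 = F.gap (F.crd p.z) := by
  rw [← F.height_sq, sq_eq_sq₀ p.pos.le (F.height_nonneg _), eq_comm]

/-- The region is filled by the cones from `∞` over the triangles. -/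
theorem mem_region_iff (F : Frame) {p : H3} :
    p ∈ F.region ↔ ∃ T, IsTri T ∧ p ∈ hull (F.ideal '' cone T) := by
  rw [mem_region, height_le_iff]
  constructor
  · intro h
    obtain ⟨T, hT, hq⟩ := exists_tri (F.crd p.z)
    exact ⟨T, hT, (F.mem_hull_cone_iff hT subset_rfl).mpr ⟨hq, h⟩⟩
  · rintro ⟨T, hT, h⟩
    exact ((F.mem_hull_cone_iff hT subset_rfl).mp h).2

end Frame

namespace Frame

/-! ### The layered tetrahedra and the uniqueness of barycentric weights -/

/-- The vertices of the lattice parallelogram at `w` that is spanned by `u` and `v - i u`. -/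
def quadr (i : ℤ) (w : ℤ × ℤ) : Finset (ℤ × ℤ) := {w, w + (1, 0), w + (-i, 1), w + (1 - i, 1)}

/-- The vertex sets of the tetrahedra of the `i`-th triangulation: below the `i`-th surface there
are the tetrahedra spanned by the parallelograms of the previous steps, and above it there are
the cones over the triangles. -/
def IsCell (i : ℤ) (S : Finset (Option (ℤ × ℤ))) : Prop :=
  (∃ j w, 0 ≤ j ∧ j < i ∧ S = face (quadr j w)) ∨
    ∃ w, S = cone (triUp i w) ∨ S = cone (triDown i w)

theorem triUp_subset_quadr (i : ℤ) (w : ℤ × ℤ) : triUp i w ⊆ quadr i w := by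
  intro x
  simp only [triUp, quadr, Finset.mem_insert, Finset.mem_singleton]
  tauto

theorem triDown_subset_quadr (i : ℤ) (w : ℤ × ℤ) : triDown i w ⊆ quadr i w := by
  intro x
  simp only [triDown, quadr, Finset.mem_insert, Finset.mem_singleton]
  tauto

theorem sum_quadr (i : ℤ) (w : ℤ × ℤ) (g : ℤ × ℤ → ℝ) :
    ∑ x ∈ quadr i w, g x =
      g w + (g (w + (1, 0)) + (g (w + (-i, 1)) + g (w + (1 - i, 1)))) := by
  rw [quadr, Finset.sum_insert, Finset.sum_insert, Finset.sum_insert, Finset.sum_singleton] <;> simp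
  omega

theorem cone_mono {S T : Finset (ℤ × ℤ)} (h : S ⊆ T) : cone S ⊆ cone T := by
  rintro (_ | w)
  · simp
  · simpa using @h w

/-- Weights on the parallelogram at `w` of the `j`-th step and on `∞`, of the kind that occurs for
the tetrahedra of the `i`-th triangulation. -/
structure Slab (F : Frame) (i : ℤ) (a : Option (ℤ × ℤ) → ℝ) (p : H3) (j : ℤ) (w : ℤ × ℤ) :
    Prop where
  rep : F.Rep a (cone (quadr j w)) p
  nonneg : 0 ≤ j
  le : j ≤ i
  none_eq : j < i → a none = 0
  top_eq : j = i → a (some (w + (1, 0))) = 0 ∨ a (some (w + (-j, 1))) = 0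

theorem Rep.exists_slab {F : Frame} {i : ℤ} (hi : 0 ≤ i) {a : Option (ℤ × ℤ) → ℝ}
    {S : Finset (Option (ℤ × ℤ))} {p : H3} (h : F.Rep a S p) (hS : IsCell i S) :
    ∃ j w, F.Slab i a p j w := by
  rcases hS with ⟨j, w, h0, hj, rfl⟩ | ⟨w, rfl | rfl⟩
  · exact ⟨j, w, h.mono (face_subset_cone _), h0, hj.le, fun _ => h.supp _ (by simp), fun h => by
      omega⟩
  · refine ⟨i, w, h.mono (cone_mono (triUp_subset_quadr _ _)), hi, le_rfl,
      fun h => absurd h (lt_irrefl _), fun _ => Or.inr (h.supp _ ?_)⟩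
    simp [triUp]
    omega
  · refine ⟨i, w, h.mono (cone_mono (triDown_subset_quadr _ _)), hi, le_rfl,
      fun h => absurd h (lt_irrefl _), fun _ => Or.inl (h.supp _ ?_)⟩
    simp [triDown]

/-- A measure on two consecutive integers is determined by its mass and its first moment. -/
theorem eq_of_moments {f f' : ℤ → ℝ} {m m' : ℤ} (h0 : ∀ x, 0 ≤ f x) (h0' : ∀ x, 0 ≤ f' x)
    (hf : ∀ x, x ≠ m → x ≠ m + 1 → f x = 0) (hf' : ∀ x, x ≠ m' → x ≠ m' + 1 → f' x = 0)
    (h1 : f m + f (m + 1) = f' m' + f' (m' + 1))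
    (h2 : f m * m + f (m + 1) * (m + 1) = f' m' * m' + f' (m' + 1) * (m' + 1)) (x : ℤ) :
    f x = f' x := by
  have key : ∀ {f f' : ℤ → ℝ} {m m' : ℤ}, (∀ x, 0 ≤ f x) → (∀ x, 0 ≤ f' x) →
      (∀ x, x ≠ m → x ≠ m + 1 → f x = 0) → (∀ x, x ≠ m' → x ≠ m' + 1 → f' x = 0) →
      f m + f (m + 1) = f' m' + f' (m' + 1) →
      f m * m + f (m + 1) * (m + 1) = f' m' * m' + f' (m' + 1) * (m' + 1) →
      m < m' → ∀ x, f x = f' x := by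
    intro f f' m m' h0 h0' hf hf' h1 h2 hm x
    obtain ⟨d, hd, rfl⟩ : ∃ d : ℤ, 0 ≤ d ∧ m' = m + 1 + d := ⟨m' - m - 1, by omega, by omega⟩
    have hdr : (0 : ℝ) ≤ d := by exact_mod_cast hd
    have a1 := h0 m
    have a2 := h0 (m + 1)
    have a3 := h0' (m + 1 + d)
    have a4 := h0' (m + 1 + d + 1)
    push_cast at h2
    have e : f m + (d * f' (m + 1 + d) + (d + 1) * f' (m + 1 + d + 1)) = 0 := by
      linear_combination ((m : ℝ) + 1) * h1 - h2
    have p1 := mul_nonneg hdr a3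
    have p2 := mul_nonneg hdr a4
    have e1 : f m = 0 := by linarith
    have e2 : f' (m + 1 + d + 1) = 0 := by linarith
    have e3 : d * f' (m + 1 + d) = 0 := by linarith
    rw [e1, e2, zero_add, add_zero] at h1
    rcases mul_eq_zero.mp e3 with h | h
    · have hd0 : d = 0 := by exact_mod_cast h
      subst hd0
      rw [add_zero] at *
      by_cases hx : x = m + 1
      · rw [hx, h1]
      · have b1 : f x = 0 := by
          by_cases hx' : x = m
          · rw [hx', e1]
          · exact hf x hx' hx
        have b2 : f' x = 0 := by
          by_cases hx' : x = m + 1 + 1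
          · rw [hx', e2]
          · exact hf' x hx hx'
        rw [b1, b2]
    · have b1 : f x = 0 := by
        by_cases hx : x = m
        · rw [hx, e1]
        · by_cases hx' : x = m + 1
          · rw [hx', h1, h]
          · exact hf x hx hx'
      have b2 : f' x = 0 := by
        by_cases hx : x = m + 1 + d
        · rw [hx, h]
        · by_cases hx' : x = m + 1 + d + 1
          · rw [hx', e2]
          · exact hf' x hx hx'
      rw [b1, b2]
  rcases lt_trichotomy m m' with h | rfl | h
  · exact key h0 h0' hf hf' h1 h2 h x
  · have e2 : f (m + 1) = f' (m + 1) := by linear_combination h2 - m * h1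
    have e1 : f m = f' m := by linarith
    by_cases hx : x = m
    · rw [hx, e1]
    · by_cases hx' : x = m + 1
      · rw [hx', e2]
      · rw [hf x hx hx', hf' x hx hx']
  · exact (key h0' h0 hf' hf h1.symm h2.symm h x).symm

/-- First moment of the weights on the lower side of the parallelogram. -/
def lowMoment (a : Option (ℤ × ℤ) → ℝ) (w : ℤ × ℤ) : ℝ :=
  a (some w) * w.1 + a (some (w + (1, 0))) * (w.1 + 1)

/-- First moment of the weights on the upper side of the parallelogram. -/
def highMoment (a : Option (ℤ × ℤ) → ℝ) (j : ℤ) (w : ℤ × ℤ) : ℝ :=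
  a (some (w + (-j, 1))) * (w.1 - j) + a (some (w + (1 - j, 1))) * (w.1 - j + 1)

theorem Rep.quadr_eqs {F : Frame} {a : Option (ℤ × ℤ) → ℝ} {j : ℤ} {w : ℤ × ℤ} {p : H3}
    (h : F.Rep a (cone (quadr j w)) p) :
    a (some w) + a (some (w + (1, 0))) =
      w.2 + 1 - (F.crd p.z).2 ∧
    a (some (w + (-j, 1))) + a (some (w + (1 - j, 1))) = (F.crd p.z).2 - w.2 ∧
    lowMoment a w + highMoment a j w = (F.crd p.z).1 ∧
    a none + Complex.normSq F.u * (a (some w) * w.1 ^ 2 + a (some (w + (1, 0))) * (w.1 + 1) ^ 2 +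
        a (some (w + (-j, 1))) * (w.1 - j) ^ 2 + a (some (w + (1 - j, 1))) * (w.1 - j + 1) ^ 2) +
      2 * F.inn * (w.2 * lowMoment a w + (w.2 + 1) * highMoment a j w) +
      Complex.normSq F.v * (w.2 ^ 2 * (w.2 + 1 - (F.crd p.z).2) +
        (w.2 + 1) ^ 2 * ((F.crd p.z).2 - w.2)) = F.quad (F.crd p.z) + p.t ^ 2 := by
  obtain ⟨-, -, h3, h4, h5, h6⟩ := h
  simp only [cone, Finset.sum_insertNone, sum_quadr, mass, posX, posY, energy, mul_zero, mul_one,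
    zero_add, Prod.fst_add, Prod.snd_add, Int.cast_add, Int.cast_one, Int.cast_neg, Int.cast_sub,
    add_zero, quad, cast] at h3 h4 h5 h6
  have e1 : a (some (w + (-j, 1))) + a (some (w + (1 - j, 1))) = (F.crd p.z).2 - w.2 := by
    linear_combination h5 - w.2 * h3
  have e2 : a (some w) + a (some (w + (1, 0))) = w.2 + 1 - (F.crd p.z).2 := by
    linear_combination h3 - e1
  refine ⟨e2, e1, ?_, ?_⟩
  · unfold lowMoment highMoment
    linear_combination h4
  · rw [← e1, ← e2]
    unfold lowMoment highMoment
    simp only [quad]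
    linear_combination h6

/-- The slope comparison: two decompositions of a point along the same strip cannot have the lower
endpoints in one order and the upper endpoints in the other one. -/
theorem Slab.not_lowMoment_lt {F : Frame} {i j j' : ℤ}
    {a a' : Option (ℤ × ℤ) → ℝ} (hF : 0 < i → F.inn < 0) {p : H3} {w w' : ℤ × ℤ}
    (h : F.Slab i a p j w) (h' : F.Slab i a' p j' w') (hw : w.2 = w'.2) : ¬ lowMoment a w <
        lowMoment a' w' := by
  intro hlt
  have hκ : 0 < Complex.normSq F.u := Complex.normSq_pos.mpr F.u_ne_zero
  obtain ⟨e1, e2, e3, e4⟩ := h.rep.quadr_eqs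
  obtain ⟨e1', e2', e3', e4'⟩ := h'.rep.quadr_eqs
  rw [← hw] at e1' e2' e4'
  have p1 := h.rep.nonneg (some w)
  have p2 := h.rep.nonneg (some (w + (1, 0)))
  have p3 := h.rep.nonneg (some (w + (-j, 1)))
  have p4 := h.rep.nonneg (some (w + (1 - j, 1)))
  have p1' := h'.rep.nonneg (some w')
  have p2' := h'.rep.nonneg (some (w' + (1, 0)))
  have p3' := h'.rep.nonneg (some (w' + (-j', 1)))
  have p4' := h'.rep.nonneg (some (w' + (1 - j', 1)))
  have p0 := h'.rep.nonneg none
  have hj := h.nonneg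
  have hn := h.none_eq
  have ht := h.top_eq
  have ht' := h'.top_eq
  have hle' := h'.le
  have hle := h.le
  simp only [lowMoment, highMoment] at e3 e3' e4 e4' hlt
  generalize a (some w) = A0 at *
  generalize a (some (w + (1, 0))) = A1 at *
  generalize a (some (w + (-j, 1))) = B0 at *
  generalize a (some (w + (1 - j, 1))) = B1 at *
  generalize a' (some w') = A0' at *
  generalize a' (some (w' + (1, 0))) = A1' at *
  generalize a' (some (w' + (-j', 1))) = B0' at *
  generalize a' (some (w' + (1 - j', 1))) = B1' at *
  obtain ⟨m, k⟩ := w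
  obtain ⟨m', k'⟩ := w'
  dsimp only at hw e1 e2 e3 e4 e1' e2' e3' e4' hlt
  generalize (F.crd p.z).2 = Y at *
  generalize (F.crd p.z).1 = X at *
  -- the combinatorial constraints on the positions
  have hm : m ≤ m' := by
    by_contra! hcon
    have hc : (m' : ℝ) + 1 ≤ m := by exact_mod_cast hcon
    have h1 := mul_nonneg (add_nonneg p1 p2) (sub_nonneg.mpr hc)
    have h2 : (A0' + A1') * ((m' : ℝ) + 1) = (A0 + A1) * (m' + 1) := by rw [e1, e1']
    linarith
  have hmj : m' - j' ≤ m - j := by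
    by_contra! hcon
    have hc : (m : ℝ) - j + 1 ≤ m' - j' := by exact_mod_cast hcon
    have h1 := mul_nonneg (add_nonneg p3 p4) (sub_nonneg.mpr hc)
    have h2 : (B0' + B1') * ((m : ℝ) - j + 1) = (B0 + B1) * (m - j + 1) := by rw [e2, e2']
    have h3 := mul_nonneg (add_nonneg p3' p4') (sub_nonneg.mpr hc)
    linarith
  rcases hle.lt_or_eq with hlt_i | rfl
  · -- a tetrahedron below the surface: compare the slopes of the two polygonal curves
    rw [hn hlt_i] at e4
    have sq : ∀ x : ℤ, (0 : ℝ) ≤ x * (x - 1) := by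
      intro x
      have : 0 ≤ x * (x - 1) := by
        rcases le_or_gt x 0 with h | h
        · exact mul_nonneg_of_nonpos_of_nonpos h (by omega)
        · exact mul_nonneg h.le (by omega)
      exact_mod_cast this
    have s1 := mul_nonneg p1' (sq (m' - m))
    have s2 := mul_nonneg p2' (sq (m' + 1 - m))
    have s3 := mul_nonneg p3' (sq (m' - j' - (m - j)))
    have s4 := mul_nonneg p4' (sq (m' - j' + 1 - (m - j)))
    push_cast at s1 s2 s3 s4
    have hD : 0 < A0' * m' + A1' * (m' + 1) - (A0 * m + A1 * (m + 1)) := by linarith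
    have hjr : (0 : ℝ) ≤ j := by exact_mod_cast hj
    set D := A0' * m' + A1' * (m' + 1) - (A0 * m + A1 * (m + 1)) with hDdef
    have hs : 2 * j * D ≤ (A0' * m' ^ 2 + A1' * (m' + 1) ^ 2 + B0' * (m' - j') ^ 2 +
        B1' * (m' - j' + 1) ^ 2) -
        (A0 * m ^ 2 + A1 * (m + 1) ^ 2 + B0 * (m - j) ^ 2 + B1 * (m - j + 1) ^ 2) := by
      have f1 : A0' + A1' - A0 - A1 = 0 := by linarith
      have f2 : B0' + B1' - B0 - B1 = 0 := by linarith
      have f3 : B0' * (m' - j') + B1' * (m' - j' + 1) - (B0 * (m - j) + B1 * (m - j + 1)) = -D := by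
        linarith
      have id1 : (A0' * m' ^ 2 + A1' * (m' + 1) ^ 2) - (A0 * m ^ 2 + A1 * (m + 1) ^ 2) =
          A0' * (((m' : ℝ) - m) * (m' - m - 1)) + A1' * (((m' : ℝ) + 1 - m) * (m' + 1 - m - 1)) +
          (2 * m + 1) * D - m * (m + 1) * (A0' + A1' - A0 - A1) := by
        rw [hDdef]
        ring
      have id2 : (B0' * (m' - j') ^ 2 + B1' * (m' - j' + 1) ^ 2) -
          (B0 * (m - j) ^ 2 + B1 * (m - j + 1) ^ 2) =
          B0' * (((m' : ℝ) - j' - (m - j)) * (m' - j' - (m - j) - 1)) +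
          B1' * (((m' : ℝ) - j' + 1 - (m - j)) * (m' - j' + 1 - (m - j) - 1)) +
          (2 * (m - j) + 1) *
            (B0' * (m' - j') + B1' * (m' - j' + 1) - (B0 * (m - j) + B1 * (m - j + 1))) -
          (m - j) * (m - j + 1) * (B0' + B1' - B0 - B1) := by ring
      rw [f1] at id1
      rw [f2, f3] at id2
      linarith only [id1, id2, s1, s2, s3, s4]
    have t1 := mul_nonneg hκ.le (sub_nonneg.mpr hs)
    have t2 : 0 ≤ Complex.normSq F.u * (2 * j * D) := by positivity
    have t3 : F.inn * D < 0 := mul_neg_of_neg_of_pos (hF (by omega)) hD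
    have e5 : (B0 * (m - j) + B1 * (m - j + 1)) - (B0' * (m' - j') + B1' * (m' - j' + 1)) = D := by
      rw [hDdef]
      linarith
    have e6 : F.inn * ((k * (A0 * m + A1 * (m + 1)) + (k + 1) * (B0 * (m - j) + B1 * (m - j + 1))) -
        (k * (A0' * m' + A1' * (m' + 1)) + (k + 1) * (B0' * (m' - j') + B1' * (m' - j' + 1)))) =
        F.inn * D := by
      rw [← e5]
      linear_combination F.inn * k * (e3 - e3')
    have e7 : a' none + Complex.normSq F.u * ((A0' * m' ^ 2 + A1' * (m' + 1) ^ 2 +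
        B0' * (m' - j') ^ 2 + B1' * (m' - j' + 1) ^ 2) -
        (A0 * m ^ 2 + A1 * (m + 1) ^ 2 + B0 * (m - j) ^ 2 + B1 * (m - j + 1) ^ 2)) =
        2 * (F.inn * D) := by
      linear_combination e4' - e4 + 2 * e6
    rw [mul_sub] at t1
    linarith only [e7, t1, t2, t3, p0]
  · -- two cones from infinity: both lie over the same parallelogram
    have hj' : j' = j := by omega
    subst hj'
    have hmm : m' = m := by omega
    subst hmm
    have hA : A1 < A1' := by
      have h2 : (A0' + A1') * (m' : ℝ) = (A0 + A1) * m' := by rw [e1, e1']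
      linarith
    have hB : B1' < B1 := by
      have h2 : (B0' + B1') * ((m' : ℝ) - j') = (B0 + B1) * (m' - j') := by rw [e2, e2']
      linarith
    rcases ht' rfl with h | h <;> linarith

/-- Weights that agree at all finite vertices agree at `∞`. -/
theorem Rep.none_eq_of_some_eq {F : Frame} {a a' : Option (ℤ × ℤ) → ℝ}
    {S S' : Finset (Option (ℤ × ℤ))} {p : H3} (h : F.Rep a S p) (h' : F.Rep a' S' p)
    (hs : ∀ w, a (some w) = a' (some w)) : a = a' := by
  have h1 := (h.mono (Finset.subset_union_left.trans Finset.subset_union_left :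
    S ⊆ S ∪ S' ∪ {none})).energy_eq
  have h2 := (h'.mono (Finset.subset_union_right.trans Finset.subset_union_left :
    S' ⊆ S ∪ S' ∪ {none})).energy_eq
  rw [← h2, ← sub_eq_zero, ← Finset.sum_sub_distrib, Finset.sum_eq_single none] at h1
  · ext (_ | w)
    · simp only [energy, mul_one] at h1
      linarith
    · exact hs w
  · rintro (_ | w) - hw
    · exact absurd rfl hw
    · rw [hs w, sub_self]
  · intro h
    simp at h

theorem Slab.eq_zero_of_snd {F : Frame} {i j : ℤ} {a : Option (ℤ × ℤ) → ℝ} {p : H3} {w : ℤ × ℤ}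
    (h : F.Slab i a p j w) {x y : ℤ} (hy : y ≠ w.2) (hy' : y ≠ w.2 + 1) : a (some (x, y)) = 0 := by
  refine h.rep.supp _ ?_
  simp only [some_mem_cone, quadr, Finset.mem_insert, Finset.mem_singleton, Prod.ext_iff,
    Prod.fst_add, Prod.snd_add]
  omega

theorem Slab.eq_zero_low {F : Frame} {i j : ℤ} {a : Option (ℤ × ℤ) → ℝ} {p : H3} {w : ℤ × ℤ}
    (h : F.Slab i a p j w) (x : ℤ) (hx : x ≠ w.1) (hx' : x ≠ w.1 + 1) :
    a (some (x, w.2)) = 0 := by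
  refine h.rep.supp _ ?_
  simp only [some_mem_cone, quadr, Finset.mem_insert, Finset.mem_singleton, Prod.ext_iff,
    Prod.fst_add, Prod.snd_add]
  omega

theorem Slab.eq_zero_high {F : Frame} {i j : ℤ} {a : Option (ℤ × ℤ) → ℝ} {p : H3} {w : ℤ × ℤ}
    (h : F.Slab i a p j w) (x : ℤ) (hx : x ≠ w.1 - j) (hx' : x ≠ w.1 - j + 1) :
    a (some (x, w.2 + 1)) = 0 := by
  refine h.rep.supp _ ?_
  simp only [some_mem_cone, quadr, Finset.mem_insert, Finset.mem_singleton, Prod.ext_iff,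
    Prod.fst_add, Prod.snd_add]
  omega

theorem lowMoment_eq (a : Option (ℤ × ℤ) → ℝ) (w : ℤ × ℤ) : lowMoment a w =
    a (some (w.1, w.2)) * w.1 + a (some (w.1 + 1, w.2)) * (w.1 + 1) := by
  obtain ⟨m, k⟩ := w
  simp [lowMoment]

theorem highMoment_eq (a : Option (ℤ × ℤ) → ℝ) (j : ℤ) (w : ℤ × ℤ) : highMoment a j w =
    a (some (w.1 - j, w.2 + 1)) * (w.1 - j : ℤ) +
      a (some (w.1 - j + 1, w.2 + 1)) * ((w.1 - j : ℤ) + 1) := by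
  obtain ⟨m, k⟩ := w
  have h1 : ((m, k) : ℤ × ℤ) + (-j, 1) = (m - j, k + 1) := by
    ext <;> simp
    ring
  have h2 : ((m, k) : ℤ × ℤ) + (1 - j, 1) = (m - j + 1, k + 1) := by
    ext <;> simp
    ring
  rw [highMoment, h1, h2]
  push_cast
  rfl

theorem Slab.mass_low {F : Frame} {i j : ℤ} {a : Option (ℤ × ℤ) → ℝ} {p : H3} {w : ℤ × ℤ}
    (h : F.Slab i a p j w) :
    a (some (w.1, w.2)) + a (some (w.1 + 1, w.2)) = w.2 + 1 - (F.crd p.z).2 := by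
  have h1 := h.rep.quadr_eqs.1
  obtain ⟨m, k⟩ := w
  simpa using h1

theorem Slab.mass_high {F : Frame} {i j : ℤ} {a : Option (ℤ × ℤ) → ℝ} {p : H3} {w : ℤ × ℤ}
    (h : F.Slab i a p j w) :
    a (some (w.1 - j, w.2 + 1)) + a (some (w.1 - j + 1, w.2 + 1)) = (F.crd p.z).2 - w.2 := by
  have h1 := h.rep.quadr_eqs.2.1
  obtain ⟨m, k⟩ := w
  have e1 : ((m, k) : ℤ × ℤ) + (-j, 1) = (m - j, k + 1) := by
    ext <;> simp
    ring
  have e2 : ((m, k) : ℤ × ℤ) + (1 - j, 1) = (m - j + 1, k + 1) := by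
    ext <;> simp
    ring
  rwa [e1, e2] at h1

/-- Barycentric weights with respect to the tetrahedra of one triangulation are unique. -/
theorem Slab.unique {F : Frame} {i j j' : ℤ} (hF : 0 < i → F.inn < 0)
    {a a' : Option (ℤ × ℤ) → ℝ} {p : H3} {w w' : ℤ × ℤ} (h : F.Slab i a p j w)
    (h' : F.Slab i a' p j' w') : a = a' := by
  have key : ∀ {j j' : ℤ} {a a' : Option (ℤ × ℤ) → ℝ} {w w' : ℤ × ℤ}, F.Slab i a p j w →
      F.Slab i a' p j' w' → w.2 < w'.2 → ∀ x, a (some x) = a' (some x) := by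
    -- two strips meet along a line, where only the common row of vertices has weights
    intro j j' a a' w w' h h' hlt
    have m1 := h.mass_low
    have m2 := h.mass_high
    have m1' := h'.mass_low
    have m2' := h'.mass_high
    have n1 := h.rep.nonneg (some (w.1, w.2))
    have n2 := h.rep.nonneg (some (w.1 + 1, w.2))
    have n3 := h'.rep.nonneg (some (w'.1 - j', w'.2 + 1))
    have n4 := h'.rep.nonneg (some (w'.1 - j' + 1, w'.2 + 1))
    have hw : w'.2 = w.2 + 1 := by
      have hr : (w'.2 : ℝ) ≤ w.2 + 1 := by linarith
      have : w'.2 ≤ w.2 + 1 := by exact_mod_cast hr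
      omega
    have hwr : (w'.2 : ℝ) = w.2 + 1 := by exact_mod_cast hw
    have z1 : a (some (w.1, w.2)) = 0 := by linarith
    have z2 : a (some (w.1 + 1, w.2)) = 0 := by linarith
    have z3 : a' (some (w'.1 - j', w'.2 + 1)) = 0 := by linarith
    have z4 : a' (some (w'.1 - j' + 1, w'.2 + 1)) = 0 := by linarith
    have l1 := lowMoment_eq a w
    have l2 := highMoment_eq a' j' w'
    rw [z1, z2] at l1
    rw [z3, z4] at l2
    have t1 := h.rep.quadr_eqs.2.2.1
    have t2 := h'.rep.quadr_eqs.2.2.1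
    rw [l1, highMoment_eq] at t1
    rw [l2, lowMoment_eq] at t2
    have hrow := eq_of_moments (f := fun x => a (some (x, w'.2)))
        (f' := fun x => a' (some (x, w'.2)))
      (m := w.1 - j) (m' := w'.1) (fun x => h.rep.nonneg _) (fun x => h'.rep.nonneg _)
      (fun x hx hx' => by rw [hw]; exact h.eq_zero_high x hx hx')
      (fun x hx hx' => h'.eq_zero_low x hx hx')
      (by rw [m1', hw, m2]; push_cast; linarith) (by rw [hw] at t2 ⊢; linarith)
    rintro ⟨x, y⟩
    by_cases hy : y = w'.2
    · rw [hy]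
      exact hrow x
    · have b1 : a (some (x, y)) = 0 := by
        by_cases hy' : y = w.2
        · rw [hy']
          by_cases hx : x = w.1
          · rw [hx, z1]
          · by_cases hx' : x = w.1 + 1
            · rw [hx', z2]
            · exact h.eq_zero_low x hx hx'
        · exact h.eq_zero_of_snd hy' (by omega)
      have b2 : a' (some (x, y)) = 0 := by
        by_cases hy' : y = w'.2 + 1
        · rw [hy']
          by_cases hx : x = w'.1 - j'
          · rw [hx, z3]
          · by_cases hx' : x = w'.1 - j' + 1
            · rw [hx', z4]
            · exact h'.eq_zero_high x hx hx'
        · exact h'.eq_zero_of_snd hy hy'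
      rw [b1, b2]
  refine h.rep.none_eq_of_some_eq h'.rep ?_
  rcases lt_trichotomy w.2 w'.2 with hw | hw | hw
  · exact key h h' hw
  · have hm : lowMoment a w = lowMoment a' w' :=
      le_antisymm (not_lt.mp (h'.not_lowMoment_lt hF h hw.symm))
        (not_lt.mp (h.not_lowMoment_lt hF h' hw))
    have t1 := h.rep.quadr_eqs.2.2.1
    have t2 := h'.rep.quadr_eqs.2.2.1
    have hm2 : highMoment a j w = highMoment a' j' w' := by linarith
    rw [lowMoment_eq, lowMoment_eq] at hm
    rw [highMoment_eq, highMoment_eq] at hm2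
    have m1 := h.mass_low
    have m2 := h.mass_high
    have m1' := h'.mass_low
    have m2' := h'.mass_high
    rw [← hw] at hm hm2 m1' m2'
    have r1 := eq_of_moments (f := fun x => a (some (x, w.2))) (f' := fun x => a' (some (x, w.2)))
      (m := w.1) (m' := w'.1) (fun x => h.rep.nonneg _) (fun x => h'.rep.nonneg _)
      (fun x hx hx' => h.eq_zero_low x hx hx')
      (fun x hx hx' => by rw [hw]; exact h'.eq_zero_low x hx hx')
      (by rw [m1, m1']) (by simpa using hm)
    have r2 := eq_of_moments (f := fun x => a (some (x, w.2 + 1)))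
      (f' := fun x => a' (some (x, w.2 + 1)))
      (m := w.1 - j) (m' := w'.1 - j') (fun x => h.rep.nonneg _) (fun x => h'.rep.nonneg _)
      (fun x hx hx' => h.eq_zero_high x hx hx')
      (fun x hx hx' => by rw [hw]; exact h'.eq_zero_high x hx hx')
      (by rw [m2, m2']) (by simpa using hm2)
    rintro ⟨x, y⟩
    by_cases hy : y = w.2
    · rw [hy]
      exact r1 x
    · by_cases hy' : y = w.2 + 1
      · rw [hy']
        exact r2 x
      · rw [h.eq_zero_of_snd hy hy', h'.eq_zero_of_snd (by rwa [← hw]) (by rwa [← hw])]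
  · exact fun x => (key h' h hw x).symm

/-- The weights of a point on a cell of the decomposition depend only on the point: this is what
makes the cells fit together. -/
theorem Rep.unique {F : Frame} {i : ℤ} (hF : 0 < i → F.inn < 0) (hi : 0 ≤ i)
    {a a' : Option (ℤ × ℤ) → ℝ}
    {S S' : Finset (Option (ℤ × ℤ))} {p : H3} (h : F.Rep a S p) (h' : F.Rep a' S' p)
    (hS : IsCell i S) (hS' : IsCell i S') : a = a' := by
  obtain ⟨j, w, h1⟩ := h.exists_slab hi hS
  obtain ⟨j', w', h2⟩ := h'.exists_slab hi hS'
  exact h1.unique hF h2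

end Frame

namespace Frame

/-! ### The five vertices of a diagonal exchange -/

/-- The affine dependency of the five vertices involved in a diagonal exchange: `∞` with a positive
coefficient and the ends of the old diagonal on one side, the ends of the new one on the other. -/
def radon (F : Frame) (i : ℤ) (w : ℤ × ℤ) (o : Option (ℤ × ℤ)) : ℝ :=
  match o with
  | none => 2 * (i * Complex.normSq F.u - F.inn)
  | some x => if x = w ∨ x = w + (1 - i, 1) then 1 else
      if x = w + (1, 0) ∨ x = w + (-i, 1) then -1 else 0

theorem radon_none (F : Frame) (i : ℤ) (w : ℤ × ℤ) :
    F.radon i w none = 2 * (i * Complex.normSq F.u - F.inn) := rfl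

theorem radon_b (F : Frame) (i : ℤ) (w : ℤ × ℤ) : F.radon i w (some w) = 1 := by
  simp [radon]

theorem radon_c (F : Frame) (i : ℤ) (w : ℤ × ℤ) : F.radon i w (some (w + (1 - i, 1))) = 1 := by
  simp [radon]

theorem radon_d (F : Frame) (i : ℤ) (w : ℤ × ℤ) : F.radon i w (some (w + (1, 0))) = -1 := by
  simp [radon]

theorem radon_d' (F : Frame) (i : ℤ) (w : ℤ × ℤ) : F.radon i w (some (w + (-i, 1))) = -1 := by
  simp [radon]
  omega

/-- The coefficient at `∞` is positive, that is, the paraboloid over the parallelogram is concave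
along the old diagonal: this is the condition for the diagonal exchange to be geometric. -/
theorem radon_none_pos {F : Frame} (hF : F.inn < 0) {i : ℤ} (hi : 0 ≤ i) (w : ℤ × ℤ) :
    0 < F.radon i w none := by
  have h1 : (0 : ℝ) ≤ i := by exact_mod_cast hi
  have h2 := mul_nonneg h1 (Complex.normSq_nonneg F.u)
  rw [radon_none]
  linarith

theorem radon_supp (F : Frame) (i : ℤ) (w : ℤ × ℤ) {o : Option (ℤ × ℤ)} (ho : o ∉ cone (quadr i w))
    :
    F.radon i w o = 0 := by
  rcases o with _ | x
  · simp at ho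
  · simp only [some_mem_cone, quadr, Finset.mem_insert, Finset.mem_singleton, not_or] at ho
    simp [radon, ho.1, ho.2.1, ho.2.2.1, ho.2.2.2]

theorem Rep.add_radon {F : Frame} {i : ℤ} {w : ℤ × ℤ} {a : Option (ℤ × ℤ) → ℝ} {p : H3}
    (h : F.Rep a (cone (quadr i w)) p) (ε : ℝ) (h0 : ∀ o, 0 ≤ a o + ε * F.radon i w o) :
    F.Rep (fun o => a o + ε * F.radon i w o) (cone (quadr i w)) p := by
  have key : ∀ g : Option (ℤ × ℤ) → ℝ, ∑ o ∈ cone (quadr i w), F.radon i w o * g o = 0 →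
      ∑ o ∈ cone (quadr i w), (a o + ε * F.radon i w o) * g o =
        ∑ o ∈ cone (quadr i w), a o * g o := by
    intro g hg
    have : ∀ o, (a o + ε * F.radon i w o) * g o = a o * g o + ε * (F.radon i w o * g o) :=
      fun o => by ring
    simp only [this]
    rw [Finset.sum_add_distrib, ← Finset.mul_sum, hg, mul_zero, add_zero]
  have hsum : ∀ g : Option (ℤ × ℤ) → ℝ, ∑ o ∈ cone (quadr i w), F.radon i w o * g o =
      2 * (i * Complex.normSq F.u - F.inn) * g none + (g (some w) + g (some (w + (1 - i, 1))) -
        g (some (w + (1, 0))) - g (some (w + (-i, 1)))) := by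
    intro g
    rw [cone, Finset.sum_insertNone, sum_quadr, radon_none, radon_b, radon_c, radon_d, radon_d']
    ring
  refine ⟨h0, fun o ho => by rw [h.supp o ho, F.radon_supp i w ho]; ring, ?_, ?_, ?_, ?_⟩
  · rw [key _ (by rw [hsum]; simp [mass]), h.mass_eq]
  · rw [key _ (by rw [hsum]; simp [posX]; ring), h.posX_eq]
  · rw [key _ (by rw [hsum]; simp [posY]), h.posY_eq]
  · rw [key _ (by rw [hsum]; simp [energy, quad, cast]; ring), h.energy_eq]

/-- To keep all weights nonnegative after adding a multiple of the dependency it is enough to look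
at the five vertices in its support. -/
theorem radon_cases {F : Frame} {i : ℤ} {w : ℤ × ℤ} {a : Option (ℤ × ℤ) → ℝ} {ε : ℝ}
    (ha : ∀ o, 0 ≤ a o) (h1 : 0 ≤ a none + ε * F.radon i w none)
    (h2 : 0 ≤ a (some w) + ε) (h3 : 0 ≤ a (some (w + (1 - i, 1))) + ε)
    (h4 : 0 ≤ a (some (w + (1, 0))) - ε) (h5 : 0 ≤ a (some (w + (-i, 1))) - ε) (o : Option (ℤ × ℤ))
        :
    0 ≤ a o + ε * F.radon i w o := by
  by_cases ho : o ∈ cone (quadr i w)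
  · rcases o with _ | x
    · exact h1
    · simp only [some_mem_cone, quadr, Finset.mem_insert, Finset.mem_singleton] at ho
      rcases ho with rfl | rfl | rfl | rfl
      · rw [radon_b]; linarith
      · rw [radon_d]; linarith
      · rw [radon_d']; linarith
      · rw [radon_c]; linarith
  · rw [F.radon_supp i w ho, mul_zero, add_zero]
    exact ha o

theorem notMem_cone_cases {i : ℤ} {w : ℤ × ℤ} {f : Option (ℤ × ℤ) → ℝ} {T : Finset (Option (ℤ × ℤ))}
    (hf : ∀ o ∉ cone (quadr i w), f o = 0) {o₀ : Option (ℤ × ℤ)} (h0 : f o₀ = 0)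
    (hT : ∀ o ∈ cone (quadr i w), o ∉ T → o = o₀) : ∀ o ∉ T, f o = 0 := by
  intro o ho
  by_cases h : o ∈ cone (quadr i w)
  · rw [hT o h ho, h0]
  · exact hf o h

/-- The two cones over the triangles of a parallelogram fill the cone over the parallelogram. -/
theorem hull_cone_quadr_old {F : Frame} (hF : F.inn < 0) {i : ℤ} (hi : 0 ≤ i) (w : ℤ × ℤ) :
    hull (F.ideal '' cone (quadr i w)) =
      hull (F.ideal '' cone (triUp i w)) ∪ hull (F.ideal '' cone (triDown i w)) := by
  apply subset_antisymm
  · intro p hp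
    obtain ⟨a, ha⟩ := F.mem_hull_iff.mp hp
    have n := ha.nonneg
    have hρ := radon_none_pos hF hi w
    have hmin := min_le_left (a (some (w + (1, 0)))) (a (some (w + (-i, 1))))
    have hmin' := min_le_right (a (some (w + (1, 0)))) (a (some (w + (-i, 1))))
    have hmin0 := le_min (n (some (w + (1, 0)))) (n (some (w + (-i, 1))))
    have h := ha.add_radon (min (a (some (w + (1, 0)))) (a (some (w + (-i, 1)))))
      (radon_cases n (add_nonneg (n _) (mul_nonneg hmin0 hρ.le)) (add_nonneg (n _) hmin0)
        (add_nonneg (n _) hmin0) (by linarith) (by linarith))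
    rcases min_choice (a (some (w + (1, 0)))) (a (some (w + (-i, 1)))) with hm | hm
    · rw [hm] at h
      right
      refine (h.of_supp (T := cone (triDown i w)) (notMem_cone_cases h.supp
        (o₀ := some (w + (1, 0))) (by rw [radon_d]; ring) ?_)).mem_hull
      rintro (_ | x)
      · simp
      · simp only [some_mem_cone, quadr, triDown, Finset.mem_insert, Finset.mem_singleton,
          Option.some.injEq]
        tauto
    · rw [hm] at h
      left
      refine (h.of_supp (T := cone (triUp i w)) (notMem_cone_cases h.supp
        (o₀ := some (w + (-i, 1))) (by rw [radon_d']; ring) ?_)).mem_hull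
      rintro (_ | x)
      · simp
      · simp only [some_mem_cone, quadr, triUp, Finset.mem_insert, Finset.mem_singleton,
          Option.some.injEq]
        tauto
  · apply union_subset <;> apply hull_mono <;> apply image_mono <;> rw [Finset.coe_subset]
    · exact cone_mono (triUp_subset_quadr i w)
    · exact cone_mono (triDown_subset_quadr i w)

theorem triDown_succ (i : ℤ) (w : ℤ × ℤ) :
    triDown (i + 1) (w + (1, 0)) = {w + (1, 0), w + (-i, 1), w + (1 - i, 1)} := by
  have h1 : w + (1, 0) + (-(i + 1), 1) = w + (-i, 1) := by
    ext <;> simp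
  have h2 : w + (1, 0) + (1 - (i + 1), 1) = w + (1 - i, 1) := by
    ext <;> simp
    ring
  rw [triDown, h1, h2]

theorem triUp_succ (i : ℤ) (w : ℤ × ℤ) : triUp (i + 1) w = {w, w + (1, 0), w + (-i, 1)} := by
  have h1 : w + (1 - (i + 1), 1) = w + (-i, 1) := by
    ext <;> simp
  rw [triUp, h1]

/-- The tetrahedron over the parallelogram and the cones over the two triangles on the other side
of it fill the cone over the parallelogram. -/
theorem hull_cone_quadr_new {F : Frame} (hF : F.inn < 0) {i : ℤ} (hi : 0 ≤ i) (w : ℤ × ℤ) :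
    hull (F.ideal '' cone (quadr i w)) = hull (F.ideal '' face (quadr i w)) ∪
      hull (F.ideal '' cone (triDown (i + 1) (w + (1, 0)))) ∪
        hull (F.ideal '' cone (triUp (i + 1) w)) := by
  rw [triDown_succ, triUp_succ]
  apply subset_antisymm
  · intro p hp
    obtain ⟨a, ha⟩ := F.mem_hull_iff.mp hp
    have n := ha.nonneg
    have hρ := radon_none_pos hF hi w
    -- the largest multiple of the dependency that can be subtracted
    obtain ⟨ε, h0, h1, h2, h3, h4⟩ : ∃ ε : ℝ, 0 ≤ ε ∧ ε * F.radon i w none ≤ a none ∧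
        ε ≤ a (some w) ∧ ε ≤ a (some (w + (1 - i, 1))) ∧
        (ε * F.radon i w none = a none ∨ ε = a (some w) ∨ ε = a (some (w + (1 - i, 1)))) := by
      refine ⟨min (a none / F.radon i w none) (min (a (some w)) (a (some (w + (1 - i, 1))))),
        le_min (div_nonneg (n _) hρ.le) (le_min (n _) (n _)), ?_,
        (min_le_right _ _).trans (min_le_left _ _), (min_le_right _ _).trans (min_le_right _ _), ?_⟩
      · rw [← le_div_iff₀ hρ]
        exact min_le_left _ _
      · rcases min_choice (a none / F.radon i w none)
          (min (a (some w)) (a (some (w + (1 - i, 1))))) with h | h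
        · left
          rw [h, div_mul_cancel₀ _ hρ.ne']
        · right
          rw [h]
          exact min_choice _ _
    have h := ha.add_radon (-ε) (radon_cases n (by linarith) (by linarith) (by linarith)
      (by linarith [n (some (w + (1, 0)))]) (by linarith [n (some (w + (-i, 1)))]))
    rcases h4 with h4 | h4 | h4
    · left; left
      refine (h.of_supp (T := face (quadr i w)) (notMem_cone_cases h.supp
        (o₀ := none) (by rw [← h4]; ring) ?_)).mem_hull
      rintro (_ | x)
      · simp
      · simp
    · left; right
      refine (h.of_supp (notMem_cone_cases h.supp
        (o₀ := some w) (by rw [radon_b, ← h4]; ring) ?_)).mem_hull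
      rintro (_ | x)
      · simp
      · simp only [some_mem_cone, quadr, Finset.mem_insert, Finset.mem_singleton,
          Option.some.injEq]
        tauto
    · right
      refine (h.of_supp (notMem_cone_cases h.supp
        (o₀ := some (w + (1 - i, 1))) (by rw [radon_c, ← h4]; ring) ?_)).mem_hull
      rintro (_ | x)
      · simp
      · simp only [some_mem_cone, quadr, Finset.mem_insert, Finset.mem_singleton,
          Option.some.injEq]
        tauto
  · refine union_subset (union_subset ?_ ?_) ?_ <;> apply hull_mono <;> apply image_mono <;>
      rw [Finset.coe_subset]
    · exact face_subset_cone _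
    · apply cone_mono
      intro x
      simp only [quadr, Finset.mem_insert, Finset.mem_singleton]
      tauto
    · apply cone_mono
      intro x
      simp only [quadr, Finset.mem_insert, Finset.mem_singleton]
      tauto

/-! ### Change of basis along the fan -/

/-- The frame with the second basis vector replaced by `v - i u`. -/
def shear (F : Frame) (i : ℤ) : Frame where
  c := F.c
  u := F.u
  v := F.v - i * F.u
  cross_ne := by
    have h := F.cross_ne
    intro h2
    apply h
    rw [← h2]
    simp
    ring

/-- The coordinates with respect to the original basis, as a function of the coordinates with
respect to the sheared basis. -/
def shearMap (i : ℤ) : (ℤ × ℤ) ≃+ (ℤ × ℤ) where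
  toFun w := (w.1 - i * w.2, w.2)
  invFun w := (w.1 + i * w.2, w.2)
  left_inv w := by simp
  right_inv w := by simp
  map_add' w w' := by
    ext <;> simp
    ring

theorem shearMap_apply (i : ℤ) (w : ℤ × ℤ) : shearMap i w = (w.1 - i * w.2, w.2) := rfl

theorem shear_zero (F : Frame) : F.shear 0 = F := by
  ext <;> simp [shear]

theorem shear_pt_cast (F : Frame) (i : ℤ) (w : ℤ × ℤ) :
    (F.shear i).pt (cast w) = F.pt (cast (shearMap i w)) := by
  simp [pt, cast, shear, shearMap_apply]
  ring

theorem shear_ideal_some (F : Frame) (i : ℤ) (w : ℤ × ℤ) :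
    (F.shear i).ideal (some w) = F.ideal (some (shearMap i w)) := by
  rw [ideal_some, ideal_some, shear_pt_cast]

theorem coe_face (S : Finset (ℤ × ℤ)) : (face S : Set (Option (ℤ × ℤ))) = some '' S := by
  simp [face]

theorem coe_cone (S : Finset (ℤ × ℤ)) :
    (cone S : Set (Option (ℤ × ℤ))) = insert none (some '' S) := by
  ext (_ | x) <;> simp

theorem shear_image_face (F : Frame) (i : ℤ) (S : Finset (ℤ × ℤ)) :
    (F.shear i).ideal '' face S = F.ideal '' face (S.image (shearMap i)) := by
  simp only [coe_face, image_image, shear_ideal_some, Finset.coe_image]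

theorem shear_image_cone (F : Frame) (i : ℤ) (S : Finset (ℤ × ℤ)) :
    (F.shear i).ideal '' cone S = F.ideal '' cone (S.image (shearMap i)) := by
  simp only [coe_cone, image_insert_eq, image_image, shear_ideal_some, Finset.coe_image, ideal_none]

theorem shearMap_one_zero (i : ℤ) : shearMap i (1, 0) = (1, 0) := by simp [shearMap_apply]

theorem shearMap_zero_one (i : ℤ) : shearMap i (0, 1) = (-i, 1) := by simp [shearMap_apply]

theorem shearMap_one_one (i : ℤ) : shearMap i (1, 1) = (1 - i, 1) := by simp [shearMap_apply]

theorem image_triUp (i : ℤ) (w : ℤ × ℤ) :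
    (triUp 0 w).image (shearMap i) = triUp i (shearMap i w) := by
  simp only [triUp, Finset.image_insert, Finset.image_singleton, map_add, sub_zero,
    shearMap_one_zero, shearMap_one_one]

theorem image_triDown (i : ℤ) (w : ℤ × ℤ) :
    (triDown 0 w).image (shearMap i) = triDown i (shearMap i w) := by
  simp only [triDown, Finset.image_insert, Finset.image_singleton, map_add, sub_zero, neg_zero,
    shearMap_zero_one, shearMap_one_one]

theorem mem_region_shear_iff (F : Frame) (i : ℤ) {p : H3} : p ∈ (F.shear i).region ↔
    ∃ w, p ∈ hull (F.ideal '' cone (triUp i w)) ∨ p ∈ hull (F.ideal '' cone (triDown i w)) := by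
  rw [mem_region_iff]
  constructor
  · rintro ⟨T, ⟨w, rfl | rfl⟩, h⟩
    · rw [shear_image_cone, image_triUp] at h
      exact ⟨_, Or.inl h⟩
    · rw [shear_image_cone, image_triDown] at h
      exact ⟨_, Or.inr h⟩
  · rintro ⟨w, h | h⟩
    · refine ⟨triUp 0 ((shearMap i).symm w), ⟨_, Or.inl rfl⟩, ?_⟩
      rwa [shear_image_cone, image_triUp, AddEquiv.apply_symm_apply]
    · refine ⟨triDown 0 ((shearMap i).symm w), ⟨_, Or.inr rfl⟩, ?_⟩
      rwa [shear_image_cone, image_triDown, AddEquiv.apply_symm_apply]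

theorem region_shear_succ_union {F : Frame} (hF : F.inn < 0) {i : ℤ} (hi : 0 ≤ i) {p : H3} :
    p ∈ (F.shear i).region ↔
      p ∈ (F.shear (i + 1)).region ∨ ∃ w, p ∈ hull (F.ideal '' face (quadr i w)) := by
  have h : p ∈ (F.shear i).region ↔ ∃ w, p ∈ hull (F.ideal '' cone (quadr i w)) := by
    simp only [mem_region_shear_iff, hull_cone_quadr_old hF hi, mem_union]
  rw [h, mem_region_shear_iff]
  constructor
  · rintro ⟨w, hw⟩
    rw [hull_cone_quadr_new hF hi] at hw
    rcases hw with (hw | hw) | hw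
    · exact Or.inr ⟨w, hw⟩
    · exact Or.inl ⟨_, Or.inr hw⟩
    · exact Or.inl ⟨_, Or.inl hw⟩
  · rintro (⟨w, hw | hw⟩ | ⟨w, hw⟩)
    · exact ⟨w, by rw [hull_cone_quadr_new hF hi]; exact Or.inr hw⟩
    · refine ⟨w - (1, 0), ?_⟩
      rw [hull_cone_quadr_new hF hi, sub_add_cancel]
      exact Or.inl (Or.inr hw)
    · exact ⟨w, by rw [hull_cone_quadr_new hF hi]; exact Or.inl (Or.inl hw)⟩

end Frame

/-! ### The drilled ananas above a lattice triangulation -/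

instance : Nonempty Cover := ⟨⟨((0, 0), 1), zero_le_one, fun h => absurd h one_ne_zero⟩⟩

/-- When the developing map is an embedding, the ideal cells are the preimages of hulls. -/
theorem isIdealCell_iff {dev : Cover → H3} (hdev : IsEmbedding dev) {C : Set Cover} {V : Set Ideal}
    :
    IsIdealCell dev C V ↔ hull V ⊆ range dev ∧ C = dev ⁻¹' hull V := by
  constructor
  · rintro ⟨σ, -, h2, rfl⟩
    refine ⟨fun p hp => ⟨σ p, h2 p hp⟩, ?_⟩
    ext x
    constructor
    · rintro ⟨p, hp, rfl⟩
      rw [mem_preimage, h2 p hp]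
      exact hp
    · intro hx
      exact ⟨dev x, hx, hdev.injective (h2 _ hx)⟩
  · rintro ⟨h, rfl⟩
    have hr : ∀ p ∈ hull V, dev (Function.invFun dev p) = p := fun p hp => Function.invFun_eq (h hp)
    refine ⟨Function.invFun dev, ?_, hr, ?_⟩
    · rw [hdev.isInducing.continuousOn_iff]
      exact continuousOn_id.congr hr
    · ext x
      constructor
      · rintro ⟨p, hp, rfl⟩
        rw [mem_preimage, hr p hp]
        exact hp
      · intro hx
        exact ⟨dev x, hx, Function.leftInverse_invFun hdev.injective x⟩

theorem isCompleteDev_of_isClosedEmbedding {dev : Cover → H3} (hdev : IsClosedEmbedding dev) :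
    IsCompleteDev dev := by
  intro u hu
  have h : CauchySeq fun n => dev (u n) := by
    rw [EMetric.cauchySeq_iff]
    intro ε hε
    obtain ⟨N, hN⟩ := hu ε hε
    exact ⟨N, fun m hm n hn => (edist_le_pathDist dev _ _).trans_lt (hN m hm n hn)⟩
  obtain ⟨p, hp⟩ := cauchySeq_tendsto_of_complete h
  obtain ⟨x, rfl⟩ : p ∈ range dev :=
    hdev.isClosed_range.mem_of_tendsto hp (Eventually.of_forall fun n => mem_range_self _)
  exact ⟨x, hdev.isInducing.tendsto_nhds_iff.mpr hp⟩

theorem IsStdTriangle.exists_finset {S : Set (ℤ × ℤ)} (h : IsStdTriangle S) :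
    ∃ T, Frame.IsTri T ∧ S = (T : Set (ℤ × ℤ)) := by
  obtain ⟨v, rfl | rfl⟩ := h
  · exact ⟨Frame.triUp 0 v, ⟨v, Or.inl rfl⟩, by simp [Frame.triUp]⟩
  · exact ⟨Frame.triDown 0 v, ⟨v, Or.inr rfl⟩, by simp [Frame.triDown]⟩

theorem Frame.IsTri.isStdTriangle {T : Finset (ℤ × ℤ)} (h : Frame.IsTri T) :
    IsStdTriangle (T : Set (ℤ × ℤ)) := by
  obtain ⟨v, rfl | rfl⟩ := h
  · exact ⟨v, Or.inl (by simp [Frame.triUp])⟩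
  · exact ⟨v, Or.inr (by simp [Frame.triDown])⟩

theorem IsStdEdge.exists_finset {S : Set (ℤ × ℤ)} (h : IsStdEdge S) :
    ∃ E T, Frame.IsTri T ∧ E ⊆ T ∧ S = (E : Set (ℤ × ℤ)) := by
  obtain ⟨v, rfl | rfl | rfl⟩ := h
  · refine ⟨{v, v + (1, 0)}, Frame.triUp 0 v, ⟨v, Or.inl rfl⟩, ?_, by simp⟩
    intro x
    simp [Frame.triUp]
    tauto
  · refine ⟨{v, v + (0, 1)}, Frame.triDown 0 v, ⟨v, Or.inr rfl⟩, ?_, by simp⟩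
    intro x
    simp [Frame.triDown]
    tauto
  · refine ⟨{v, v + (1, 1)}, Frame.triUp 0 v, ⟨v, Or.inl rfl⟩, ?_, by simp⟩
    intro x
    simp [Frame.triUp]
    tauto

namespace Frame

/-- The vertical coordinate of the model: it interpolates between the surface at `r = 0` and the
horosphere of height `top` at `r = 1`, and it is linear from there on. -/
def profile (F : Frame) (h r : ℝ) : ℝ := max (1 - r) 0 * h + r * F.top

/-- Inverse of `profile F h`. -/
def profileInv (F : Frame) (h t : ℝ) : ℝ := min ((t - h) / (F.top - h)) (t / F.top)

theorem profile_of_le (F : Frame) {h r : ℝ} (hr : r ≤ 1) :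
    F.profile h r = h + r * (F.top - h) := by
  rw [profile, max_eq_left (by linarith)]
  ring

theorem profile_of_ge (F : Frame) {h r : ℝ} (hr : 1 ≤ r) : F.profile h r = r * F.top := by
  rw [profile, max_eq_right (by linarith)]
  ring

theorem profileInv_profile (F : Frame) {h r : ℝ} (h0 : 0 ≤ h) (h1 : h < F.top) :
    F.profileInv h (F.profile h r) = r := by
  have hM := F.one_le_top
  have hM0 : 0 < F.top := by linarith
  have hd : 0 < F.top - h := by linarith
  rcases le_total r 1 with hr1 | hr1
  · rw [F.profile_of_le hr1, profileInv, add_sub_cancel_left, mul_div_cancel_right₀ _ hd.ne',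
      min_eq_left]
    rw [le_div_iff₀ hM0]
    nlinarith
  · rw [F.profile_of_ge hr1, profileInv, mul_div_cancel_right₀ _ hM0.ne', min_eq_right]
    rw [le_div_iff₀ hd]
    nlinarith

theorem profile_profileInv (F : Frame) {h t : ℝ} (h0 : 0 ≤ h) (h1 : h < F.top) :
    F.profile h (F.profileInv h t) = t := by
  have hM := F.one_le_top
  have hM0 : 0 < F.top := by linarith
  have hd : 0 < F.top - h := by linarith
  rcases le_total t F.top with h2 | h2
  · have e : F.profileInv h t = (t - h) / (F.top - h) := by
      rw [profileInv, min_eq_left]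
      rw [div_le_div_iff₀ hd hM0]
      nlinarith
    have hle : (t - h) / (F.top - h) ≤ 1 := by
      rw [div_le_one hd]
      linarith
    rw [e, F.profile_of_le hle, div_mul_cancel₀ _ hd.ne']
    ring
  · have e : F.profileInv h t = t / F.top := by
      rw [profileInv, min_eq_right]
      rw [div_le_div_iff₀ hM0 hd]
      nlinarith
    have hle : 1 ≤ t / F.top := by rwa [one_le_div hM0]
    rw [e, F.profile_of_ge hle, div_mul_cancel₀ _ hM0.ne']

theorem profileInv_nonneg (F : Frame) {h t : ℝ} (h0 : 0 ≤ h) (h1 : h < F.top) (ht : h ≤ t) :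
    0 ≤ F.profileInv h t := by
  have hM := F.one_le_top
  exact le_min (div_nonneg (by linarith) (by linarith)) (div_nonneg (by linarith) (by linarith))

theorem height_pt (F : Frame) (q : ℝ × ℝ) : F.height (F.pt q) = √(F.gap q) := by
  rw [height, crd_pt]

theorem cover_notMem (x : Cover) (h : x.1.2 = 0) : x.1.1 ∉ range cast := by
  rintro ⟨w, hw⟩
  exact x.2.2 h ⟨w.1, w.2, hw.symm⟩

theorem profile_pos (F : Frame) (x : Cover) : 0 < F.profile (F.height (F.pt x.1.1)) x.1.2 := by
  have hM := F.one_le_top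
  have h0 := F.height_nonneg (F.pt x.1.1)
  rcases x.2.1.eq_or_lt with h | h
  · rw [← h, F.profile_of_le zero_le_one, zero_mul, add_zero]
    apply F.height_pos
    rw [crd_pt]
    exact cover_notMem x h.symm
  · unfold profile
    have := le_max_right (1 - x.1.2) 0
    positivity

/-- The homeomorphism of the universal cover with the region above the surface. -/
def modelDev (F : Frame) (x : Cover) : H3 :=
  ⟨F.pt x.1.1, F.profile (F.height (F.pt x.1.1)) x.1.2, F.profile_pos x⟩

theorem continuous_modelDev (F : Frame) : Continuous F.modelDev := by
  rw [H3.continuous_iff]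
  have h1 : Continuous fun x : Cover => F.pt x.1.1 :=
    F.continuous_pt.comp (continuous_fst.comp continuous_subtype_val)
  have h2 : Continuous fun x : Cover => x.1.2 := continuous_snd.comp continuous_subtype_val
  refine ⟨h1, ?_⟩
  have h3 := F.continuous_height.comp h1
  exact (((continuous_const.sub h2).max continuous_const).mul h3).add (h2.mul continuous_const)

theorem modelDev_mem (F : Frame) (x : Cover) : F.modelDev x ∈ F.region := by
  rw [mem_region]
  have h0 := F.height_nonneg (F.pt x.1.1)
  have h1 := F.height_lt_top (F.pt x.1.1)
  have hx := x.2.1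
  simp only [modelDev]
  rcases le_total x.1.2 1 with h | h
  · rw [F.profile_of_le h]
    nlinarith
  · rw [F.profile_of_ge h]
    nlinarith

/-- The inverse of `modelDev`. -/
def modelInv (F : Frame) (p : F.region) : Cover :=
  ⟨(F.crd p.1.z, F.profileInv (F.height p.1.z) p.1.t),
    F.profileInv_nonneg (F.height_nonneg _) (F.height_lt_top _) p.2, by
      rintro h ⟨m, n, hmn⟩
      dsimp only at h hmn
      have h2 := F.profile_profileInv (t := p.1.t) (F.height_nonneg p.1.z) (F.height_lt_top _)
      rw [h, F.profile_of_le zero_le_one, zero_mul, add_zero] at h2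
      have h3 : F.height p.1.z = 0 := by
        rw [height, hmn]
        have := F.gap_cast (m, n)
        rw [cast] at this
        rw [this, Real.sqrt_zero]
      have := p.1.pos
      linarith⟩

theorem modelDev_modelInv (F : Frame) (p : F.region) : F.modelDev (F.modelInv p) = p := by
  have h : F.pt (F.modelInv p).1.1 = p.1.z := F.pt_crd _
  ext
  · exact h
  · simp only [modelDev, h]
    exact F.profile_profileInv (F.height_nonneg _) (F.height_lt_top _)

theorem modelInv_modelDev (F : Frame) (x : Cover) : F.modelInv ⟨F.modelDev x, F.modelDev_mem x⟩ = x
    := by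
  apply Subtype.ext
  apply Prod.ext
  · exact F.crd_pt _
  · exact F.profileInv_profile (F.height_nonneg _) (F.height_lt_top _)

theorem continuous_modelInv (F : Frame) : Continuous F.modelInv := by
  have hz : Continuous fun p : F.region => p.1.z := H3.continuous_z.comp continuous_subtype_val
  have ht : Continuous fun p : F.region => p.1.t := H3.continuous_t.comp continuous_subtype_val
  have hh := F.continuous_height.comp hz
  have hM := F.one_le_top
  refine Continuous.subtype_mk ((F.continuous_crd.comp hz).prodMk ?_) _
  refine Continuous.min ((ht.sub hh).div (continuous_const.sub hh) fun p => ?_) (ht.div_const _)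
  exact (sub_pos.mpr (F.height_lt_top _)).ne'

theorem isClosedEmbedding_modelDev (F : Frame) : IsClosedEmbedding F.modelDev := by
  let e : Cover ≃ₜ F.region :=
    { toFun := fun x => ⟨F.modelDev x, F.modelDev_mem x⟩
      invFun := F.modelInv
      left_inv := F.modelInv_modelDev
      right_inv := fun p => Subtype.ext (F.modelDev_modelInv p)
      continuous_toFun := F.continuous_modelDev.subtype_mk _
      continuous_invFun := F.continuous_modelInv }
  exact F.isClosed_region.isClosedEmbedding_subtypeVal.comp e.isClosedEmbedding

theorem range_modelDev (F : Frame) : range F.modelDev = F.region := by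
  ext p
  constructor
  · rintro ⟨x, rfl⟩
    exact F.modelDev_mem x
  · intro hp
    exact ⟨F.modelInv ⟨p, hp⟩, F.modelDev_modelInv ⟨p, hp⟩⟩

theorem modelDev_t_gt (F : Frame) {x : Cover} : F.height (F.modelDev x).z < (F.modelDev x).t ↔
    0 < x.1.2 := by
  have h0 := F.height_nonneg (F.pt x.1.1)
  have h1 := F.height_lt_top (F.pt x.1.1)
  simp only [modelDev]
  constructor
  · intro h
    refine lt_of_le_of_ne x.2.1 fun h2 => ?_
    rw [← h2, F.profile_of_le zero_le_one] at h
    linarith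
  · intro h
    rcases le_total x.1.2 1 with h2 | h2
    · rw [F.profile_of_le h2]
      nlinarith
    · rw [F.profile_of_ge h2]
      nlinarith

theorem face_subset_region (F : Frame) {S T : Finset (ℤ × ℤ)} (hT : IsTri T) (hST : S ⊆ T) :
    hull (F.ideal '' face S) ⊆ F.region := fun _ hp =>
  F.mem_region_iff.mpr ⟨T, hT, hull_mono (image_mono (Finset.coe_subset.mpr
    ((face_subset_cone S).trans (cone_mono hST)))) hp⟩

theorem modelDev_preimage_face (F : Frame) {S T : Finset (ℤ × ℤ)} (hT : IsTri T) (hST : S ⊆ T) :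
    F.modelDev ⁻¹' hull (F.ideal '' face S) = boundaryCell S := by
  ext x
  rw [mem_preimage, F.mem_hull_face_iff hT hST, ← height_eq_iff]
  have hle : F.height (F.modelDev x).z ≤ (F.modelDev x).t := F.modelDev_mem x
  have hz : F.crd (F.modelDev x).z = x.1.1 := F.crd_pt _
  rw [hz]
  have h := F.modelDev_t_gt (x := x)
  have hx := x.2.1
  constructor
  · rintro ⟨h1, h2⟩
    refine ⟨?_, h1⟩
    by_contra h3
    exact (h.mpr (lt_of_le_of_ne hx (Ne.symm h3))).ne h2
  · rintro ⟨h1, h2⟩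
    refine ⟨h2, le_antisymm hle (not_lt.mp fun h3 => ?_)⟩
    exact (h.mp h3).ne' h1

theorem image_face (F : Frame) (S : Finset (ℤ × ℤ)) :
    F.ideal '' face S = (fun w => F.ideal (some w)) '' (S : Set (ℤ × ℤ)) := by
  rw [coe_face, image_image]

theorem isIdealCell_boundaryCell (F : Frame) {S T : Finset (ℤ × ℤ)} (hT : IsTri T) (hST : S ⊆ T) :
    IsIdealCell F.modelDev (boundaryCell S) ((fun w => F.ideal (some w)) '' (S : Set (ℤ × ℤ))) := by
  rw [isIdealCell_iff F.isClosedEmbedding_modelDev.isEmbedding, ← image_face, range_modelDev]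
  exact ⟨F.face_subset_region hT hST, (F.modelDev_preimage_face hT hST).symm⟩

theorem linearIndependent_basis (F : Frame) : LinearIndependent ℝ ![F.u, F.v] := by
  rw [LinearIndependent.pair_iff]
  intro s t h
  have h1 : F.pt (s, t) = F.pt (0, 0) := by
    have h2 : (s : ℂ) * F.u + t * F.v = 0 := by simpa using h
    simp only [pt]
    push_cast
    linear_combination h2
  have h2 := F.pt_injective h1
  simpa using h2

/-- The region above the surface of a frame, as a drilled ananas. -/
def model (F : Frame) : DrilledAnanas where
  dev := F.modelDev
  continuous_dev := F.continuous_modelDev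
  isLocalHomeomorphOn_dev := by
    rw [isLocalHomeomorphOn_iff_isOpenEmbedding_restrict]
    intro x hx
    have ho : IsOpen {x : Cover | 0 < x.1.2} :=
      isOpen_lt continuous_const (continuous_snd.comp continuous_subtype_val)
    refine ⟨_, ho.mem_nhds hx, F.isClosedEmbedding_modelDev.isEmbedding.comp .subtypeVal, ?_⟩
    have : range (domRestrict {x : Cover | 0 < x.1.2} F.modelDev) = {p | F.height p.z < p.t} := by
      ext p
      constructor
      · rintro ⟨x, rfl⟩
        exact F.modelDev_t_gt.mpr x.2
      · intro hp
        have hp' : F.height p.z < p.t := hp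
        obtain ⟨x, rfl⟩ : p ∈ range F.modelDev := by
          rw [range_modelDev]
          exact hp'.le
        exact ⟨⟨x, F.modelDev_t_gt.mp hp'⟩, rfl⟩
    rw [this]
    exact isOpen_lt (F.continuous_height.comp H3.continuous_z) H3.continuous_t
  locally_injective x := ⟨univ, univ_mem, F.isClosedEmbedding_modelDev.injective.injOn⟩
  ω₁ := F.u
  ω₂ := F.v
  linearIndependent := F.linearIndependent_basis
  dev_shift_z v x := by
    simp only [modelDev, pt, shift]
    push_cast
    ring
  dev_shift_t v x := by
    have h : (shift v x).1.1 = x.1.1 + cast v := rfl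
    simp only [modelDev, height_pt, h, gap_add_cast]
    rfl
  complete := isCompleteDev_of_isClosedEmbedding F.isClosedEmbedding_modelDev
  horocusp := by
    have hM : 0 < F.top := by linarith [F.one_le_top]
    have hmk : ∀ p : H3, 1 ≤ p.t / F.top → ∃ x : Cover, x.1.2 = p.t / F.top ∧ F.modelDev x = p := by
      intro p hp
      refine ⟨⟨(F.crd p.z, p.t / F.top), by linarith, fun h => ?_⟩, rfl, ?_⟩
      · simp only at h
        linarith
      · ext
        · exact F.pt_crd _
        · simp only [modelDev]
          rw [F.profile_of_ge hp, div_mul_cancel₀ _ hM.ne']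
    refine ⟨1, one_pos, F.isClosedEmbedding_modelDev.injective.injOn, ⟨F.top, hM, ?_⟩, ?_⟩
    · ext p
      constructor
      · rintro ⟨x, hx, rfl⟩
        have hx' : 1 ≤ x.1.2 := hx
        change F.top ≤ F.profile _ _
        rw [F.profile_of_ge hx']
        nlinarith
      · intro hp
        have hp' : 1 ≤ p.t / F.top := (one_le_div hM).mpr hp
        obtain ⟨x, hx, rfl⟩ := hmk p hp'
        exact ⟨x, by rw [mem_ofPred_eq, hx]; exact hp', rfl⟩
    · intro y hy
      refine ⟨y * F.top, ?_⟩
      ext p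
      constructor
      · rintro ⟨x, hx, rfl⟩
        have hx' : x.1.2 = y := hx
        change F.profile _ _ = _
        rw [hx', F.profile_of_ge hy.le]
      · intro hp
        have hp' : p.t / F.top = y := by
          rw [div_eq_iff hM.ne']
          exact hp
        obtain ⟨x, hx, rfl⟩ := hmk p (by rw [hp']; exact hy.le)
        exact ⟨x, by rw [mem_ofPred_eq, hx]; exact hp', rfl⟩
  vert w := F.ideal (some w)
  injOn_vert S _ := fun w _ w' _ h => Option.some_injective _ (F.ideal_injective h)
  boundary_triangle S hS := by
    obtain ⟨T, hT, rfl⟩ := hS.exists_finset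
    exact F.isIdealCell_boundaryCell hT subset_rfl
  boundary_edge S hS := by
    obtain ⟨E, T, hT, hET, rfl⟩ := hS.exists_finset
    exact F.isIdealCell_boundaryCell hT hET

end Frame

/-! ### The boundary of a drilled ananas -/

theorem IsIdealCell.image_eq {dev : Cover → H3} {C : Set Cover} {V : Set Ideal}
    (h : IsIdealCell dev C V) : dev '' C = hull V := by
  obtain ⟨σ, -, h2, rfl⟩ := h
  ext p
  constructor
  · rintro ⟨_, ⟨q, hq, rfl⟩, rfl⟩
    rwa [h2 q hq]
  · intro hp
    exact ⟨σ p, ⟨p, hp, rfl⟩, h2 p hp⟩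

theorem IsIdealCell.injOn {dev : Cover → H3} {C : Set Cover} {V : Set Ideal}
    (h : IsIdealCell dev C V) : InjOn dev C := by
  obtain ⟨σ, -, h2, rfl⟩ := h
  rintro _ ⟨p, hp, rfl⟩ _ ⟨q, hq, rfl⟩ hpq
  rw [h2 p hp, h2 q hq] at hpq
  rw [hpq]

theorem shift_shift (v w : ℤ × ℤ) (x : Cover) : shift v (shift w x) = shift (w + v) x := by
  apply Subtype.ext
  simp only [shift, Prod.fst_add, Prod.snd_add, Int.cast_add, add_assoc]

theorem shift_zero (x : Cover) : shift 0 x = x := by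
  apply Subtype.ext
  simp [shift]

theorem shift_mem_boundaryCell {S : Set (ℤ × ℤ)} {x : Cover} (w : ℤ × ℤ) (hx : x ∈ boundaryCell S) :
    shift w x ∈ boundaryCell ((· + w) '' S) := by
  refine ⟨hx.1, ?_⟩
  have h : convexHull ℝ (Frame.cast '' S) ⊆
      (fun q => q + Frame.cast w) ⁻¹' convexHull ℝ (Frame.cast '' ((· + w) '' S)) := by
    refine convexHull_min ?_ ((convex_convexHull ℝ _).translate_preimage_left _)
    rintro _ ⟨v, hv, rfl⟩
    apply subset_convexHull
    exact ⟨v + w, ⟨v, hv, rfl⟩, Frame.cast_add v w⟩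
  exact h hx.2

theorem shift_image_boundaryCell (S : Set (ℤ × ℤ)) (w : ℤ × ℤ) :
    shift w '' boundaryCell S = boundaryCell ((· + w) '' S) := by
  apply subset_antisymm
  · rintro _ ⟨x, hx, rfl⟩
    exact shift_mem_boundaryCell w hx
  · intro x hx
    refine ⟨shift (-w) x, ?_, by rw [shift_shift, neg_add_cancel, shift_zero]⟩
    have h := shift_mem_boundaryCell (-w) hx
    rw [image_image] at h
    simpa using h

theorem idealTranslate_injective (τ : ℂ) : Function.Injective (idealTranslate τ) := by
  intro a b h
  have h2 := congrArg (idealTranslate (-τ)) h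
  simpa [idealTranslate_idealTranslate, idealTranslate_zero] using h2

namespace DrilledAnanas

variable (A : DrilledAnanas)

/-- The holonomy translation of a deck transformation. -/
def hol (w : ℤ × ℤ) : ℂ := w.1 * A.ω₁ + w.2 * A.ω₂

theorem dev_shift (w : ℤ × ℤ) (x : Cover) : A.dev (shift w x) = (A.dev x).translate (A.hol w) := by
  ext
  · rw [A.dev_shift_z, H3.translate_z, hol]
    ring
  · exact A.dev_shift_t w x

theorem pair_vert {v e w : ℤ × ℤ} (he : e = (1, 0) ∨ e = (0, 1) ∨ e = (1, 1))
    (hne : ∀ v, A.vert v ≠ A.vert (v + e)) :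
    ({A.vert (v + w), A.vert (v + w + e)} : Set Ideal) =
      {idealTranslate (A.hol w) (A.vert v), idealTranslate (A.hol w) (A.vert (v + e))} := by
  have hE : ∀ v, IsStdEdge {v, v + e} := by
    intro v
    rcases he with rfl | rfl | rfl
    · exact ⟨v, Or.inl rfl⟩
    · exact ⟨v, Or.inr (Or.inl rfl)⟩
    · exact ⟨v, Or.inr (Or.inr rfl)⟩
  have h1 := (A.boundary_edge _ (hE v)).image_eq
  have h2 := (A.boundary_edge _ (hE (v + w))).image_eq
  have h3 : ({v + w, v + w + e} : Set (ℤ × ℤ)) = (· + w) '' {v, v + e} := by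
    rw [image_pair, add_right_comm]
  have h4 : ∀ C, A.dev '' (shift w '' C) = H3.translate (A.hol w) '' (A.dev '' C) := by
    intro C
    simp only [image_image, A.dev_shift]
  rw [image_pair] at h1 h2
  rw [h3, ← shift_image_boundaryCell, h4, h1, ← hull_idealTranslate, image_pair] at h2
  refine (pair_eq_of_hull_eq ?_ (hne _) h2).symm
  exact fun h => hne v (idealTranslate_injective _ h)

theorem isStdTriangle_up (v : ℤ × ℤ) : IsStdTriangle {v, v + (1, 0), v + (1, 1)} := ⟨v, Or.inl rfl⟩

theorem vert_ne_one_zero (v : ℤ × ℤ) : A.vert v ≠ A.vert (v + (1, 0)) := fun h => by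
  have := A.injOn_vert _ (isStdTriangle_up v) (by simp) (by simp) h
  simp at this

theorem vert_ne_one_one (v : ℤ × ℤ) : A.vert v ≠ A.vert (v + (1, 1)) := fun h => by
  have := A.injOn_vert _ (isStdTriangle_up v) (by simp) (by simp) h
  simp at this

/-- The deck group acts on the ideal vertices by the holonomy: a vertex is the common end of two
sides of a boundary triangle. -/
theorem vert_add (v w : ℤ × ℤ) : A.vert (v + w) = idealTranslate (A.hol w) (A.vert v) := by
  have h1 := A.pair_vert (v := v) (w := w) (Or.inl rfl) A.vert_ne_one_zero
  have h2 := A.pair_vert (v := v) (w := w) (Or.inr (Or.inr rfl)) A.vert_ne_one_one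
  by_contra hne
  have m1 : A.vert (v + w) ∈ ({A.vert (v + w), A.vert (v + w + (1, 0))} : Set Ideal) := by simp
  have m2 : A.vert (v + w) ∈ ({A.vert (v + w), A.vert (v + w + (1, 1))} : Set Ideal) := by simp
  rw [h1] at m1
  rw [h2] at m2
  have e1 := m1.resolve_left hne
  have e2 : A.vert (v + w) = idealTranslate (A.hol w) (A.vert (v + (1, 1))) := m2.resolve_left hne
  rw [e1] at e2
  have := A.injOn_vert _ (isStdTriangle_up v) (by simp) (by simp) (idealTranslate_injective _ e2)
  simp at this

theorem cross_ne : A.ω₁.re * A.ω₂.im - A.ω₁.im * A.ω₂.re ≠ 0 := by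
  intro h
  have hli := LinearIndependent.pair_iff.mp A.linearIndependent
  have h1 := hli A.ω₂.re (-A.ω₁.re) (by apply Complex.ext <;> simp <;> linarith)
  have h2 := hli A.ω₂.im (-A.ω₁.im) (by apply Complex.ext <;> simp <;> linarith)
  have h3 : A.ω₁ = 0 := by apply Complex.ext <;> simp <;> linarith [h1.2, h2.2]
  have h4 := hli 1 0 (by simp [h3])
  exact one_ne_zero h4.1

/-- The frame with origin `c` that is given by the holonomy. -/
def frame (c : ℂ) : Frame := ⟨c, A.ω₁, A.ω₂, A.cross_ne⟩

theorem exists_frame : ∃ c : ℂ, ∀ w, A.vert w = (A.frame c).ideal (some w) := by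
  have h0 : ∀ w, A.vert w = idealTranslate (A.hol w) (A.vert 0) := fun w => by
    rw [← A.vert_add, zero_add]
  have hfin : A.vert 0 ≠ OnePoint.infty := by
    intro h
    apply A.vert_ne_one_zero 0
    rw [h0 (0 + (1, 0)), h]
    rfl
  obtain ⟨c, hc⟩ := OnePoint.ne_infty_iff_exists.mp hfin
  refine ⟨c, fun w => ?_⟩
  rw [h0, ← hc, idealTranslate_coe, Frame.ideal_some]
  congr 1
  simp [Frame.pt, frame, hol, Frame.cast]
  ring

end DrilledAnanas

namespace Frame

theorem IsTri.isCell {T : Finset (ℤ × ℤ)} (h : IsTri T) : IsCell 0 (cone T) := by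
  obtain ⟨w, rfl | rfl⟩ := h
  · exact Or.inr ⟨w, Or.inl rfl⟩
  · exact Or.inr ⟨w, Or.inr rfl⟩

theorem IsTri.card_eq {T : Finset (ℤ × ℤ)} (h : IsTri T) : T.card = 3 := by
  obtain ⟨w, rfl | rfl⟩ := h
  · rw [triUp, Finset.card_insert_of_notMem, Finset.card_insert_of_notMem, Finset.card_singleton]
      <;>
      simp
  · rw [triDown, Finset.card_insert_of_notMem, Finset.card_insert_of_notMem,
      Finset.card_singleton] <;> simp

theorem IsTri.isStdEdge {T S : Finset (ℤ × ℤ)} (h : IsTri T) (hST : S ⊆ T) (hS : S.card = 2) :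
    IsStdEdge (S : Set (ℤ × ℤ)) := by
  obtain ⟨y, z, hyz, rfl⟩ := Finset.card_eq_two.mp hS
  have hy := hST (Finset.mem_insert_self y {z})
  have hz := hST (Finset.mem_insert_of_mem (Finset.mem_singleton_self z))
  rw [Finset.coe_pair]
  have e1 : ∀ w : ℤ × ℤ, w + (1, 1) = w + (1, 0) + (0, 1) := fun w => by rw [add_assoc]; rfl
  have e2 : ∀ w : ℤ × ℤ, w + (1, 1) = w + (0, 1) + (1, 0) := fun w => by rw [add_assoc]; rfl
  obtain ⟨w, rfl | rfl⟩ := h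
  · simp only [triUp, Finset.mem_insert, Finset.mem_singleton, sub_zero] at hy hz
    rcases hy with rfl | rfl | rfl <;> rcases hz with rfl | rfl | rfl <;> try exact absurd rfl hyz
    · exact ⟨_, Or.inl rfl⟩
    · exact ⟨_, Or.inr (Or.inr rfl)⟩
    · exact ⟨_, Or.inl (pair_comm _ _)⟩
    · exact ⟨w + (1, 0), Or.inr (Or.inl (by rw [e1]))⟩
    · exact ⟨_, Or.inr (Or.inr (pair_comm _ _))⟩
    · exact ⟨w + (1, 0), Or.inr (Or.inl (by rw [e1, pair_comm]))⟩
  · simp only [triDown, Finset.mem_insert, Finset.mem_singleton, sub_zero, neg_zero] at hy hz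
    rcases hy with rfl | rfl | rfl <;> rcases hz with rfl | rfl | rfl <;> try exact absurd rfl hyz
    · exact ⟨_, Or.inr (Or.inl rfl)⟩
    · exact ⟨_, Or.inr (Or.inr rfl)⟩
    · exact ⟨_, Or.inr (Or.inl (pair_comm _ _))⟩
    · exact ⟨w + (0, 1), Or.inl (by rw [e2])⟩
    · exact ⟨_, Or.inr (Or.inr (pair_comm _ _))⟩
    · exact ⟨w + (0, 1), Or.inl (by rw [e2, pair_comm])⟩

theorem two_le_card_of_mem_hull (F : Frame) {S T : Finset (ℤ × ℤ)} (hT : IsTri T) (hST : S ⊆ T)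
    {p : H3} (hp : p ∈ hull (F.ideal '' face S)) : 2 ≤ S.card := by
  have h := (F.mem_hull_face_iff hT hST).mp hp
  have hpos := p.pos
  by_contra! hcon
  rcases Nat.lt_succ_iff_lt_or_eq.mp hcon with h1 | h1
  · have : S = ∅ := Finset.card_eq_zero.mp (by omega)
    subst this
    simp at h
  · obtain ⟨y, rfl⟩ := Finset.card_eq_one.mp h1
    simp only [Finset.coe_singleton, image_singleton, convexHull_singleton, mem_singleton_iff] at h
    rw [h.1, gap_cast] at h
    have := h.2
    nlinarith

/-- The complement of the lattice. -/
def offLattice (F : Frame) : Set ℂ := {z | F.crd z ∉ range cast}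

theorem mem_offLattice_of_pos {F : Frame} {z : ℂ} (h : 0 < F.height z) : z ∈ F.offLattice := by
  rintro ⟨w, hw⟩
  rw [height, ← hw, gap_cast, Real.sqrt_zero] at h
  exact lt_irrefl _ h

/-- The triangles, indexed by the parallelograms and a choice of one of the two triangles. -/
def tri (k : (ℤ × ℤ) × Bool) : Finset (ℤ × ℤ) := if k.2 then triUp 0 k.1 else triDown 0 k.1

theorem isTri_tri (k : (ℤ × ℤ) × Bool) : IsTri (tri k) := by
  obtain ⟨w, _ | _⟩ := k
  · exact ⟨w, Or.inr rfl⟩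
  · exact ⟨w, Or.inl rfl⟩

theorem IsTri.exists_tri_eq {T : Finset (ℤ × ℤ)} (h : IsTri T) : ∃ k, T = tri k := by
  obtain ⟨w, rfl | rfl⟩ := h
  · exact ⟨(w, true), rfl⟩
  · exact ⟨(w, false), rfl⟩

theorem convexHull_tri_subset (k : (ℤ × ℤ) × Bool) :
    convexHull ℝ (cast '' (tri k : Set (ℤ × ℤ))) ⊆ Icc (cast k.1) (cast k.1 + (1, 1)) := by
  refine convexHull_min ?_ (convex_Icc _ _)
  rintro _ ⟨x, hx, rfl⟩
  obtain ⟨w, _ | _⟩ := k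
  · simp only [tri, triDown, Finset.mem_coe, Finset.mem_insert, Finset.mem_singleton,
      Bool.false_eq_true,
      if_false] at hx
    rcases hx with rfl | rfl | rfl <;> simp [cast, Prod.le_def]
  · simp only [tri, triUp, Finset.mem_coe, Finset.mem_insert, Finset.mem_singleton, if_true] at hx
    rcases hx with rfl | rfl | rfl <;> simp [cast, Prod.le_def]

theorem locallyFinite_tri : LocallyFinite fun k => convexHull ℝ (cast '' (tri k : Set (ℤ × ℤ))) :=
    by
  intro q
  refine ⟨Metric.ball q 1, Metric.ball_mem_nhds q one_pos, ?_⟩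
  have hfin : (((Icc (⌊q.1⌋ - 2) (⌊q.1⌋ + 2) ×ˢ Icc (⌊q.2⌋ - 2) (⌊q.2⌋ + 2)) : Set (ℤ × ℤ)) ×ˢ
      (univ : Set Bool)).Finite :=
    ((finite_Icc _ _).prod (finite_Icc _ _)).prod finite_univ
  refine hfin.subset ?_
  rintro k ⟨r, hr1, hr2⟩
  have hb := convexHull_tri_subset k hr1
  rw [Metric.mem_ball, Prod.dist_eq, max_lt_iff, Real.dist_eq, Real.dist_eq, abs_lt, abs_lt] at hr2
  obtain ⟨⟨b1, b2⟩, b3, b4⟩ := hb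
  simp only [cast, Prod.fst_add, Prod.snd_add] at b1 b2 b3 b4
  refine ⟨⟨⟨?_, ?_⟩, ?_, ?_⟩, mem_univ _⟩
  · have : (⌊q.1⌋ : ℝ) - 2 ≤ k.1.1 := by linarith [Int.floor_le q.1]
    exact_mod_cast this
  · have : (k.1.1 : ℝ) ≤ ⌊q.1⌋ + 2 := by linarith [Int.lt_floor_add_one q.1]
    exact_mod_cast this
  · have : (⌊q.2⌋ : ℝ) - 2 ≤ k.1.2 := by linarith [Int.floor_le q.2]
    exact_mod_cast this
  · have : (k.1.2 : ℝ) ≤ ⌊q.2⌋ + 2 := by linarith [Int.lt_floor_add_one q.2]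
    exact_mod_cast this

end Frame

namespace DrilledAnanas

variable {A : DrilledAnanas} {c : ℂ}

theorem vert_image (hc : ∀ w, A.vert w = (A.frame c).ideal (some w)) (S : Finset (ℤ × ℤ)) :
    A.vert '' S = (A.frame c).ideal '' Frame.face S := by
  rw [Frame.image_face]
  exact image_congr fun w _ => hc w

theorem image_boundaryCell (hc : ∀ w, A.vert w = (A.frame c).ideal (some w)) {T : Finset (ℤ × ℤ)}
    (hT : Frame.IsTri T) :
    A.dev '' boundaryCell T = hull ((A.frame c).ideal '' Frame.face T) := by
  rw [(A.boundary_triangle _ hT.isStdTriangle).image_eq, vert_image hc]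

theorem exists_tri_of_boundary {x : Cover} (hx : x.1.2 = 0) :
    ∃ T, Frame.IsTri T ∧ x ∈ boundaryCell T := by
  obtain ⟨T, hT, h⟩ := Frame.exists_tri x.1.1
  exact ⟨T, hT, hx, h⟩

theorem height_of_boundary (hc : ∀ w, A.vert w = (A.frame c).ideal (some w)) {x : Cover}
    (hx : x.1.2 = 0) : (A.frame c).height (A.dev x).z = (A.dev x).t := by
  obtain ⟨T, hT, h⟩ := exists_tri_of_boundary hx
  have h2 : A.dev x ∈ A.dev '' boundaryCell T := ⟨x, h, rfl⟩
  rw [image_boundaryCell hc hT, Frame.mem_hull_face_iff _ hT subset_rfl] at h2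
  exact (Frame.height_eq_iff _).mpr h2.2

theorem injOn_boundary (hc : ∀ w, A.vert w = (A.frame c).ideal (some w)) :
    InjOn A.dev {x | x.1.2 = 0} := by
  intro x hx x' hx' h
  obtain ⟨T, hT, hxT⟩ := exists_tri_of_boundary hx
  obtain ⟨T', hT', hxT'⟩ := exists_tri_of_boundary hx'
  have m1 : A.dev x ∈ hull ((A.frame c).ideal '' Frame.face T) := by
    rw [← image_boundaryCell hc hT]
    exact ⟨x, hxT, rfl⟩
  have m2 : A.dev x ∈ hull ((A.frame c).ideal '' Frame.face T') := by
    rw [← image_boundaryCell hc hT', h]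
    exact ⟨x', hxT', rfl⟩
  obtain ⟨a, ha⟩ := (Frame.mem_hull_iff _).mp m1
  obtain ⟨a', ha'⟩ := (Frame.mem_hull_iff _).mp m2
  have hu := (ha.mono (Frame.face_subset_cone _)).unique (fun h => absurd h (lt_irrefl _)) le_rfl
    (ha'.mono (Frame.face_subset_cone _)) hT.isCell hT'.isCell
  rw [← hu] at ha'
  have hI : Frame.face T ∩ Frame.face T' = Frame.face (T ∩ T') := by
    ext (_ | w) <;> simp
  have m3 := (ha.inter ha').mem_hull
  rw [hI] at m3
  have hc2 := Frame.two_le_card_of_mem_hull _ hT Finset.inter_subset_left m3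
  have hc3 := Finset.card_le_card (Finset.inter_subset_left : T ∩ T' ⊆ T)
  rw [hT.card_eq] at hc3
  have hcases : (T ∩ T').card = 2 ∨ (T ∩ T').card = 3 := by omega
  rcases hcases with h2 | h3
  · have hE := A.boundary_edge _ (hT.isStdEdge Finset.inter_subset_left h2)
    rw [vert_image hc] at hE
    rw [← hE.image_eq] at m3
    obtain ⟨y, hy, hyx⟩ := m3
    have hyT : y ∈ boundaryCell T := ⟨hy.1, convexHull_mono (image_mono (by simp)) hy.2⟩
    have hyT' : y ∈ boundaryCell T' := ⟨hy.1, convexHull_mono (image_mono (by simp)) hy.2⟩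
    rw [← (A.boundary_triangle _ hT.isStdTriangle).injOn hyT hxT hyx]
    exact (A.boundary_triangle _ hT'.isStdTriangle).injOn hyT' hxT' (hyx.trans h)
  · have e1 := Finset.eq_of_subset_of_card_le (Finset.inter_subset_left : T ∩ T' ⊆ T)
      (by rw [h3, hT.card_eq])
    have e2 := Finset.eq_of_subset_of_card_le (Finset.inter_subset_right : T ∩ T' ⊆ T')
      (by rw [h3, hT'.card_eq])
    rw [← e1, e2] at hxT
    exact (A.boundary_triangle _ hT'.isStdTriangle).injOn hxT hxT' h

/-- The developing map identifies the boundary with the surface over the complement of the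
lattice; `b` is the inverse homeomorphism. -/
theorem exists_boundary_section (hc : ∀ w, A.vert w = (A.frame c).ideal (some w)) :
    ∃ b : ℂ → Cover, ContinuousOn b (A.frame c).offLattice ∧
      (∀ z ∈ (A.frame c).offLattice, (b z).1.2 = 0 ∧ (A.dev (b z)).z = z ∧
        (A.dev (b z)).t = (A.frame c).height z) ∧
      ∀ x : Cover, x.1.2 = 0 → (A.dev x).z ∈ (A.frame c).offLattice ∧ x = b (A.dev x).z := by
  classical
  set F := A.frame c with hF
  choose σ hσ1 hσ2 hσ3 using fun k => A.boundary_triangle _ (Frame.isTri_tri k).isStdTriangle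
  have lift : ∀ z ∈ F.offLattice, 0 < F.height z := fun z hz => F.height_pos hz
  let s : F.offLattice → H3 := fun z => ⟨z, F.height z, lift z z.2⟩
  have hs : Continuous s := by
    rw [H3.continuous_iff]
    exact ⟨continuous_subtype_val, F.continuous_height.comp continuous_subtype_val⟩
  have hmem : ∀ (z : F.offLattice) k,
      F.crd z ∈ convexHull ℝ (Frame.cast '' (Frame.tri k : Set (ℤ × ℤ))) →
        s z ∈ hull (A.vert '' Frame.tri k) := by
    intro z k hk
    rw [vert_image hc, Frame.mem_hull_face_iff _ (Frame.isTri_tri k) subset_rfl]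
    exact ⟨hk, F.height_sq z⟩
  have hex : ∀ z : F.offLattice, ∃ x : Cover, x.1.2 = 0 ∧ A.dev x = s z := by
    intro z
    obtain ⟨T, hT, hz⟩ := Frame.exists_tri (F.crd z)
    obtain ⟨k, rfl⟩ := hT.exists_tri_eq
    refine ⟨σ k (s z), ?_, hσ2 k _ (hmem z k hz)⟩
    have : σ k (s z) ∈ boundaryCell (Frame.tri k) := by
      rw [← hσ3 k]
      exact ⟨_, hmem z k hz, rfl⟩
    exact this.1
  choose g hg1 hg2 using hex
  have hgcont : Continuous g := by
    let f : (ℤ × ℤ) × Bool → Set F.offLattice := fun k =>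
      (fun z : F.offLattice => F.crd z) ⁻¹' convexHull ℝ (Frame.cast '' (Frame.tri k : Set (ℤ × ℤ)))
    have hcrd : Continuous fun z : F.offLattice => F.crd z :=
      F.continuous_crd.comp continuous_subtype_val
    refine LocallyFinite.continuous (f := f) (Frame.locallyFinite_tri.preimage_continuous hcrd)
      ?_ (fun k => ?_) fun k => ?_
    · rw [eq_univ_iff_forall]
      intro z
      obtain ⟨T, hT, hz⟩ := Frame.exists_tri (F.crd z)
      obtain ⟨k, rfl⟩ := hT.exists_tri_eq
      exact mem_iUnion.mpr ⟨k, hz⟩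
    · have : (Frame.cast '' (Frame.tri k : Set (ℤ × ℤ))).Finite := (Finset.finite_toSet _).image _
      exact (this.isClosed_convexHull ℝ).preimage hcrd
    · have h1 : ContinuousOn (fun z => σ k (s z)) (f k) :=
        (hσ1 k).comp hs.continuousOn fun z hz => hmem z k hz
      refine h1.congr fun z hz => ?_
      have : σ k (s z) ∈ boundaryCell (Frame.tri k) := by
        rw [← hσ3 k]
        exact ⟨_, hmem z k hz, rfl⟩
      exact injOn_boundary hc (hg1 z) this.1 (by rw [hg2, hσ2 k _ (hmem z k hz)])
  refine ⟨fun z => if hz : z ∈ F.offLattice then g ⟨z, hz⟩ else Classical.arbitrary _, ?_, ?_, ?_⟩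
  · rw [continuousOn_iff_continuous_domRestrict]
    refine hgcont.congr fun z => ?_
    simp
  · intro z hz
    simp only [hz, dif_pos]
    exact ⟨hg1 _, by rw [hg2], by rw [hg2]⟩
  · intro x hx
    have hh := height_of_boundary hc hx
    have hz : (A.dev x).z ∈ F.offLattice := Frame.mem_offLattice_of_pos (by
      rw [hF, hh]
      exact (A.dev x).pos)
    refine ⟨hz, ?_⟩
    simp only [hz, dif_pos]
    refine injOn_boundary hc hx (hg1 _) ?_
    rw [hg2]
    exact H3.ext rfl hh.symm

end DrilledAnanas

/-! ### The inverse of the developing map over the vertical rays -/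

theorem isPreconnected_interior_cover : IsPreconnected {x : Cover | 0 < x.1.2} := by
  have h : IsPreconnected {p : (ℝ × ℝ) × ℝ | 0 < p.2} := by
    have : Convex ℝ {p : (ℝ × ℝ) × ℝ | 0 < p.2} :=
      convex_halfSpace_gt (LinearMap.snd ℝ (ℝ × ℝ) ℝ).isLinear 0
    exact this.isPreconnected
  have h2 : Subtype.val '' {x : Cover | 0 < x.1.2} = {p : (ℝ × ℝ) × ℝ | 0 < p.2} := by
    ext p
    constructor
    · rintro ⟨x, hx, rfl⟩
      exact hx
    · intro hp
      exact ⟨⟨p, le_of_lt hp, fun h0 => absurd h0 (ne_of_gt hp)⟩, hp, rfl⟩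
  have hi : IsInducing (fun x : Cover => (x.1 : (ℝ × ℝ) × ℝ)) := IsInducing.subtypeVal
  refine hi.isPreconnected_image.mp ?_
  convert h

theorem isOpen_interior_cover : IsOpen {x : Cover | 0 < x.1.2} :=
  isOpen_lt continuous_const (continuous_snd.comp continuous_subtype_val)

theorem mem_closure_interior (x : Cover) : x ∈ closure {x : Cover | 0 < x.1.2} := by
  refine mem_closure_of_tendsto (f := fun n : ℕ =>
    (⟨(x.1.1, x.1.2 + 1 / ((n : ℝ) + 1)), add_nonneg x.2.1 (by positivity), fun h => absurd h
      (ne_of_gt (add_pos_of_nonneg_of_pos x.2.1 (by positivity)))⟩ : Cover)) (b := atTop) ?_ ?_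
  · rw [tendsto_subtype_rng]
    have : Tendsto (fun n : ℕ => (x.1.1, x.1.2 + 1 / ((n : ℝ) + 1))) atTop
        (𝓝 (x.1.1, x.1.2 + 0)) :=
      tendsto_const_nhds.prodMk_nhds (tendsto_const_nhds.add
          tendsto_one_div_add_atTop_nhds_zero_nat)
    simpa using this
  · exact Eventually.of_forall fun n => add_pos_of_nonneg_of_pos x.2.1 (by positivity)

/-- The point above `p` at height `s`, or `p` itself if `s` is below `p`. -/
def H3.raise (p : H3) (s : ℝ) : H3 := ⟨p.z, max p.t s, lt_max_of_lt_left p.pos⟩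

theorem H3.continuous_raise (p : H3) : Continuous p.raise := by
  rw [H3.continuous_iff]
  exact ⟨continuous_const, continuous_const.max continuous_id⟩

theorem H3.raise_eq {p q : H3} (hz : q.z = p.z) (ht : p.t ≤ q.t) : p.raise q.t = q :=
  H3.ext hz.symm (max_eq_right ht)

namespace DrilledAnanas

variable (A : DrilledAnanas)

theorem isLocallyInjective_dev : IsLocallyInjective A.dev := by
  intro x
  obtain ⟨U, hU, hi⟩ := A.locally_injective x
  exact ⟨interior U, isOpen_interior, mem_interior_iff_mem_nhds.mpr hU, hi.mono interior_subset⟩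

variable {A}

/-- Unique lifting of vertical segments. -/
theorem lift_vertical {g g' : H3 → Cover} {q q' : H3} (hz : q'.z = q.z) (ht : q.t ≤ q'.t)
    {S : Set H3} (hS : ∀ r : H3, r.z = q.z → q.t ≤ r.t → r.t ≤ q'.t → r ∈ S)
    (hg : ContinuousOn g S) (hg' : ContinuousOn g' S)
    (hd : ∀ r ∈ S, A.dev (g r) = r) (hd' : ∀ r ∈ S, A.dev (g' r) = r) : g q = g' q ↔ g q' = g' q' :=
        by
  have hmaps : MapsTo q.raise (Icc q.t q'.t) S := fun s hs =>
    hS _ rfl (le_max_left _ _) (max_le ht hs.2)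
  have key : ∀ s ∈ Icc q.t q'.t, g (q.raise s) = g' (q.raise s) →
      EqOn (g ∘ q.raise) (g' ∘ q.raise) (Icc q.t q'.t) := by
    intro s hs h
    refine (T2Space.isSeparatedMap A.dev).eqOn_of_comp_eqOn A.isLocallyInjective_dev
      isPreconnected_Icc (hg.comp q.continuous_raise.continuousOn hmaps)
      (hg'.comp q.continuous_raise.continuousOn hmaps) (fun r hr => ?_) hs h
    simp only [Function.comp_apply]
    rw [hd _ (hmaps hr), hd' _ (hmaps hr)]
  have e1 : q.raise q.t = q := H3.raise_eq rfl le_rfl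
  have e2 : q.raise q'.t = q' := H3.raise_eq hz ht
  have m1 : q.t ∈ Icc q.t q'.t := ⟨le_rfl, ht⟩
  have m2 : q'.t ∈ Icc q.t q'.t := ⟨ht, le_rfl⟩
  constructor
  · intro h
    have := key _ m1 (by rwa [e1]) m2
    simpa [e2] using this
  · intro h
    have := key _ m2 (by rwa [e2]) m1
    simpa [e1] using this

variable (A) in
/-- The facts on a drilled ananas that determine its developing map: the boundary develops onto
the graph of the height function of `F`, with inverse `b`, and the part of the cusp above height
`h` develops injectively. -/
structure Unfolding (F : Frame) (b : ℂ → Cover) (y h : ℝ) : Prop where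
  continuousOn_b : ContinuousOn b F.offLattice
  b_snd : ∀ z ∈ F.offLattice, (b z).1.2 = 0
  dev_b_z : ∀ z ∈ F.offLattice, (A.dev (b z)).z = z
  dev_b_t : ∀ z ∈ F.offLattice, (A.dev (b z)).t = F.height z
  mem_offLattice : ∀ x : Cover, x.1.2 = 0 → (A.dev x).z ∈ F.offLattice
  eq_b : ∀ x : Cover, x.1.2 = 0 → x = b (A.dev x).z
  y_pos : 0 < y
  injOn : InjOn A.dev {x | y ≤ x.1.2}
  exists_top : ∃ σ : H3 → Cover, ContinuousOn σ {p | h < p.t} ∧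
    ∀ p ∈ {p : H3 | h < p.t}, A.dev (σ p) = p ∧ y ≤ (σ p).1.2

/-- The boundary is a section over the plane minus the lattice; the cusp is a section over a
horoball. -/
theorem exists_unfolding : ∃ (c : ℂ) (b : ℂ → Cover) (y h : ℝ), A.Unfolding (A.frame c) b y h := by
  obtain ⟨c, hc⟩ := A.exists_frame
  obtain ⟨b, hb1, hb2, hb3⟩ := exists_boundary_section hc
  obtain ⟨y, hy, hinj, ⟨h, hh, him⟩, -⟩ := A.horocusp
  -- the level `y` lies below some horosphere, by compactness of the torus
  obtain ⟨k, hk⟩ : ∃ k, ∀ x : Cover, x.1.2 = y → (A.dev x).t ≤ k := by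
    let ι : ℝ × ℝ → Cover := fun q => ⟨(q, y), hy.le, fun h0 => absurd h0 hy.ne'⟩
    have hι : Continuous ι := by
      rw [continuous_induced_rng]
      exact continuous_id.prodMk continuous_const
    have hcpt : IsCompact (Icc (0 : ℝ) 1 ×ˢ Icc (0 : ℝ) 1) := isCompact_Icc.prod isCompact_Icc
    obtain ⟨k, hk⟩ := hcpt.bddAbove_image
      (f := fun q => (A.dev (ι q)).t) (H3.continuous_t.comp (A.continuous_dev.comp hι)).continuousOn
    refine ⟨k, fun x hx => ?_⟩
    have hsh := A.dev_shift_t (⌊x.1.1.1⌋, ⌊x.1.1.2⌋) (ι (Int.fract x.1.1.1, Int.fract x.1.1.2))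
    have : shift (⌊x.1.1.1⌋, ⌊x.1.1.2⌋) (ι (Int.fract x.1.1.1, Int.fract x.1.1.2)) = x := by
      apply Subtype.ext
      simp only [shift, ι, Int.fract_add_floor]
      rw [← hx]
    rw [this] at hsh
    rw [hsh]
    exact hk ⟨_, ⟨⟨Int.fract_nonneg _, (Int.fract_lt_one _).le⟩,
      ⟨Int.fract_nonneg _, (Int.fract_lt_one _).le⟩⟩, rfl⟩
  have hsurj : ∀ p : H3, max h k < p.t → ∃ x : Cover, y < x.1.2 ∧ A.dev x = p := by
    intro p hp
    have : p ∈ A.dev '' {x | y ≤ x.1.2} := by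
      rw [him]
      exact (le_max_left h k).trans hp.le
    obtain ⟨x, hx, rfl⟩ := this
    refine ⟨x, lt_of_le_of_ne hx fun he => ?_, rfl⟩
    exact absurd (hk x he.symm) (not_le.mpr ((le_max_right h k).trans_lt hp))
  choose! σ hσ1 hσ2 using hsurj
  refine ⟨c, b, y, max h k, hb1, fun z hz => (hb2 z hz).1, fun z hz => (hb2 z hz).2.1,
    fun z hz => (hb2 z hz).2.2, fun x hx => (hb3 x hx).1, fun x hx => (hb3 x hx).2, hy, hinj, σ, ?_,
    fun p hp => ⟨hσ2 p hp, (hσ1 p hp).le⟩⟩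
  intro p hp
  obtain ⟨e, he, hde⟩ := A.isLocalHomeomorphOn_dev (σ p) (hy.trans (hσ1 p hp))
  have hpt : p ∈ e.target := by
    have := e.map_source he
    rwa [← hde, hσ2 p hp] at this
  have hep : e.symm p = σ p := by
    have := e.left_inv he
    rwa [← hde, hσ2 p hp] at this
  have hcs := e.continuousAt_symm hpt
  have hev : ∀ᶠ q in 𝓝 p, y < (e.symm q).1.2 ∧ q ∈ e.target := by
    refine (hcs.eventually (p := fun x => y < x.1.2) ?_).and (e.open_target.mem_nhds hpt)
    rw [hep]
    exact (isOpen_lt continuous_const (continuous_snd.comp continuous_subtype_val)).mem_nhds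
      (hσ1 p hp)
  refine (hcs.continuousWithinAt (s := {p | max h k < p.t})).congr_of_eventuallyEq ?_ hep.symm
  filter_upwards [mem_nhdsWithin_of_mem_nhds hev, self_mem_nhdsWithin] with q hq hq2
  refine hinj (hσ1 q hq2).le hq.1.le ?_
  rw [hσ2 q hq2, hde, e.right_inv hq.2]

namespace Unfolding

variable {F : Frame} {b : ℂ → Cover} {y h : ℝ}

variable (A y h) in
/-- `σ` is a local inverse of the developing map over the open set `O`, which contains with a point
also the vertical ray above it, and agrees high up with the inverse over the cusp. -/
structure IsSec (O : Set H3) (σ : H3 → Cover) : Prop where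
  isOpen : IsOpen O
  up : ∀ p ∈ O, ∀ q : H3, q.z = p.z → p.t ≤ q.t → q ∈ O
  cont : ContinuousOn σ O
  dev_eq : ∀ p ∈ O, A.dev (σ p) = p
  pos : ∀ p ∈ O, 0 < (σ p).1.2
  top : ∀ p ∈ O, h < p.t → y ≤ (σ p).1.2

theorem IsSec.eq (H : A.Unfolding F b y h) {O O' : Set H3} {σ σ' : H3 → Cover}
    (h1 : IsSec A y h O σ)
    (h2 : IsSec A y h O' σ') {p : H3} (hp : p ∈ O) (hp' : p ∈ O') : σ p = σ' p := by
  let q := p.raise (h + 1)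
  have hq : q ∈ O ∩ O' := ⟨h1.up p hp q rfl (le_max_left _ _), h2.up p hp' q rfl (le_max_left _ _)⟩
  have hqt : h < q.t := (lt_add_one h).trans_le (le_max_right _ _)
  refine (lift_vertical (A := A) (q := p) (q' := q) rfl (le_max_left _ _) (S := O ∩ O')
    (fun r hr ht _ => ⟨h1.up p hp r hr ht, h2.up p hp' r hr ht⟩) (h1.cont.mono inter_subset_left)
    (h2.cont.mono inter_subset_right) (fun r hr => h1.dev_eq r hr.1)
    fun r hr => h2.dev_eq r hr.2).mpr ?_
  refine H.injOn (h1.top q hq.1 hqt) (h2.top q hq.2 hqt) ?_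
  rw [h1.dev_eq q hq.1, h2.dev_eq q hq.2]

variable (A y h) in
/-- The largest domain of an inverse of the developing map as in `IsSec`. -/
def dom : Set H3 := {p | ∃ O σ, IsSec A y h O σ ∧ p ∈ O}

open Classical in
variable (A y h) in
/-- The inverse of the developing map on the largest domain. -/
def sec (p : H3) : Cover :=
  if hp : p ∈ dom A y h then hp.choose_spec.choose p else Classical.arbitrary _

theorem sec_eq (H : A.Unfolding F b y h) {O : Set H3} {σ : H3 → Cover} (h1 : IsSec A y h O σ)
    {p : H3}
    (hp : p ∈ O) : sec A y h p = σ p := by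
  have hd : p ∈ dom A y h := ⟨O, σ, h1, hp⟩
  rw [sec, dif_pos hd]
  exact IsSec.eq H hd.choose_spec.choose_spec.1 h1 hd.choose_spec.choose_spec.2 hp

/-- The partial sections agree on overlaps, so they glue to the largest one. -/
theorem isSec (H : A.Unfolding F b y h) : IsSec A y h (dom A y h) (sec A y h) where
  isOpen := by
    rw [isOpen_iff_mem_nhds]
    rintro p ⟨O, σ, h1, hp⟩
    exact mem_of_superset (h1.isOpen.mem_nhds hp) fun q hq => ⟨O, σ, h1, hq⟩
  up := by
    rintro p ⟨O, σ, h1, hp⟩ q hz ht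
    exact ⟨O, σ, h1, h1.up p hp q hz ht⟩
  cont := by
    rintro p ⟨O, σ, h1, hp⟩
    refine ContinuousAt.continuousWithinAt ?_
    refine ((h1.cont p hp).continuousAt (h1.isOpen.mem_nhds hp)).congr ?_
    filter_upwards [h1.isOpen.mem_nhds hp] with q hq using (sec_eq H h1 hq).symm
  dev_eq := by
    rintro p ⟨O, σ, h1, hp⟩
    rw [sec_eq H h1 hp, h1.dev_eq p hp]
  pos := by
    rintro p ⟨O, σ, h1, hp⟩
    rw [sec_eq H h1 hp]
    exact h1.pos p hp
  top := by
    rintro p ⟨O, σ, h1, hp⟩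
    rw [sec_eq H h1 hp]
    exact h1.top p hp

theorem mem_dom_of_lt (H : A.Unfolding F b y h) {p : H3} (hp : h < p.t) : p ∈ dom A y h := by
  obtain ⟨σ, h1, h2⟩ := H.exists_top
  exact ⟨_, σ, ⟨isOpen_lt continuous_const H3.continuous_t,
    fun p hp q _ ht => lt_of_lt_of_le (show h < p.t from hp) ht, h1, fun p hp => (h2 p hp).1,
    fun p hp => H.y_pos.trans_le (h2 p hp).2, fun p hp _ => (h2 p hp).2⟩, hp⟩

/-- All points strictly above `p` lie in the domain. -/
def Accessible (A : DrilledAnanas) (y h : ℝ) (p : H3) : Prop :=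
  ∀ q : H3, q.z = p.z → p.t < q.t → q ∈ dom A y h

theorem accessible_of_mem (H : A.Unfolding F b y h) {p : H3} (hp : p ∈ dom A y h) :
    Accessible A y h p := fun q hz ht => H.isSec.up p hp q hz ht.le

/-- The inverse extends past an accessible point where it has a limit in the interior. -/
theorem mem_dom_of_tendsto (H : A.Unfolding F b y h) {p : H3} (hp : Accessible A y h p) {x : Cover}
    (hx : 0 < x.1.2) (hxp : A.dev x = p)
    (hlim : Tendsto (sec A y h) (𝓝[dom A y h] p) (𝓝 x)) : p ∈ dom A y h := by
  classical
  obtain ⟨e, he, hde⟩ := A.isLocalHomeomorphOn_dev x hx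
  have hpt : p ∈ e.target := by
    have := e.map_source he
    rwa [← hde, hxp] at this
  have hep : e.symm p = x := by
    have := e.left_inv he
    rwa [← hde, hxp] at this
  have hV : e.target ∩ e.symm ⁻¹' {x : Cover | 0 < x.1.2} ∈ 𝓝 p :=
    (e.isOpen_inter_preimage_symm isOpen_interior_cover).mem_nhds ⟨hpt, by
      rw [mem_preimage, hep]
      exact hx⟩
  obtain ⟨ε, hε, hbox⟩ := H3.exists_box hV
  have hsrc : ∀ᶠ q in 𝓝 p, q ∈ dom A y h → sec A y h q ∈ e.source := by
    have := hlim.eventually (e.open_source.mem_nhds he)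
    rwa [eventually_nhdsWithin_iff] at this
  obtain ⟨ε', hε', hbox'⟩ := H3.exists_box hsrc
  let r := min ε ε' / 2
  have hr : 0 < r := by positivity
  have hrε : r < ε := by
    have : min ε ε' ≤ ε := min_le_left _ _
    simp only [r]; linarith [lt_min hε hε']
  have hrε' : r < ε' := by
    have : min ε ε' ≤ ε' := min_le_right _ _
    simp only [r]; linarith [lt_min hε hε']
  let q : H3 := ⟨p.z, p.t + r, by linarith [p.pos]⟩
  have hq : q ∈ dom A y h := hp q rfl (by simp only [q]; linarith)
  have hqs : sec A y h q ∈ e.source :=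
    hbox' q (by simpa [q] using hε') (by simp [q, abs_of_pos hr, hrε']) hq
  have hO : dom A y h ∩ sec A y h ⁻¹' e.source ∈ 𝓝 q :=
    (H.isSec.cont.isOpen_inter_preimage H.isSec.isOpen e.open_source).mem_nhds ⟨hq, hqs⟩
  obtain ⟨δ, hδ, hboxq⟩ := H3.exists_box hO
  let B : Set H3 := {p' | ‖p'.z - p.z‖ < min δ ε ∧ |p'.t - p.t| < ε}
  have hBo : IsOpen B := by
    exact (isOpen_lt (H3.continuous_z.sub continuous_const).norm continuous_const).inter
      (isOpen_lt (H3.continuous_t.sub continuous_const).abs continuous_const)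
  have hBV : ∀ p' ∈ B, p' ∈ e.target ∧ 0 < (e.symm p').1.2 := fun p' hp' =>
    hbox p' (hp'.1.trans_le (min_le_right _ _)) hp'.2
  have hlevel : ∀ p' ∈ B, ∀ q' : H3, q'.z = p'.z → q'.t = q.t →
      q' ∈ dom A y h ∧ sec A y h q' ∈ e.source := by
    intro p' hp' q' hz ht
    refine hboxq q' ?_ ?_
    · rw [hz]
      exact hp'.1.trans_le (min_le_left _ _)
    · rw [ht, sub_self, abs_zero]
      exact hδ
  have hagree : ∀ p' ∈ B, p' ∈ dom A y h → sec A y h p' = e.symm p' := by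
    intro p' hB hD
    let q' : H3 := ⟨p'.z, q.t, q.pos⟩
    have hq' := hlevel p' hB q' rfl rfl
    have hee : sec A y h q' = e.symm q' := by
      have h1 := e.left_inv hq'.2
      rw [← hde, H.isSec.dev_eq q' hq'.1] at h1
      exact h1.symm
    have hqB : |q.t - p.t| < ε := by simp [q, abs_of_pos hr, hrε]
    have hcs : ContinuousOn e.symm (dom A y h ∩ B) :=
      e.continuousOn_symm.mono fun s hs => (hBV s hs.2).1
    have hcd : ContinuousOn (sec A y h) (dom A y h ∩ B) := H.isSec.cont.mono inter_subset_left
    have hd1 : ∀ s ∈ dom A y h ∩ B, A.dev (sec A y h s) = s := fun s hs => H.isSec.dev_eq s hs.1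
    have hd2 : ∀ s ∈ dom A y h ∩ B, A.dev (e.symm s) = s := fun s hs => by
      rw [hde, e.right_inv (hBV s hs.2).1]
    rw [abs_lt] at hqB
    have hB2 := abs_lt.mp hB.2
    rcases le_total p'.t q.t with hle | hle
    · refine (lift_vertical (q := p') (q' := q') rfl hle (S := dom A y h ∩ B) ?_ hcd hcs hd1
        hd2).mpr hee
      intro s hz h1 h2
      refine ⟨H.isSec.up p' hD s hz h1, ?_, ?_⟩
      · rw [hz]
        exact hB.1
      · have h3 : s.t ≤ q.t := h2
        rw [abs_lt]
        constructor <;> linarith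
    · refine (lift_vertical (q := q') (q' := p') rfl hle (S := dom A y h ∩ B) ?_ hcd hcs hd1
        hd2).mp hee
      intro s hz h1 h2
      refine ⟨H.isSec.up q' hq'.1 s hz h1, ?_, ?_⟩
      · rw [hz]
        exact hB.1
      · have h3 : q.t ≤ s.t := h1
        rw [abs_lt]
        constructor <;> linarith
  obtain ⟨σ, eD, eB⟩ : ∃ σ : H3 → Cover, EqOn σ (sec A y h) (dom A y h) ∧ EqOn σ e.symm B := by
    refine ⟨fun p' => if p' ∈ B then e.symm p' else sec A y h p', fun p' hD => ?_,
      fun p' hB => if_pos hB⟩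
    by_cases hB : p' ∈ B
    · simp only [if_pos hB]
      exact (hagree p' hB hD).symm
    · simp only [if_neg hB]
  refine ⟨dom A y h ∪ B, σ, ?_, Or.inr ⟨by simpa using ⟨hδ, hε⟩, by simpa using hε⟩⟩
  refine ⟨H.isSec.isOpen.union hBo, ?_, ?_, ?_, ?_, ?_⟩
  · rintro p' (hD | hB) q' hz ht
    · exact Or.inl (H.isSec.up p' hD q' hz ht)
    · by_cases hq' : q'.t ≤ q.t
      · refine Or.inr ⟨by rw [hz]; exact hB.1, ?_⟩
        have := abs_lt.mp hB.2
        have h4 : q.t = p.t + r := rfl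
        rw [abs_lt]
        constructor <;> linarith
      · refine Or.inl (H.isSec.up ⟨p'.z, q.t, q.pos⟩ (hlevel p' hB ⟨p'.z, q.t, q.pos⟩ rfl rfl).1 q'
          hz ?_)
        exact (not_le.mp hq').le
  · refine ContinuousOn.union_of_isOpen ?_ ?_ H.isSec.isOpen hBo
    · exact H.isSec.cont.congr eD
    · exact (e.continuousOn_symm.mono fun s hs => (hBV s hs).1).congr eB
  · rintro p' (hD | hB)
    · rw [eD hD, H.isSec.dev_eq p' hD]
    · rw [eB hB, hde, e.right_inv (hBV p' hB).1]
  · rintro p' (hD | hB)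
    · rw [eD hD]
      exact H.isSec.pos p' hD
    · rw [eB hB]
      exact (hBV p' hB).2
  · intro p' _ hh
    rw [eD (H.mem_dom_of_lt hh)]
    exact H.isSec.top p' (H.mem_dom_of_lt hh) hh

end Unfolding
end DrilledAnanas

namespace DrilledAnanas
namespace Unfolding

variable {A : DrilledAnanas} {F : Frame} {b : ℂ → Cover} {y h : ℝ}

/-! ### The developing map is an embedding -/

theorem pathDist_sec_vertical (H : A.Unfolding F b y h) {p q : H3} (hp : p ∈ dom A y h)
    (hz : q.z = p.z) (ht : p.t ≤ q.t) :
    pathDist A.dev (sec A y h p) (sec A y h q) ≤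
      ENNReal.ofReal (Real.log q.t - Real.log p.t) := by
  have hlog : Real.log p.t ≤ Real.log q.t := Real.log_le_log p.pos ht
  let c : ℝ → H3 := fun s =>
    ⟨p.z, Real.exp (Real.log p.t + s * (Real.log q.t - Real.log p.t)), Real.exp_pos _⟩
  have h0 : c 0 = p := by
    ext
    · rfl
    · simp [c, Real.exp_log p.pos]
  have h1 : c 1 = q := by
    ext
    · exact hz.symm
    · simp [c, Real.exp_log q.pos]
  have := pathDist_le_of_lipschitz H.isSec.cont H.isSec.dev_eq (c := c)
    (K := (Real.log q.t - Real.log p.t).toNNReal) ?_ ?_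
  · rwa [h0, h1] at this
  · intro s _ s' _
    rw [H3.dist_of_z_eq (p := c s) (q := c s') rfl, Real.coe_toNNReal _ (sub_nonneg.mpr hlog)]
    simp only [c, Real.log_exp]
    rw [show Real.log p.t + s * (Real.log q.t - Real.log p.t) -
      (Real.log p.t + s' * (Real.log q.t - Real.log p.t)) =
        (Real.log q.t - Real.log p.t) * (s - s') by ring, abs_mul,
      abs_of_nonneg (sub_nonneg.mpr hlog)]
  · intro s hs
    refine H.isSec.up p hp _ rfl ?_
    simp only [c]
    rw [← Real.log_le_iff_le_exp p.pos]
    nlinarith [hs.1]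

theorem pathDist_sec_horizontal (H : A.Unfolding F b y h) {p q : H3} (ht : q.t = p.t)
    (hD : ∀ s ∈ Icc (0 : ℝ) 1, ∀ r : H3, r.z = p.z + s * (q.z - p.z) → r.t = p.t →
      r ∈ dom A y h) :
    pathDist A.dev (sec A y h p) (sec A y h q) ≤ ENNReal.ofReal (‖q.z - p.z‖ / p.t) := by
  let c : ℝ → H3 := fun s => ⟨p.z + s * (q.z - p.z), p.t, p.pos⟩
  have h0 : c 0 = p := by
    ext
    · simp [c]
    · rfl
  have h1 : c 1 = q := by
    ext
    · simp [c]
    · exact ht.symm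
  have hnn : 0 ≤ ‖q.z - p.z‖ / p.t := div_nonneg (norm_nonneg _) p.pos.le
  have := pathDist_le_of_lipschitz H.isSec.cont H.isSec.dev_eq (c := c)
    (K := (‖q.z - p.z‖ / p.t).toNNReal) ?_ fun s hs => hD s hs _ rfl rfl
  · rwa [h0, h1] at this
  · intro s _ s' _
    refine (H3.dist_le_of_t_eq (p := c s) (q := c s') rfl).trans ?_
    rw [Real.coe_toNNReal _ hnn]
    simp only [c]
    rw [show p.z + s * (q.z - p.z) - (p.z + s' * (q.z - p.z)) =
      ((s - s' : ℝ) : ℂ) * (q.z - p.z) by push_cast; ring, norm_mul, Complex.norm_real,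
      Real.norm_eq_abs]
    apply le_of_eq
    ring

/-- Near an accessible point, the inverse of the developing map is small in the path metric: any
two values are joined by a path that goes up, sideways, and down again. -/
theorem exists_pathDist_sec_le (H : A.Unfolding F b y h) {p : H3} (hp : Accessible A y h p) {ε : ℝ}
    (hε : 0 < ε) : ∃ w : Cover, ∀ᶠ q in 𝓝[dom A y h] p,
      pathDist A.dev (sec A y h q) w ≤ ENNReal.ofReal ε := by
  obtain ⟨η, hη, hη2⟩ : ∃ η : ℝ, 0 < η ∧ ∀ s : ℝ, |s - p.t| < 2 * η →
      |Real.log s - Real.log p.t| < ε / 4 := by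
    have hc := (Real.continuousAt_log p.pos.ne')
    obtain ⟨η, hη, h2⟩ := Metric.continuousAt_iff.mp hc (ε / 4) (by positivity)
    exact ⟨η / 2, by positivity, fun s hs => by
      simpa [Real.dist_eq] using h2 (x := s) (by rw [Real.dist_eq]; linarith)⟩
  let q₀ : H3 := ⟨p.z, p.t + η, by linarith [p.pos]⟩
  have hq₀ : q₀ ∈ dom A y h := hp q₀ rfl (by simp only [q₀]; linarith)
  obtain ⟨δ, hδ, hbox⟩ := H3.exists_box (H.isSec.isOpen.mem_nhds hq₀)
  refine ⟨sec A y h q₀, ?_⟩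
  let r := min (min δ (ε / 2 * p.t)) η
  have hr : 0 < r := lt_min (lt_min hδ (mul_pos (by positivity) p.pos)) hη
  rw [eventually_nhdsWithin_iff]
  filter_upwards [H3.box_mem_nhds p hr] with q hq hqD
  have hq1 : ‖q.z - p.z‖ < δ :=
    hq.1.trans_le ((min_le_left _ _).trans (min_le_left _ _))
  have hq2 : ‖q.z - p.z‖ < ε / 2 * p.t :=
    hq.1.trans_le ((min_le_left _ _).trans (min_le_right _ _))
  have hq3 : |q.t - p.t| < η := hq.2.trans_le (min_le_right _ _)
  let q₁ : H3 := ⟨q.z, p.t + η, by linarith [p.pos]⟩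
  have hle : q.t ≤ q₁.t := by
    have := (abs_lt.mp hq3).2
    simp only [q₁]; linarith
  have e1 : pathDist A.dev (sec A y h q) (sec A y h q₁) ≤ ENNReal.ofReal (ε / 2) := by
    refine (H.pathDist_sec_vertical (q := q₁) hqD rfl hle).trans (ENNReal.ofReal_le_ofReal ?_)
    have h1 := hη2 q.t (by linarith [abs_nonneg (q.t - p.t)])
    have h2 := hη2 q₁.t (by simp only [q₁]; rw [add_sub_cancel_left, abs_of_pos hη]; linarith)
    have h3 := (abs_lt.mp h1).1
    have h4 := (abs_lt.mp h2).2
    linarith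
  have e2 : pathDist A.dev (sec A y h q₁) (sec A y h q₀) ≤ ENNReal.ofReal (ε / 2) := by
    rw [pathDist_comm]
    refine (H.pathDist_sec_horizontal (p := q₀) (q := q₁) rfl fun s hs v hvz hvt => hbox v ?_
        ?_).trans
      (ENNReal.ofReal_le_ofReal ?_)
    · rw [hvz, add_sub_cancel_left, norm_mul, Complex.norm_real, Real.norm_eq_abs,
        abs_of_nonneg hs.1]
      exact (mul_le_of_le_one_left (norm_nonneg _) hs.2).trans_lt hq1
    · rw [hvt, sub_self, abs_zero]
      exact hδ
    · rw [div_le_iff₀ q₀.pos]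
      have : p.t ≤ q₀.t := by simp only [q₀]; linarith
      exact hq2.le.trans (mul_le_mul_of_nonneg_left this (by positivity))
  refine (pathDist_triangle _ _ (sec A y h q₁) _).trans ((add_le_add e1 e2).trans ?_)
  rw [← ENNReal.ofReal_add (by positivity) (by positivity)]
  exact ENNReal.ofReal_le_ofReal (by linarith)

theorem exists_tendsto_seq (H : A.Unfolding F b y h) {p : H3} (hp : Accessible A y h p) {u : ℕ → H3}
    (hu : Tendsto u atTop (𝓝[dom A y h] p)) :
    ∃ x, Tendsto (fun n => sec A y h (u n)) atTop (𝓝 x) := by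
  refine A.complete _ fun ε hε => ?_
  obtain ⟨r, hr0, hr⟩ := ENNReal.lt_iff_exists_real_btwn.mp hε
  have hr0' : 0 < r := by
    by_contra hcon
    rw [ENNReal.ofReal_of_nonpos (not_lt.mp hcon)] at hr
    exact lt_irrefl _ hr.1
  obtain ⟨w, hw⟩ := H.exists_pathDist_sec_le hp (half_pos hr0')
  obtain ⟨n₀, hn₀⟩ := eventually_atTop.mp (hu.eventually hw)
  refine ⟨n₀, fun m hm n hn => ?_⟩
  refine lt_of_le_of_lt (pathDist_triangle _ _ w _) (lt_of_le_of_lt ?_ hr.2)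
  have h2 := hn₀ n hn
  rw [pathDist_comm] at h2
  refine (add_le_add (hn₀ m hm) h2).trans ?_
  rw [← ENNReal.ofReal_add (by positivity) (by positivity), add_halves]

/-- Completeness: the inverse of the developing map has a limit at each accessible point. -/
theorem exists_tendsto (H : A.Unfolding F b y h) {p : H3} (hp : Accessible A y h p) :
    ∃ x, A.dev x = p ∧ Tendsto (sec A y h) (𝓝[dom A y h] p) (𝓝 x) := by
  let v : ℕ → H3 := fun n => ⟨p.z, p.t + 1 / ((n : ℝ) + 1), add_pos p.pos (by positivity)⟩
  have hvD : ∀ n, v n ∈ dom A y h := fun n => hp _ rfl (lt_add_of_pos_right _ (by positivity))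
  have hvt : Tendsto v atTop (𝓝 p) := by
    rw [H3.tendsto_nhds_iff]
    refine ⟨tendsto_const_nhds, ?_⟩
    have := (tendsto_const_nhds (x := p.t)).add (tendsto_one_div_add_atTop_nhds_zero_nat (𝕜 := ℝ))
    rwa [add_zero] at this
  have hv : Tendsto v atTop (𝓝[dom A y h] p) :=
    tendsto_nhdsWithin_iff.mpr ⟨hvt, Eventually.of_forall hvD⟩
  obtain ⟨x, hx⟩ := H.exists_tendsto_seq hp hv
  refine ⟨x, ?_, ?_⟩
  · have h1 := (A.continuous_dev.tendsto x).comp hx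
    have h2 : (A.dev ∘ fun n => sec A y h (v n)) = v := by
      ext1 n
      exact H.isSec.dev_eq _ (hvD n)
    rw [h2] at h1
    exact tendsto_nhds_unique h1 hvt
  · refine tendsto_of_seq_tendsto fun u hu => ?_
    -- interleave the two sequences
    let c : ℕ → H3 := fun n => if Even n then u (n / 2) else v (n / 2)
    have hdiv : Tendsto (fun n : ℕ => n / 2) atTop atTop :=
      Nat.tendsto_div_const_atTop two_ne_zero
    have hc : Tendsto c atTop (𝓝[dom A y h] p) :=
      Tendsto.if' (hu.comp hdiv) (hv.comp hdiv)
    obtain ⟨x', hx'⟩ := H.exists_tendsto_seq hp hc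
    have a1 : Tendsto (fun n : ℕ => 2 * n) atTop atTop :=
      tendsto_id.const_mul_atTop' two_pos
    have a2 : Tendsto (fun n : ℕ => 2 * n + 1) atTop atTop :=
      (tendsto_add_atTop_nat 1).comp a1
    have h1 : Tendsto (fun n => sec A y h (u n)) atTop (𝓝 x') := by
      refine (hx'.comp a1).congr fun n => ?_
      simp [c]
    have h2 : Tendsto (fun n => sec A y h (v n)) atTop (𝓝 x') := by
      refine (hx'.comp a2).congr fun n => ?_
      have : (2 * n + 1) / 2 = n := by omega
      simp [c, this]
    rw [tendsto_nhds_unique hx h2]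
    exact h1

/-- At an accessible point outside the domain, the limit is a boundary point. -/
theorem tendsto_b (H : A.Unfolding F b y h) {p : H3} (hp : Accessible A y h p)
    (hpD : p ∉ dom A y h) : p.z ∈ F.offLattice ∧ p.t = F.height p.z ∧
      Tendsto (sec A y h) (𝓝[dom A y h] p) (𝓝 (b p.z)) := by
  obtain ⟨x, hx, hlim⟩ := H.exists_tendsto hp
  have hx0 : x.1.2 = 0 := by
    rcases x.2.1.eq_or_lt with he | hl
    · exact he.symm
    · exact absurd (H.mem_dom_of_tendsto hp hl hx hlim) hpD
  have h1 := H.mem_offLattice x hx0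
  have h2 := H.eq_b x hx0
  rw [hx] at h1 h2
  refine ⟨h1, ?_, by rwa [← h2]⟩
  rw [← H.dev_b_t _ h1, ← h2, hx]

/-- A point is outside the domain only if it lies on or below the boundary surface. -/
theorem exit_of_notMem (H : A.Unfolding F b y h) {p : H3} (hpD : p ∉ dom A y h) :
    p.z ∈ F.offLattice ∧ p.t ≤ F.height p.z ∧ A.dev (b p.z) ∉ dom A y h := by
  let S : Set ℝ := {s | p.t ≤ s ∧ p.raise s ∉ dom A y h}
  have hpS : p.t ∈ S := ⟨le_rfl, by rwa [H3.raise_eq rfl le_rfl]⟩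
  have hbd : BddAbove S := ⟨h, fun s hs => by
    by_contra! hcon
    exact hs.2 (H.mem_dom_of_lt (hcon.trans_le (le_max_right _ _)))⟩
  have hcl : IsClosed S := isClosed_Ici.inter
    (H.isSec.isOpen.isClosed_compl.preimage p.continuous_raise)
  have hmem : sSup S ∈ S := hcl.csSup_mem ⟨_, hpS⟩ hbd
  set q := p.raise (sSup S) with hq
  have hqt : q.t = sSup S := max_eq_right hmem.1
  have hacc : Accessible A y h q := by
    intro r hz ht
    by_contra hr
    have hle : p.t ≤ r.t := by linarith [hmem.1]
    have : r.t ∈ S := ⟨hle, by rwa [H3.raise_eq (p := p) (q := r) hz hle]⟩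
    have := le_csSup hbd this
    linarith
  obtain ⟨h1, h2, -⟩ := H.tendsto_b hacc hmem.2
  have hqz : q.z = p.z := rfl
  rw [hqz] at h1 h2
  refine ⟨h1, ?_, ?_⟩
  · rw [← h2, hqt]
    exact hmem.1
  · have : A.dev (b p.z) = q := H3.ext (H.dev_b_z _ h1) (by rw [H.dev_b_t _ h1, h2])
    rw [this]
    exact hmem.2

/-- A vertical ray that leaves the domain does so at the height of the boundary, so everything above
a boundary point is in the domain. -/
theorem accessible_b (H : A.Unfolding F b y h) {z : ℂ} (hz : z ∈ F.offLattice) :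
    Accessible A y h (A.dev (b z)) := by
  intro q hqz hqt
  by_contra hq
  have := (H.exit_of_notMem hq).2.1
  rw [hqz, H.dev_b_z z hz] at this
  rw [H.dev_b_t z hz] at hqt
  linarith

theorem isOpen_offLattice (F : Frame) : IsOpen F.offLattice := by
  have : F.offLattice = {z | 0 < F.height z} :=
    subset_antisymm (fun z hz => F.height_pos hz) fun z hz => Frame.mem_offLattice_of_pos hz
  rw [this]
  exact isOpen_lt continuous_const F.continuous_height

/-- The boundary points whose image is outside the domain form an open set: by local injectivity of
the developing map, a boundary point close to such a point does not develop onto an interior one. -/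
theorem eventually_exit (H : A.Unfolding F b y h) {z : ℂ} (hz : z ∈ F.offLattice)
    (hD : A.dev (b z) ∉ dom A y h) :
    ∀ᶠ w in 𝓝 z, w ∈ F.offLattice ∧ A.dev (b w) ∉ dom A y h := by
  have hlim := (H.tendsto_b (H.accessible_b hz) hD).2.2
  rw [H.dev_b_z z hz] at hlim
  obtain ⟨U, hU, hinj⟩ := A.locally_injective (b z)
  have hoff : F.offLattice ∈ 𝓝 z := (isOpen_offLattice F).mem_nhds hz
  have hbc : ContinuousAt b z := (H.continuousOn_b z hz).continuousAt hoff
  have h1 := hlim.eventually hU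
  rw [eventually_nhdsWithin_iff] at h1
  have h2 := (A.continuous_dev.continuousAt.comp hbc).eventually h1
  filter_upwards [h2, hbc.eventually hU, hoff] with w hw1 hw2 hw3
  refine ⟨hw3, fun hcon => ?_⟩
  have heq := hinj (hw1 hcon) hw2 (H.isSec.dev_eq _ hcon)
  have hpos := H.isSec.pos _ hcon
  rw [show sec A y h (A.dev (b w)) = b w from heq, H.b_snd w hw3] at hpos
  exact lt_irrefl _ hpos

/-- The frontier points of the domain are images of boundary points: they lie on the graph over the
boundary, above which every point is in the domain. -/
theorem closure_dom (H : A.Unfolding F b y h) {p : H3} (hp : p ∈ closure (dom A y h))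
    (hpD : p ∉ dom A y h) : Accessible A y h p := by
  obtain ⟨h1, h2, h3⟩ := H.exit_of_notMem hpD
  have hle : F.height p.z ≤ p.t := by
    by_contra! hlt
    have e1 := H3.continuous_z.continuousAt.eventually (H.eventually_exit h1 h3)
    have e2 : ∀ᶠ q : H3 in 𝓝 p, q.t < F.height q.z :=
      (isOpen_lt H3.continuous_t (F.continuous_height.comp H3.continuous_z)).mem_nhds hlt
    obtain ⟨q, hq1, hq2, hq3⟩ :=
      ((mem_closure_iff_frequently.mp hp).and_eventually (e1.and e2)).exists
    refine hq2.2 (H.isSec.up q hq1 _ (H.dev_b_z _ hq2.1) ?_)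
    rw [H.dev_b_t _ hq2.1]
    exact hq3.le
  have : A.dev (b p.z) = p := H3.ext (H.dev_b_z _ h1) (by rw [H.dev_b_t _ h1]; linarith)
  rw [← this]
  exact H.accessible_b h1

/-- The maximal inverse of the developing map reaches all interior points. -/
theorem interior_subset (H : A.Unfolding F b y h) {x : Cover} (hx : 0 < x.1.2) :
    A.dev x ∈ dom A y h ∧ sec A y h (A.dev x) = x := by
  let K : Set Cover := {x | A.dev x ∈ dom A y h ∧ sec A y h (A.dev x) = x}
  have hKo : IsOpen K := by
    rw [isOpen_iff_mem_nhds]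
    intro x hxK
    obtain ⟨U, hU, hinj⟩ := A.locally_injective x
    have hD : dom A y h ∈ 𝓝 (A.dev x) := H.isSec.isOpen.mem_nhds hxK.1
    have hc : ContinuousAt (fun x' => sec A y h (A.dev x')) x :=
      ((H.isSec.cont _ hxK.1).continuousAt hD).comp A.continuous_dev.continuousAt
    have hU' : U ∈ 𝓝 (sec A y h (A.dev x)) := by
      rw [hxK.2]
      exact hU
    filter_upwards [hc.eventually hU', hU, A.continuous_dev.continuousAt.eventually hD]
      with x' h1 h2 h3
    exact ⟨h3, hinj h1 h2 (H.isSec.dev_eq _ h3)⟩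
  have hKc : ∀ x, 0 < x.1.2 → x ∈ closure K → x ∈ K := by
    intro x hx hcl
    have hfr := mem_closure_iff_frequently.mp hcl
    have hpcl : A.dev x ∈ closure (dom A y h) := mem_closure_iff_frequently.mpr
      (A.continuous_dev.continuousAt.frequently (hfr.mono fun x' h' => h'.1))
    have hacc : Accessible A y h (A.dev x) := by
      by_cases hD : A.dev x ∈ dom A y h
      · exact H.accessible_of_mem hD
      · exact H.closure_dom hpcl hD
    obtain ⟨x', hx', hlim⟩ := H.exists_tendsto hacc
    have hne : (𝓝[K] x).NeBot := mem_closure_iff_nhdsWithin_neBot.mp hcl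
    have hdev : Tendsto A.dev (𝓝[K] x) (𝓝[dom A y h] (A.dev x)) :=
      tendsto_nhdsWithin_iff.mpr ⟨A.continuous_dev.continuousAt.mono_left nhdsWithin_le_nhds,
        eventually_nhdsWithin_of_forall fun x' h' => h'.1⟩
    have hid : Tendsto (fun x => x) (𝓝[K] x) (𝓝 x') :=
      (hlim.comp hdev).congr' (eventually_nhdsWithin_of_forall fun x' h' => h'.2)
    have hxx : x' = x := tendsto_nhds_unique hid (tendsto_id.mono_left nhdsWithin_le_nhds)
    subst hxx
    have hD := H.mem_dom_of_tendsto hacc hx rfl hlim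
    refine ⟨hD, ?_⟩
    have hc := H.isSec.cont _ hD
    have : (𝓝[dom A y h] (A.dev x')).NeBot := mem_closure_iff_nhdsWithin_neBot.mp hpcl
    exact tendsto_nhds_unique hc hlim
  let p₀ : H3 := ⟨0, max 1 (h + 1), lt_max_of_lt_left one_pos⟩
  have hp₀ : p₀ ∈ dom A y h := H.mem_dom_of_lt ((lt_add_one h).trans_le (le_max_right _ _))
  refine isPreconnected_interior_cover.subset_of_closure_inter_subset hKo
    ⟨sec A y h p₀, H.isSec.pos _ hp₀, ?_, ?_⟩ ?_ hx
  · rw [H.isSec.dev_eq _ hp₀]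
    exact hp₀
  · rw [H.isSec.dev_eq _ hp₀]
  · exact fun x' hx' => hKc x' hx'.2 hx'.1

/-- The domain of the section is the open region above the graph: a boundary point cannot develop
into the domain, since it would be a limit of interior points, which the section recovers. -/
theorem height_lt_iff (H : A.Unfolding F b y h) (p : H3) : p ∈ dom A y h ↔ F.height p.z < p.t := by
  have hcl : ∀ z ∈ F.offLattice, A.dev (b z) ∉ dom A y h := by
    by_contra! hcon
    obtain ⟨z, hz, hzD⟩ := hcon
    -- the boundary point `b z` would be a limit of interior points and thus be equal to the
    -- interior point `sec (dev (b z))`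
    have hD : dom A y h ∈ 𝓝 (A.dev (b z)) := H.isSec.isOpen.mem_nhds hzD
    have hc : ContinuousAt (fun x' => sec A y h (A.dev x')) (b z) :=
      ((H.isSec.cont _ hzD).continuousAt hD).comp A.continuous_dev.continuousAt
    have hne : (𝓝[{x : Cover | 0 < x.1.2}] (b z)).NeBot :=
      mem_closure_iff_nhdsWithin_neBot.mp (mem_closure_interior (b z))
    have h1 : Tendsto (fun x => x) (𝓝[{x : Cover | 0 < x.1.2}] (b z))
        (𝓝 (sec A y h (A.dev (b z)))) :=
      (hc.mono_left nhdsWithin_le_nhds).congr'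
        (eventually_nhdsWithin_of_forall fun x' h' => (H.interior_subset h').2)
    have h2 := tendsto_nhds_unique h1 (tendsto_id.mono_left nhdsWithin_le_nhds)
    have h3 := H.isSec.pos _ hzD
    rw [h2, H.b_snd z hz] at h3
    exact lt_irrefl _ h3
  constructor
  · intro hp
    by_contra! hle
    have hz := Frame.mem_offLattice_of_pos (p.pos.trans_le hle)
    refine hcl p.z hz (H.isSec.up p hp _ (H.dev_b_z _ hz) ?_)
    rwa [H.dev_b_t _ hz]
  · intro hlt
    by_contra hp
    have := (H.exit_of_notMem hp).2.1
    linarith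

theorem range_dev (H : A.Unfolding F b y h) : range A.dev = F.region := by
  ext p
  rw [Frame.mem_region]
  constructor
  · rintro ⟨x, rfl⟩
    rcases x.2.1.eq_or_lt with he | hl
    · have hz := H.mem_offLattice x he.symm
      have := H.dev_b_t _ hz
      rw [← H.eq_b x he.symm] at this
      exact this.ge
    · exact ((H.height_lt_iff _).mp (H.interior_subset hl).1).le
  · intro hle
    rcases hle.eq_or_lt with he | hl
    · have hz : p.z ∈ F.offLattice := Frame.mem_offLattice_of_pos (he.symm ▸ p.pos)
      exact ⟨b p.z, H3.ext (H.dev_b_z _ hz) (by rw [H.dev_b_t _ hz, he])⟩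
    · exact ⟨_, H.isSec.dev_eq p ((H.height_lt_iff p).mpr hl)⟩

theorem isClosedEmbedding_dev (H : A.Unfolding F b y h) : IsClosedEmbedding A.dev := by
  have hbdry : ∀ x : Cover, x.1.2 = 0 → A.dev x ∉ dom A y h := by
    intro x hx hD
    have hz := H.mem_offLattice x hx
    have h1 := H.dev_b_t _ hz
    rw [← H.eq_b x hx] at h1
    exact absurd h1 (ne_of_gt ((H.height_lt_iff _).mp hD))
  have hind : IsInducing A.dev := by
    rw [isInducing_iff_nhds]
    intro x
    refine le_antisymm (tendsto_iff_comap.mp A.continuous_dev.continuousAt) ?_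
    rcases x.2.1.eq_or_lt with he | hl
    · have hz := H.mem_offLattice x he.symm
      have hx := H.eq_b x he.symm
      have hacc := H.accessible_b hz
      rw [← hx] at hacc
      have hlim := (H.tendsto_b hacc (hbdry x he.symm)).2.2
      rw [← hx] at hlim
      have hbc : ContinuousAt b (A.dev x).z :=
        (H.continuousOn_b _ hz).continuousAt ((isOpen_offLattice F).mem_nhds hz)
      intro U hU
      have h1 := hlim.eventually hU
      rw [eventually_nhdsWithin_iff] at h1
      have h2 : ∀ᶠ q : H3 in 𝓝 (A.dev x), b q.z ∈ U :=
        H3.continuous_z.continuousAt.eventually (hbc.eventually (by rwa [← hx]))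
      refine mem_comap.mpr ⟨_, h1.and h2, fun x' hx' => ?_⟩
      rcases x'.2.1.eq_or_lt with he' | hl'
      · rw [H.eq_b x' he'.symm]
        exact hx'.2
      · have h3 := H.interior_subset hl'
        rw [← h3.2]
        exact hx'.1 h3.1
    · obtain ⟨hD, hs⟩ := H.interior_subset hl
      have hDn := H.isSec.isOpen.mem_nhds hD
      have hc : ContinuousAt (sec A y h) (A.dev x) := (H.isSec.cont _ hD).continuousAt hDn
      intro U hU
      have h1 : ∀ᶠ q in 𝓝 (A.dev x), sec A y h q ∈ U := hc.eventually (by rwa [hs])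
      refine mem_comap.mpr ⟨_, h1.and hDn, fun x' hx' => ?_⟩
      rcases x'.2.1.eq_or_lt with he' | hl'
      · exact absurd hx'.2 (hbdry x' he'.symm)
      · rw [← (H.interior_subset hl').2]
        exact hx'.1
  refine ⟨⟨hind, hind.injective⟩, ?_⟩
  rw [H.range_dev]
  exact F.isClosed_region

end Unfolding

/-- The developing map of a drilled ananas identifies the universal cover with the region above
the boundary surface of a lattice. -/
theorem exists_region (A : DrilledAnanas) : ∃ c, IsClosedEmbedding A.dev ∧
    range A.dev = (A.frame c).region := by
  obtain ⟨c, b, y, h, H⟩ := A.exists_unfolding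
  exact ⟨c, H.isClosedEmbedding_dev, H.range_dev⟩

end DrilledAnanas

namespace Frame

/-! ### Combinatorics of the lattice cells -/

/-- Faces of two cells meet in the hull of their common vertices, since weights are unique. -/
theorem hull_inter_of_subset {F : Frame} {i : ℤ} (hF : 0 < i → F.inn < 0) (hi : 0 ≤ i)
    {S S' T T' : Finset (Option (ℤ × ℤ))} (hS : IsCell i S) (hS' : IsCell i S') (hT : T ⊆ S)
    (hT' : T' ⊆ S') :
    hull (F.ideal '' T) ∩ hull (F.ideal '' T') = hull (F.ideal '' (T ∩ T' : Finset _)) := by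
  ext p
  constructor
  · rintro ⟨h1, h2⟩
    obtain ⟨a, ha⟩ := F.mem_hull_iff.mp h1
    obtain ⟨a', ha'⟩ := F.mem_hull_iff.mp h2
    rw [← (ha.mono hT).unique hF hi (ha'.mono hT') hS hS'] at ha'
    exact (ha.inter ha').mem_hull
  · intro h
    obtain ⟨a, ha⟩ := F.mem_hull_iff.mp h
    exact ⟨(ha.mono Finset.inter_subset_left).mem_hull, (ha.mono
        Finset.inter_subset_right).mem_hull⟩

theorem not_rep_singleton (F : Frame) {a : Option (ℤ × ℤ) → ℝ} {o : Option (ℤ × ℤ)} {p : H3} :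
    ¬ F.Rep a {o} p := by
  intro h
  have h1 := h.mass_eq
  have h2 := h.posX_eq
  have h3 := h.posY_eq
  have h4 := h.energy_eq
  have hp := p.pos
  rw [Finset.sum_singleton] at h1 h2 h3 h4
  cases o with
  | none => simp [mass] at h1
  | some w =>
    simp only [mass, mul_one] at h1
    rw [h1, one_mul] at h2 h3 h4
    have : F.crd p.z = cast w := Prod.ext h2.symm h3.symm
    rw [this] at h4
    simp only [energy] at h4
    nlinarith

theorem exists_mem_hull_pair (F : Frame) {o o' : Option (ℤ × ℤ)} (h : o ≠ o') :
    ∃ p, p ∈ hull (F.ideal '' ({o, o'} : Finset _)) := by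
  have hv : ∀ w, ∃ p, p ∈ hull (F.ideal '' ({none, some w} : Finset (Option (ℤ × ℤ)))) := by
    intro w
    refine ⟨⟨F.pt (cast w), 1, one_pos⟩, ?_⟩
    rw [Finset.coe_pair, image_pair]
    exact mem_hull_infty_coe.mpr rfl
  cases o with
  | none =>
    cases o' with
    | none => exact absurd rfl h
    | some w => exact hv w
  | some w =>
    cases o' with
    | none =>
      rw [Finset.pair_comm]
      exact hv w
    | some w' =>
      have hne : F.pt (cast w) ≠ F.pt (cast w') := fun he =>
        h (congrArg some (cast_injective (F.pt_injective he)))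
      obtain ⟨p, hp, -⟩ := exists_mem_hull_coe_coe hne (s := 1 / 2) (by norm_num) (by norm_num)
      refine ⟨p, ?_⟩
      rw [Finset.coe_pair, image_pair]
      exact hp

/-- The vertices of a cell can be recovered from its edges. -/
theorem subset_of_hull_subset {F : Frame} {i : ℤ} (hF : 0 < i → F.inn < 0) (hi : 0 ≤ i)
    {S S' T : Finset (Option (ℤ × ℤ))} (hS : IsCell i S) (hS' : IsCell i S') (hT : T ⊆ S)
    (hcard : T.Nontrivial) (h : hull (F.ideal '' T) ⊆ hull (F.ideal '' S')) : T ⊆ S' := by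
  intro o ho
  obtain ⟨o', ho', hne⟩ := hcard.exists_ne o
  obtain ⟨p, hp⟩ := F.exists_mem_hull_pair hne.symm
  have hsub : ({o, o'} : Finset _) ⊆ T := by
    intro x hx
    rw [Finset.mem_insert, Finset.mem_singleton] at hx
    rcases hx with rfl | rfl
    · exact ho
    · exact ho'
  obtain ⟨a, ha⟩ := F.mem_hull_iff.mp hp
  obtain ⟨a', ha'⟩ := F.mem_hull_iff.mp (h (ha.mono hsub).mem_hull)
  have heq := (ha.mono (hsub.trans hT)).unique hF hi ha' hS hS'
  by_contra hcon
  have h0 : a o = 0 := by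
    rw [heq]
    exact ha'.supp o hcon
  refine F.not_rep_singleton (a := a) (o := o') (p := p) (ha.of_supp fun x hx => ?_)
  by_cases hxo : x = o
  · rw [hxo, h0]
  · refine ha.supp x ?_
    rw [Finset.mem_insert, not_or]
    exact ⟨hxo, hx⟩

theorem IsCell.nontrivial {i : ℤ} {S : Finset (Option (ℤ × ℤ))} (h : IsCell i S) : S.Nontrivial :=
    by
  rcases h with ⟨j, w, -, -, rfl⟩ | ⟨w, rfl | rfl⟩
  · refine ⟨some w, ?_, some (w + (1, 0)), ?_, ?_⟩
    · simp [quadr]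
    · simp [quadr]
    · simp
  · exact ⟨none, by simp, some w, by simp [triUp], by simp⟩
  · exact ⟨none, by simp, some w, by simp [triDown], by simp⟩

/-- Tetrahedra without the vertex `∞` have bounded height; compare `not_bddAbove_of_infty`. -/
theorem bddAbove_face (F : Frame) (S : Finset (ℤ × ℤ)) :
    ∃ M, ∀ p ∈ hull (F.ideal '' face S), p.t ^ 2 ≤ M := by
  refine ⟨∑ w ∈ S, F.quad (cast w), fun p hp => ?_⟩
  obtain ⟨a, ha⟩ := F.mem_hull_iff.mp hp
  have hq : ∀ q, 0 ≤ F.quad q := fun q => by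
    rw [F.quad_eq]
    positivity
  have h1 := ha.energy_eq
  have h2 := ha.mass_eq
  simp only [face, Finset.sum_map, Function.Embedding.some_apply, energy, mass, mul_one] at h1 h2
  have h3 : ∀ w ∈ S, a (some w) * F.quad (cast w) ≤ F.quad (cast w) := fun w hw => by
    refine mul_le_of_le_one_left (hq _) ?_
    rw [← h2]
    exact Finset.single_le_sum (fun x _ => ha.nonneg (some x)) hw
  have := Finset.sum_le_sum h3
  linarith [hq (F.crd p.z)]

/-- Hulls with the vertex `∞` have unbounded height, so that the tetrahedra at the cusp can be told
from the others by their underlying sets. -/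
theorem not_bddAbove_of_infty {V : Set Ideal} (h : OnePoint.infty ∈ V) {z : ℂ}
    (hz : (z : Ideal) ∈ V)
    (M : ℝ) : ∃ p ∈ hull V, M < p.t ^ 2 := by
  let t := |M| + 1
  have ht : 0 < t := by positivity
  refine ⟨⟨z, t, ht⟩, hull_mono (pair_subset h hz) (mem_hull_infty_coe.mpr rfl), ?_⟩
  have : M ≤ |M| := le_abs_self M
  have h2 : 0 ≤ |M| := abs_nonneg M
  simp only [t]
  nlinarith

/-! #### Linear independence -/

/-- Independence of four light-like vectors, tested in the coordinates in which weights are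
computed. -/
theorem linearIndependent_light (F : Frame) (o : Fin 4 → Option (ℤ × ℤ))
    (h : ∀ g : Fin 4 → ℝ, ∑ k, g k * mass (o k) = 0 → ∑ k, g k * posX (o k) = 0 →
      ∑ k, g k * posY (o k) = 0 → ∑ k, g k * F.energy (o k) = 0 → ∀ k, g k = 0) :
    LinearIndependent ℝ
      ![light (F.ideal (o 0)), light (F.ideal (o 1)), light (F.ideal (o 2)), light (F.ideal (o 3))]
          := by
  rw [Fintype.linearIndependent_iff]
  intro g hg
  simp only [Fin.sum_univ_four, Matrix.cons_val_zero, Matrix.cons_val_one, Matrix.cons_val,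
    light_ideal, Prod.smul_mk, Prod.mk_add_mk, smul_eq_mul, Complex.real_smul] at hg
  rw [Prod.mk_eq_zero, Prod.mk_eq_zero] at hg
  obtain ⟨h1, h2, h3⟩ := hg
  have hre := congrArg Complex.re h2
  have him := congrArg Complex.im h2
  simp only [Complex.add_re, Complex.add_im, Complex.mul_re, Complex.mul_im, Complex.ofReal_re,
    Complex.ofReal_im, Complex.zero_re, Complex.zero_im, zero_mul, sub_zero, add_zero] at hre him
  have hm : ∑ k, g k * mass (o k) = 0 := by
    simp only [Fin.sum_univ_four]
    exact h3
  have hx' : ∑ k, g k * posX (o k) * F.u.re + ∑ k, g k * posY (o k) * F.v.re = 0 := by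
    simp only [Fin.sum_univ_four]
    linear_combination hre - F.c.re * h3
  have hy' : ∑ k, g k * posX (o k) * F.u.im + ∑ k, g k * posY (o k) * F.v.im = 0 := by
    simp only [Fin.sum_univ_four]
    linear_combination him - F.c.im * h3
  rw [← Finset.sum_mul, ← Finset.sum_mul] at hx' hy'
  have hc := F.cross_ne
  have hx : ∑ k, g k * posX (o k) = 0 := by
    refine (mul_eq_zero.mp ?_).resolve_right hc
    linear_combination F.v.im * hx' - F.v.re * hy'
  have hy : ∑ k, g k * posY (o k) = 0 := by
    refine (mul_eq_zero.mp ?_).resolve_right hc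
    linear_combination F.u.re * hy' - F.u.im * hx'
  refine h g hm hx hy ?_
  simp only [Fin.sum_univ_four] at hm hx hy ⊢
  linear_combination h1 - ‖F.c‖ ^ 2 * hm - 2 * (F.c.re * F.u.re + F.c.im * F.u.im) * hx -
    2 * (F.c.re * F.v.re + F.c.im * F.v.im) * hy

/-- The cells of the decomposition are nondegenerate ideal tetrahedra. -/
theorem exists_linearIndependent {F : Frame} (hF : F.inn < 0) {i : ℤ}
    {S : Finset (Option (ℤ × ℤ))} (hS : IsCell i S) :
    ∃ a b c d : Ideal, F.ideal '' S = {a, b, c, d} ∧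
      LinearIndependent ℝ ![light a, light b, light c, light d] := by
  rcases hS with ⟨j, w, hj, -, rfl⟩ | ⟨w, rfl | rfl⟩
  · refine ⟨_, _, _, _, ?_, F.linearIndependent_light
      ![some w, some (w + (1, 0)), some (w + (-j, 1)), some (w + (1 - j, 1))] ?_⟩
    · simp [face, quadr, image_insert_eq]
    · intro g h1 h2 h3 h4
      simp only [Fin.sum_univ_four, Matrix.cons_val_zero, Matrix.cons_val_one, Matrix.cons_val,
          mass,
        posX, posY, energy, quad, cast, Prod.fst_add, Prod.snd_add] at h1 h2 h3 h4
      push_cast at h1 h2 h3 h4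
      have e1 : g 2 + g 3 = 0 := by linear_combination h3 - w.2 * h1
      have e2 : g 1 + g 3 = 0 := by linear_combination h2 - w.1 * h1 + j * e1
      have e0 : g 0 - g 3 = 0 := by linear_combination h1 - e1 - e2
      have e3 : g 3 * (2 * (F.inn - j * Complex.normSq F.u)) = 0 := by
        have a0 : g 0 = g 3 := by linarith
        have a1 : g 1 = -g 3 := by linarith
        have a2 : g 2 = -g 3 := by linarith
        rw [a0, a1, a2] at h4
        linear_combination h4
      have hneg : 2 * (F.inn - j * Complex.normSq F.u) < 0 := by
        have : (0 : ℝ) ≤ j * Complex.normSq F.u :=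
          mul_nonneg (by exact_mod_cast hj) (Complex.normSq_nonneg _)
        linarith
      have e4 : g 3 = 0 := (mul_eq_zero.mp e3).resolve_right hneg.ne
      intro k
      fin_cases k <;> simp only [Fin.zero_eta, Fin.mk_one, Fin.reduceFinMk] <;> linarith
  · refine ⟨_, _, _, _, ?_, F.linearIndependent_light
      ![none, some w, some (w + (1, 0)), some (w + (1 - i, 1))] ?_⟩
    · simp [coe_cone, triUp, image_insert_eq]
    · intro g h1 h2 h3 h4
      simp only [Fin.sum_univ_four, Matrix.cons_val_zero, Matrix.cons_val_one, Matrix.cons_val,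
          mass,
        posX, posY, energy, cast, Prod.fst_add, Prod.snd_add] at h1 h2 h3 h4
      push_cast at h1 h2 h3 h4
      have e3 : g 3 = 0 := by linear_combination h3 - w.2 * h1
      have e2 : g 2 = 0 := by linear_combination h2 - w.1 * h1 - (1 - i) * e3
      have e1 : g 1 = 0 := by linear_combination h1 - e2 - e3
      rw [e1, e2, e3] at h4
      intro k
      fin_cases k <;> simp only [Fin.zero_eta, Fin.mk_one, Fin.reduceFinMk] <;> linarith
  · refine ⟨_, _, _, _, ?_, F.linearIndependent_light
      ![none, some w, some (w + (-i, 1)), some (w + (1 - i, 1))] ?_⟩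
    · simp [coe_cone, triDown, image_insert_eq]
    · intro g h1 h2 h3 h4
      simp only [Fin.sum_univ_four, Matrix.cons_val_zero, Matrix.cons_val_one, Matrix.cons_val,
          mass,
        posX, posY, energy, cast, Prod.fst_add, Prod.snd_add] at h1 h2 h3 h4
      push_cast at h1 h2 h3 h4
      have e4 : g 2 + g 3 = 0 := by linear_combination h3 - w.2 * h1
      have e3 : g 3 = 0 := by linear_combination h2 - w.1 * h1 + i * e4
      have e2 : g 2 = 0 := by linear_combination e4 - e3
      have e1 : g 1 = 0 := by linear_combination h1 - e4
      rw [e1, e2, e3] at h4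
      intro k
      fin_cases k <;> simp only [Fin.zero_eta, Fin.mk_one, Fin.reduceFinMk] <;> linarith

/-! #### Translates -/

theorem image_add_triUp (i : ℤ) (w v : ℤ × ℤ) : (triUp i w).image (· + v) = triUp i (w + v) := by
  simp only [triUp, Finset.image_insert, Finset.image_singleton, add_right_comm]

theorem image_add_triDown (i : ℤ) (w v : ℤ × ℤ) :
    (triDown i w).image (· + v) = triDown i (w + v) := by
  simp only [triDown, Finset.image_insert, Finset.image_singleton, add_right_comm]

theorem image_add_quadr (i : ℤ) (w v : ℤ × ℤ) : (quadr i w).image (· + v) = quadr i (w + v) := by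
  simp only [quadr, Finset.image_insert, Finset.image_singleton, add_right_comm]

theorem face_injective : Function.Injective face := fun S T h => by
  ext w
  rw [← some_mem_face, h, some_mem_face]

theorem cone_injective : Function.Injective cone := fun S T h => by
  ext w
  rw [← some_mem_cone, h, some_mem_cone]

theorem face_ne_cone (S T : Finset (ℤ × ℤ)) : face S ≠ cone T := fun h => by
  have : none ∈ cone T := none_mem_cone
  rw [← h] at this
  exact none_notMem_face this

theorem triUp_ne_triDown (i : ℤ) (w w' : ℤ × ℤ) : triUp i w ≠ triDown i w' := by
  intro h
  have h1 : w ∈ triDown i w' := h ▸ (by simp [triUp])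
  have h2 : w + (1, 0) ∈ triDown i w' := h ▸ (by simp [triUp])
  have h3 : w + (1 - i, 1) ∈ triDown i w' := h ▸ (by simp [triUp])
  simp only [triDown, Finset.mem_insert, Finset.mem_singleton, Prod.ext_iff, Prod.fst_add,
    Prod.snd_add] at h1 h2 h3
  omega

theorem eq_of_quadr_eq {i j : ℤ} {w w' : ℤ × ℤ} (h : quadr i w = quadr j w') : i = j := by
  have h1 : w ∈ quadr j w' := h ▸ (by simp [quadr])
  have h2 : w + (1, 0) ∈ quadr j w' := h ▸ (by simp [quadr])
  have h3 : w + (-i, 1) ∈ quadr j w' := h ▸ (by simp [quadr])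
  have h4 : w + (1 - i, 1) ∈ quadr j w' := h ▸ (by simp [quadr])
  simp only [quadr, Finset.mem_insert, Finset.mem_singleton, Prod.ext_iff, Prod.fst_add,
    Prod.snd_add] at h1 h2 h3 h4
  omega

theorem eq_zero_of_mem_triUp {i : ℤ} {w : ℤ × ℤ} (h1 : (0, 0) ∈ triUp i w)
    (h2 : (1 - i, 1) ∈ triUp i w) : w = 0 := by
  simp only [triUp, Finset.mem_insert, Finset.mem_singleton, Prod.ext_iff, Prod.fst_add,
    Prod.snd_add] at h1 h2
  ext <;> simp only [Prod.fst_zero, Prod.snd_zero] <;> omega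

theorem eq_zero_of_mem_triDown {i : ℤ} {w : ℤ × ℤ} (h1 : (0, 0) ∈ triDown i w)
    (h2 : (1 - i, 1) ∈ triDown i w) : w = 0 := by
  simp only [triDown, Finset.mem_insert, Finset.mem_singleton, Prod.ext_iff, Prod.fst_add,
    Prod.snd_add] at h1 h2
  ext <;> simp only [Prod.fst_zero, Prod.snd_zero] <;> omega

theorem pair_add_ne {i : ℤ} {e e' w w' : ℤ × ℤ} (he : e = (1, 0) ∨ e = (-i, 1))
    (he' : e' = (1 - i, 1)) : ({w, w + e} : Finset (ℤ × ℤ)) ≠ {w', w' + e'} := by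
  intro h
  have h1 : w' ∈ ({w, w + e} : Finset (ℤ × ℤ)) := h ▸ (by simp)
  have h2 : w' + e' ∈ ({w, w + e} : Finset (ℤ × ℤ)) := h ▸ (by simp)
  subst he'
  rcases he with rfl | rfl <;>
  · simp only [Finset.mem_insert, Finset.mem_singleton, Prod.ext_iff, Prod.fst_add,
      Prod.snd_add] at h1 h2
    omega

end Frame

/-! ### Dihedral angles at the cusp -/

theorem lorentz_normalPart {u v : Mink} (hu : lorentz u u = 0) (hv : lorentz v v = 0)
    (huv : lorentz u v ≠ 0) (x y : Mink) : lorentz (normalPart u v x) (normalPart u v y) =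
      lorentz x y - (lorentz x v * lorentz y u + lorentz x u * lorentz y v) / lorentz u v := by
  have hsub : ∀ a b c : Mink, lorentz (a - b) c = lorentz a c - lorentz b c := fun a b c => by
    simp [lorentz]
    ring
  have hsm : ∀ (r : ℝ) (a c : Mink), lorentz (r • a) c = r * lorentz a c := fun r a c => by
    simp [lorentz]
    ring
  have hcomm : ∀ a c : Mink, lorentz a c = lorentz c a := fun a c => by
    simp [lorentz]
    ring
  have hsub' : ∀ a b c : Mink, lorentz c (a - b) = lorentz c a - lorentz c b := fun a b c => by
    rw [hcomm, hsub, hcomm a, hcomm b]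
  have hsm' : ∀ (r : ℝ) (a c : Mink), lorentz c (r • a) = r * lorentz c a := fun r a c => by
    rw [hcomm, hsm, hcomm a]
  simp only [normalPart, hsub, hsub', hsm, hsm', hu, hv, hcomm v u, hcomm u y, hcomm v y]
  field_simp
  ring

theorem lorentz_light_coe (a b : ℂ) :
    lorentz (light (a : Ideal)) (light (b : Ideal)) = -‖a - b‖ ^ 2 / 2 := by
  simp only [lorentz, light_coe, ← Complex.normSq_eq_norm_sq, Complex.normSq_apply, Complex.mul_re,
    Complex.conj_re, Complex.conj_im, Complex.sub_re, Complex.sub_im]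
  ring

theorem lorentz_light_infty (b : ℂ) :
    lorentz (light OnePoint.infty) (light (b : Ideal)) = -1 / 2 := by
  simp [lorentz]
  norm_num

/-- The dihedral angle at the side `a b` of the tetrahedron with vertices `a`, `b`, `∞`, `d` equals
the one at the opposite side, which is the angle at `d` of the Euclidean triangle `a b d`. -/
theorem dihedral_infty_lt {a b d : ℂ} (hab : a ≠ b) (had : d ≠ a) (hbd : d ≠ b)
    (h : ‖a - b‖ ^ 2 < ‖d - a‖ ^ 2 + ‖d - b‖ ^ 2) :
    dihedral a b OnePoint.infty d < Real.pi / 2 := by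
  have h1 : 0 < ‖a - b‖ ^ 2 := by
    have := norm_pos_iff.mpr (sub_ne_zero.mpr hab)
    positivity
  have h2 : 0 < ‖d - a‖ ^ 2 := by
    have := norm_pos_iff.mpr (sub_ne_zero.mpr had)
    positivity
  have h3 : 0 < ‖d - b‖ ^ 2 := by
    have := norm_pos_iff.mpr (sub_ne_zero.mpr hbd)
    positivity
  have hself : ∀ z : ℂ, lorentz (light (z : Ideal)) (light (z : Ideal)) = 0 := fun z => by
    rw [lorentz_light_coe]
    simp
  have hne : lorentz (light (a : Ideal)) (light (b : Ideal)) ≠ 0 := by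
    rw [lorentz_light_coe]
    exact (by linarith : -‖a - b‖ ^ 2 / 2 < 0).ne
  have hii : lorentz (light OnePoint.infty) (light OnePoint.infty) = 0 := by simp [lorentz]
  rw [dihedral, Real.arccos_lt_pi_div_two]
  refine div_pos ?_ (mul_pos (Real.sqrt_pos.mpr ?_) (Real.sqrt_pos.mpr ?_))
  · rw [lorentz_normalPart (hself a) (hself b) hne]
    simp only [lorentz_light_coe, lorentz_light_infty]
    rw [sub_pos, div_lt_iff_of_neg (by linarith)]
    linarith
  · rw [lorentz_normalPart (hself a) (hself b) hne]
    simp only [lorentz_light_coe, lorentz_light_infty, hii]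
    rw [sub_pos, div_lt_iff_of_neg (by linarith)]
    norm_num
  · rw [lorentz_normalPart (hself a) (hself b) hne, hself]
    simp only [lorentz_light_coe]
    rw [sub_pos, div_lt_iff_of_neg (by linarith)]
    have := mul_pos h2 h3
    linarith

/-! ### The triangulations and the sub-ananas -/

open Ananas.Frame

namespace DrilledAnanas

/-- The developing map of `A` is a homeomorphism onto the region above the surface of the lattice
`G`, whose basis has an obtuse angle; `ρ` relates the basis of the lattice to the deck group. -/
structure Developed (A : DrilledAnanas) (G : Frame) (ρ : (ℤ × ℤ) ≃+ (ℤ × ℤ)) : Prop where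
  isClosedEmbedding : IsClosedEmbedding A.dev
  range_eq : range A.dev = G.region
  hol_eq : ∀ w, A.hol (ρ w) = w.1 * G.u + w.2 * G.v
  inn_neg : G.inn < 0

/-- The automorphism of `ℤ²` that takes `(1, 0)` to itself and `(0, 1)` to `(-1, -1)`. -/
def obtuseMap : (ℤ × ℤ) ≃+ (ℤ × ℤ) where
  toFun w := (w.1 - w.2, -w.2)
  invFun w := (w.1 - w.2, -w.2)
  left_inv w := by ext <;> simp
  right_inv w := by ext <;> simp
  map_add' w w' := by ext <;> simp <;> ring

/-- One of the three pairs of sides of a boundary triangle can be chosen as a basis with negative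
inner product. -/
theorem exists_developed (A : DrilledAnanas) : ∃ G ρ, A.Developed G ρ := by
  obtain ⟨c, hcl, hr⟩ := A.exists_region
  by_cases hinn : (A.frame c).inn < 0
  · exact ⟨A.frame c, AddEquiv.refl _, hcl, hr, fun w => rfl, hinn⟩
  · -- of the three pairs of sides of the triangles, the pair `ω₁`, `-ω₁ - ω₂` has an obtuse angle
    have hcr := A.cross_ne
    let G : Frame := ⟨c, A.ω₁, -A.ω₁ - A.ω₂, by
      intro h
      apply hcr
      simp only [Complex.sub_re, Complex.sub_im, Complex.neg_re, Complex.neg_im] at h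
      linarith⟩
    have hGinn : G.inn = -(Complex.normSq A.ω₁) - (A.frame c).inn := by
      simp only [G, inn, frame, Complex.normSq_apply, Complex.sub_re, Complex.sub_im,
        Complex.neg_re, Complex.neg_im]
      ring
    refine ⟨G, obtuseMap, hcl, ?_, fun w => ?_, ?_⟩
    · rw [hr]
      ext p
      rw [mem_region, mem_region, height_le_iff, height_le_iff]
      have hp : (A.frame c).crd p.z = ((G.crd p.z).1 - (G.crd p.z).2, -(G.crd p.z).2) := by
        refine crd_z_unique ?_
        conv_lhs => rw [← G.pt_crd p.z]
        simp only [pt, G, frame]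
        push_cast
        ring
      have hgap : (A.frame c).gap ((A.frame c).crd p.z) = G.gap (G.crd p.z) := by
        rw [hp]
        generalize G.crd p.z = q
        have e1 : q.1 - q.2 - -q.2 = q.1 := by ring
        have e2 : Complex.normSq G.v = Complex.normSq A.ω₁ + Complex.normSq A.ω₂ +
            2 * (A.frame c).inn := by
          simp only [G, inn, frame, Complex.normSq_apply, Complex.sub_re, Complex.sub_im,
            Complex.neg_re, Complex.neg_im]
          ring
        simp only [gap, e1, bump_neg, hGinn, e2]
        simp only [G, frame]
        ring
      rw [hgap]
    · simp only [hol, obtuseMap, G, AddEquiv.coe_mk, Equiv.coe_fn_mk]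
      push_cast
      ring
    · rw [hGinn]
      have : 0 < Complex.normSq A.ω₁ := Complex.normSq_pos.mpr (A.frame c).u_ne_zero
      linarith

/-- The part of the universal cover that develops onto the convex hull of some vertices of the
lattice. -/
def cell (A : DrilledAnanas) (G : Frame) (S : Finset (Option (ℤ × ℤ))) : Set Cover :=
  A.dev ⁻¹' hull (G.ideal '' S)

namespace Developed

variable {A : DrilledAnanas} {G : Frame} {ρ : (ℤ × ℤ) ≃+ (ℤ × ℤ)}

theorem region_shear_subset (D : A.Developed G ρ) (i k : ℕ) :
    (G.shear ((i + k : ℕ) : ℤ)).region ⊆ (G.shear (i : ℤ)).region := by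
  induction k with
  | zero => exact subset_rfl
  | succ k ih =>
    refine Subset.trans (fun p hp => ?_) ih
    rw [region_shear_succ_union D.inn_neg (by positivity)]
    left
    exact_mod_cast hp

theorem hull_subset_region (D : A.Developed G ρ) {i : ℕ} {S : Finset (Option (ℤ × ℤ))}
    (hS : IsCell i S) : hull (G.ideal '' S) ⊆ G.region := by
  have h0 : ∀ j : ℕ, (G.shear (j : ℤ)).region ⊆ G.region := fun j => by
    have := D.region_shear_subset 0 j
    rwa [Nat.cast_zero, shear_zero, zero_add] at this
  intro p hp
  rcases hS with ⟨j, w, hj, -, rfl⟩ | ⟨w, rfl | rfl⟩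
  · lift j to ℕ using hj
    exact h0 j ((region_shear_succ_union D.inn_neg (by positivity)).mpr (Or.inr ⟨w, hp⟩))
  · exact h0 i ((mem_region_shear_iff _ _).mpr ⟨w, Or.inl hp⟩)
  · exact h0 i ((mem_region_shear_iff _ _).mpr ⟨w, Or.inr hp⟩)

theorem exists_cell (D : A.Developed G ρ) (i : ℕ) {p : H3} (hp : p ∈ G.region) :
    ∃ S, IsCell i S ∧ p ∈ hull (G.ideal '' S) := by
  have key : p ∈ (G.shear (i : ℤ)).region ∨
      ∃ (j : ℕ) (w : ℤ × ℤ), j < i ∧ p ∈ hull (G.ideal '' face (quadr j w)) := by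
    induction i with
    | zero =>
      left
      rwa [Nat.cast_zero, shear_zero]
    | succ i ih =>
      rcases ih with h | ⟨j, w, hj, h⟩
      · rcases (region_shear_succ_union D.inn_neg (by positivity)).mp h with h | ⟨w, h⟩
        · left
          exact_mod_cast h
        · exact Or.inr ⟨i, w, by omega, h⟩
      · exact Or.inr ⟨j, w, by omega, h⟩
  rcases key with h | ⟨j, w, hj, h⟩
  · obtain ⟨w, h | h⟩ := (mem_region_shear_iff _ _).mp h
    · exact ⟨_, Or.inr ⟨w, Or.inl rfl⟩, h⟩
    · exact ⟨_, Or.inr ⟨w, Or.inr rfl⟩, h⟩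
  · exact ⟨_, Or.inl ⟨j, w, by positivity, by exact_mod_cast hj, rfl⟩, h⟩

theorem isIdealCell_cell (D : A.Developed G ρ) {i : ℕ} {S T : Finset (Option (ℤ × ℤ))}
    (hS : IsCell i S) (hT : T ⊆ S) : IsIdealCell A.dev (A.cell G T) (G.ideal '' T) := by
  rw [isIdealCell_iff D.isClosedEmbedding.isEmbedding, D.range_eq]
  exact ⟨(hull_mono (image_mono (Finset.coe_subset.mpr hT))).trans (D.hull_subset_region hS), rfl⟩

theorem image_cell (D : A.Developed G ρ) {i : ℕ} {S T : Finset (Option (ℤ × ℤ))}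
    (hS : IsCell i S) (hT : T ⊆ S) : A.dev '' A.cell G T = hull (G.ideal '' T) :=
  (D.isIdealCell_cell hS hT).image_eq

theorem cell_inter (D : A.Developed G ρ) {i : ℕ} {S S' T T' : Finset (Option (ℤ × ℤ))}
    (hS : IsCell i S) (hS' : IsCell i S') (hT : T ⊆ S) (hT' : T' ⊆ S') :
    A.cell G T ∩ A.cell G T' = A.cell G (T ∩ T') := by
  rw [cell, cell, cell, ← hull_inter_of_subset (fun _ => D.inn_neg) (by positivity) hS hS' hT hT']
  rfl

theorem subset_of_cell_subset (D : A.Developed G ρ) {i : ℕ} {S S' T : Finset (Option (ℤ × ℤ))}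
    (hS : IsCell i S) (hS' : IsCell i S') (hT : T ⊆ S) (hn : T.Nontrivial)
    (h : A.cell G T ⊆ A.cell G S') : T ⊆ S' := by
  refine subset_of_hull_subset (F := G) (fun _ => D.inn_neg) (by positivity) hS hS' hT hn ?_
  rw [← D.image_cell hS hT, ← D.image_cell hS' subset_rfl]
  exact image_mono h

theorem cell_injective (D : A.Developed G ρ) {i : ℕ} {S S' : Finset (Option (ℤ × ℤ))}
    (hS : IsCell i S) (hS' : IsCell i S') (h : A.cell G S = A.cell G S') : S = S' :=
  (D.subset_of_cell_subset hS hS' subset_rfl hS.nontrivial h.le).antisymm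
    (D.subset_of_cell_subset hS' hS subset_rfl hS'.nontrivial h.ge)

theorem isTet_cell (D : A.Developed G ρ) {i : ℕ} {S : Finset (Option (ℤ × ℤ))}
    (hS : IsCell i S) : IsTet A (A.cell G S) (G.ideal '' S) :=
  ⟨exists_linearIndependent D.inn_neg hS, D.isIdealCell_cell hS subset_rfl⟩

/-! #### Deck transformations -/

theorem ideal_some_add (D : A.Developed G ρ) (v w : ℤ × ℤ) :
    idealTranslate (A.hol (ρ w)) (G.ideal (some v)) = G.ideal (some (v + w)) := by
  rw [ideal_some, idealTranslate_coe, ideal_some, D.hol_eq]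
  congr 1
  simp only [pt, Frame.cast, Prod.fst_add, Prod.snd_add]
  push_cast
  ring

theorem shift_image_preimage_hull (w : ℤ × ℤ) (V : Set Ideal) :
    shift w '' (A.dev ⁻¹' hull V) = A.dev ⁻¹' hull (idealTranslate (A.hol w) '' V) := by
  rw [hull_idealTranslate]
  ext x
  constructor
  · rintro ⟨y, hy, rfl⟩
    exact ⟨_, hy, (A.dev_shift w y).symm⟩
  · rintro ⟨p, hp, hpx⟩
    have hx : shift w (shift (-w) x) = x := by rw [shift_shift, neg_add_cancel, shift_zero]
    refine ⟨shift (-w) x, ?_, hx⟩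
    have h1 := A.dev_shift w (shift (-w) x)
    rw [hx, ← hpx] at h1
    have h2 : p = A.dev (shift (-w) x) := by
      have h3 := congrArg (H3.translate (-A.hol w)) h1
      rwa [H3.translate_translate, H3.translate_translate, add_neg_cancel, H3.translate_zero,
        H3.translate_zero] at h3
    rw [mem_preimage, ← h2]
    exact hp

theorem shift_cell_face (D : A.Developed G ρ) (w : ℤ × ℤ) (S : Finset (ℤ × ℤ)) :
    shift (ρ w) '' A.cell G (face S) = A.cell G (face (S.image (· + w))) := by
  rw [cell, shift_image_preimage_hull, cell, image_face, image_face, image_image]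
  simp only [D.ideal_some_add, Finset.coe_image, image_image]

theorem shift_cell_cone (D : A.Developed G ρ) (w : ℤ × ℤ) (S : Finset (ℤ × ℤ)) :
    shift (ρ w) '' A.cell G (cone S) = A.cell G (cone (S.image (· + w))) := by
  rw [cell, shift_image_preimage_hull, cell, coe_cone, coe_cone, image_insert_eq, image_insert_eq,
    image_insert_eq, image_image, image_image, image_image]
  simp only [D.ideal_some_add, Finset.coe_image, image_image, ideal_none, idealTranslate_infty]

theorem mem_orbit_iff {C C' : Set Cover} : C' ∈ orbit C ↔ ∃ w, C' = shift (ρ w) '' C := by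
  constructor
  · rintro ⟨v, rfl⟩
    exact ⟨ρ.symm v, by rw [ρ.apply_symm_apply]⟩
  · rintro ⟨w, rfl⟩
    exact ⟨ρ w, rfl⟩

theorem mem_orbit_face (D : A.Developed G ρ) {S : Finset (ℤ × ℤ)} {C : Set Cover} :
    C ∈ orbit (A.cell G (face S)) ↔ ∃ w, C = A.cell G (face (S.image (· + w))) := by
  simp only [mem_orbit_iff (ρ := ρ), D.shift_cell_face]

theorem mem_orbit_cone (D : A.Developed G ρ) {S : Finset (ℤ × ℤ)} {C : Set Cover} :
    C ∈ orbit (A.cell G (cone S)) ↔ ∃ w, C = A.cell G (cone (S.image (· + w))) := by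
  simp only [mem_orbit_iff (ρ := ρ), D.shift_cell_cone]

theorem exists_add_iff {α : Type*} {C : α} {f : ℤ × ℤ → α} (v : ℤ × ℤ) :
    (∃ w, C = f (v + w)) ↔ ∃ w, C = f w :=
  ⟨fun ⟨w, h⟩ => ⟨_, h⟩, fun ⟨w, h⟩ => ⟨w - v, by rwa [add_sub_cancel]⟩⟩

theorem mem_orbit_up (D : A.Developed G ρ) {i : ℤ} (v : ℤ × ℤ) {C : Set Cover} :
    C ∈ orbit (A.cell G (cone (triUp i v))) ↔ ∃ w, C = A.cell G (cone (triUp i w)) := by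
  simp only [D.mem_orbit_cone, image_add_triUp]
  exact exists_add_iff (f := fun w => A.cell G (cone (triUp i w))) v

theorem mem_orbit_down (D : A.Developed G ρ) {i : ℤ} (v : ℤ × ℤ) {C : Set Cover} :
    C ∈ orbit (A.cell G (cone (triDown i v))) ↔ ∃ w, C = A.cell G (cone (triDown i w)) := by
  simp only [D.mem_orbit_cone, image_add_triDown]
  exact exists_add_iff (f := fun w => A.cell G (cone (triDown i w))) v

theorem mem_orbit_quadr (D : A.Developed G ρ) {i : ℤ} (v : ℤ × ℤ) {C : Set Cover} :
    C ∈ orbit (A.cell G (face (quadr i v))) ↔ ∃ w, C = A.cell G (face (quadr i w)) := by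
  simp only [D.mem_orbit_face, image_add_quadr]
  exact exists_add_iff (f := fun w => A.cell G (face (quadr i w))) v

/-! #### Triangulations -/

/-- The triangulation by the cells of level `i`. -/
def triangulation (D : A.Developed G ρ) (i : ℕ) : GeometricTriangulation A where
  tets := {C | ∃ S, IsCell i S ∧ C = A.cell G S}
  isTet := by
    rintro _ ⟨S, hS, rfl⟩
    exact ⟨_, D.isTet_cell hS⟩
  finite := by
    refine ⟨(fun j : ℕ => A.cell G (face (quadr j 0))) '' Iio i ∪
      {A.cell G (cone (triUp i 0)), A.cell G (cone (triDown i 0))}, ?_, ?_⟩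
    · exact ((finite_Iio i).image _).union (by simp)
    · ext C
      simp only [mem_iUnion, exists_prop, mem_union, mem_image, mem_Iio, mem_insert_iff,
        mem_singleton_iff]
      constructor
      · rintro ⟨S, ⟨j, w, hj, hji, rfl⟩ | ⟨w, rfl | rfl⟩, rfl⟩
        · lift j to ℕ using hj
          exact ⟨_, Or.inl ⟨j, by exact_mod_cast hji, rfl⟩, (D.mem_orbit_quadr 0).mpr ⟨w, rfl⟩⟩
        · exact ⟨_, Or.inr (Or.inl rfl), (D.mem_orbit_up 0).mpr ⟨w, rfl⟩⟩
        · exact ⟨_, Or.inr (Or.inr rfl), (D.mem_orbit_down 0).mpr ⟨w, rfl⟩⟩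
      · rintro ⟨τ, ⟨j, hj, rfl⟩ | rfl | rfl, hC⟩
        · obtain ⟨w, rfl⟩ := (D.mem_orbit_quadr 0).mp hC
          exact ⟨_, Or.inl ⟨j, w, by positivity, by exact_mod_cast hj, rfl⟩, rfl⟩
        · obtain ⟨w, rfl⟩ := (D.mem_orbit_up 0).mp hC
          exact ⟨_, Or.inr ⟨w, Or.inl rfl⟩, rfl⟩
        · obtain ⟨w, rfl⟩ := (D.mem_orbit_down 0).mp hC
          exact ⟨_, Or.inr ⟨w, Or.inr rfl⟩, rfl⟩
  cover := by
    rw [eq_univ_iff_forall]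
    intro x
    obtain ⟨S, hS, hx⟩ := D.exists_cell i (p := A.dev x) (D.range_eq ▸ mem_range_self x)
    exact ⟨_, ⟨S, hS, rfl⟩, hx⟩
  face_to_face := by
    rintro _ ⟨S, hS, rfl⟩ _ ⟨S', hS', rfl⟩ -
    refine ⟨_, _, G.ideal '' (S ∩ S' : Finset _), D.isTet_cell hS, D.isTet_cell hS', ?_, ?_⟩
    · rw [Finset.coe_inter]
      exact image_inter_subset _ _ _
    · rw [D.cell_inter hS hS' subset_rfl subset_rfl]
      exact D.isIdealCell_cell hS Finset.inter_subset_left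

theorem mem_tets (D : A.Developed G ρ) {i : ℕ} {C : Set Cover} :
    C ∈ (D.triangulation i).tets ↔ ∃ S, IsCell i S ∧ C = A.cell G S := Iff.rfl

theorem hull_face_ne_hull_of_infty {S : Finset (ℤ × ℤ)} {V : Set Ideal} (hV : OnePoint.infty ∈ V)
    (hV' : ∃ z : ℂ, (z : Ideal) ∈ V) : hull (G.ideal '' face S) ≠ hull V := by
  intro h
  obtain ⟨M, hM⟩ := G.bddAbove_face S
  obtain ⟨z, hz⟩ := hV'
  obtain ⟨p, hp, hpt⟩ := not_bddAbove_of_infty hV hz M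
  exact absurd (hM p (h ▸ hp)) (not_le.mpr hpt)

theorem exists_coe_mem_of_isTet {τ : Set Cover} {V : Set Ideal} (h : IsTet A τ V) :
    ∃ z : ℂ, (z : Ideal) ∈ V := by
  obtain ⟨⟨a, b, c, d, rfl, hli⟩, -⟩ := h
  have hne : a ≠ b := by
    rintro rfl
    have := hli.injective (a₁ := 0) (a₂ := 1) rfl
    exact absurd this (by decide)
  by_cases ha : a = OnePoint.infty
  · obtain ⟨z, hz⟩ := OnePoint.ne_infty_iff_exists.mp (fun hb => hne (ha.trans hb.symm))
    exact ⟨z, by simp [hz]⟩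
  · obtain ⟨z, hz⟩ := OnePoint.ne_infty_iff_exists.mp ha
    exact ⟨z, by simp [hz]⟩

/-- The tetrahedra at the cusp are the cones over the lattice triangles of the current basis. -/
theorem mem_cuspTets (D : A.Developed G ρ) {i : ℕ} {C : Set Cover} :
    C ∈ cuspTets (D.triangulation i) ↔
      ∃ w, C = A.cell G (cone (triUp i w)) ∨ C = A.cell G (cone (triDown i w)) := by
  constructor
  · rintro ⟨⟨S, hS, rfl⟩, V, hV, hinf⟩
    rcases hS with ⟨j, w, hj, hji, rfl⟩ | ⟨w, rfl | rfl⟩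
    · exfalso
      have h1 := D.image_cell (S := face (quadr j w)) (Or.inl ⟨j, w, hj, hji, rfl⟩) subset_rfl
      rw [hV.2.image_eq] at h1
      exact hull_face_ne_hull_of_infty hinf (exists_coe_mem_of_isTet hV) h1.symm
    · exact ⟨w, Or.inl rfl⟩
    · exact ⟨w, Or.inr rfl⟩
  · rintro ⟨w, rfl | rfl⟩
    · exact ⟨⟨_, Or.inr ⟨w, Or.inl rfl⟩, rfl⟩, _, D.isTet_cell (Or.inr ⟨w, Or.inl rfl⟩),
        ⟨none, by simp, rfl⟩⟩
    · exact ⟨⟨_, Or.inr ⟨w, Or.inr rfl⟩, rfl⟩, _, D.isTet_cell (Or.inr ⟨w, Or.inr rfl⟩),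
        ⟨none, by simp, rfl⟩⟩

theorem triangulation_ne (D : A.Developed G ρ) {i j : ℕ} (hij : i < j) :
    (D.triangulation i).tets ≠ (D.triangulation j).tets := by
  intro h
  have hq : IsCell j (face (quadr i 0)) :=
    Or.inl ⟨i, 0, by positivity, by exact_mod_cast hij, rfl⟩
  have h1 : A.cell G (face (quadr i 0)) ∈ (D.triangulation i).tets := by
    rw [h]
    exact ⟨_, hq, rfl⟩
  obtain ⟨S, hS, he⟩ := h1
  have hhull := D.image_cell hq subset_rfl
  have hhull' := D.image_cell hS subset_rfl
  rw [he, hhull'] at hhull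
  have hcone : ∀ T : Finset (ℤ × ℤ), T.Nonempty →
      hull (G.ideal '' face (quadr i 0)) ≠ hull (G.ideal '' cone T) := fun T ⟨w, hw⟩ =>
    hull_face_ne_hull_of_infty ⟨none, by simp, rfl⟩ ⟨_, some w, by simpa using hw, rfl⟩
  rcases hS with ⟨k, w, hk, hki, rfl⟩ | ⟨w, rfl | rfl⟩
  · have hq' : IsCell j (face (quadr k w)) := Or.inl ⟨k, w, hk, by
      have : (i : ℤ) < j := by exact_mod_cast hij
      omega, rfl⟩
    have := eq_of_quadr_eq (face_injective (D.cell_injective hq hq' he))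
    omega
  · exact hcone _ (by simp [triUp]) hhull.symm
  · exact hcone _ (by simp [triDown]) hhull.symm

theorem triangulation_injective (D : A.Developed G ρ) :
    Function.Injective fun i => (D.triangulation i).tets := by
  intro i j h
  rcases lt_trichotomy i j with hlt | heq | hgt
  · exact absurd h (D.triangulation_ne hlt)
  · exact heq
  · exact absurd h.symm (D.triangulation_ne hgt)

/-! #### Sub-ananas -/

theorem exists_incl (D : A.Developed G ρ) (i : ℕ) (x : Cover) :
    ∃ y, A.dev y = (G.shear (i : ℤ)).modelDev x := by
  have h1 : (G.shear (i : ℤ)).modelDev x ∈ range A.dev := by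
    rw [D.range_eq]
    have := D.region_shear_subset 0 i
    rw [Nat.cast_zero, shear_zero, zero_add] at this
    exact this ((G.shear (i : ℤ)).modelDev_mem x)
  exact h1

/-- The sub-ananas above the `i`-th surface. -/
def subAnanas (D : A.Developed G ρ) (i : ℕ) : SubAnanas A where
  ananas := (G.shear (i : ℤ)).model
  incl x := (D.exists_incl i x).choose
  isClosedEmbedding := by
    rw [← D.isClosedEmbedding.of_comp_iff]
    have : (A.dev ∘ fun x => (D.exists_incl i x).choose) = (G.shear (i : ℤ)).modelDev :=
      funext fun x => (D.exists_incl i x).choose_spec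
    rw [this]
    exact isClosedEmbedding_modelDev _
  deck := (shearMap i).trans ρ
  equivariant v x := by
    apply D.isClosedEmbedding.injective
    have h1 : (G.shear (i : ℤ)).modelDev (shift v x) =
        ((G.shear (i : ℤ)).modelDev x).translate ((G.shear (i : ℤ)).model.hol v) :=
      (G.shear (i : ℤ)).model.dev_shift v x
    rw [(D.exists_incl i _).choose_spec, h1, A.dev_shift, (D.exists_incl i _).choose_spec,
      AddEquiv.trans_apply, D.hol_eq]
    congr 1
    simp only [hol, model, shear, shearMap_apply]
    push_cast
    ring
  dev_eq x := (D.exists_incl i x).choose_spec.symm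

theorem dev_incl (D : A.Developed G ρ) (i : ℕ) (x : Cover) :
    A.dev ((D.subAnanas i).incl x) = (G.shear (i : ℤ)).modelDev x := (D.exists_incl i x).choose_spec

theorem incl_image (D : A.Developed G ρ) (i : ℕ) {P : Set H3} (hP : P ⊆ (G.shear (i : ℤ)).region) :
    (D.subAnanas i).incl '' ((G.shear (i : ℤ)).modelDev ⁻¹' P) = A.dev ⁻¹' P := by
  ext y
  constructor
  · rintro ⟨x, hx, rfl⟩
    rw [mem_preimage, D.dev_incl]
    exact hx
  · intro hy
    obtain ⟨x, hx⟩ : A.dev y ∈ range (G.shear (i : ℤ)).modelDev := by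
      rw [range_modelDev]
      exact hP hy
    refine ⟨x, ?_, D.isClosedEmbedding.injective ?_⟩
    · rw [mem_preimage, hx]
      exact hy
    · rw [D.dev_incl, hx]

theorem carrier_subAnanas (D : A.Developed G ρ) (i : ℕ) :
    (D.subAnanas i).carrier = A.dev ⁻¹' (G.shear (i : ℤ)).region := by
  rw [← D.incl_image i subset_rfl, SubAnanas.carrier, ← range_modelDev, preimage_range, image_univ]

theorem carrier_eq_sUnion (D : A.Developed G ρ) (i : ℕ) :
    (D.subAnanas i).carrier = ⋃₀ cuspTets (D.triangulation i) := by
  rw [D.carrier_subAnanas]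
  ext x
  rw [mem_preimage, mem_region_shear_iff]
  constructor
  · rintro ⟨w, h | h⟩
    · exact ⟨_, D.mem_cuspTets.mpr ⟨w, Or.inl rfl⟩, h⟩
    · exact ⟨_, D.mem_cuspTets.mpr ⟨w, Or.inr rfl⟩, h⟩
  · rintro ⟨C, hC, hx⟩
    obtain ⟨w, rfl | rfl⟩ := D.mem_cuspTets.mp hC
    · exact ⟨w, Or.inl hx⟩
    · exact ⟨w, Or.inr hx⟩

/-- The boundary edges of the sub-ananas are the three families of sides of the lattice
triangles. -/
theorem mem_boundaryEdges (D : A.Developed G ρ) {i : ℕ} {C : Set Cover} :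
    C ∈ (D.subAnanas i).boundaryEdges ↔ ∃ w, C = A.cell G (face {w, w + (1, 0)}) ∨
      C = A.cell G (face {w, w + (-(i : ℤ), 1)}) ∨ C = A.cell G (face {w, w + (1 - (i : ℤ), 1)}) :=
          by
  have key : ∀ (w e : ℤ × ℤ), IsStdEdge {w, w + e} →
      (D.subAnanas i).incl '' boundaryCell {w, w + e} =
        A.cell G (face {shearMap i w, shearMap i w + shearMap i e}) := by
    intro w e he
    obtain ⟨E, T, hT, hET, hE⟩ := he.exists_finset
    have hE' : E = {w, w + e} := by
      rw [← Finset.coe_inj, ← hE, Finset.coe_pair]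
    rw [hE, ← modelDev_preimage_face (G.shear (i : ℤ)) hT hET,
      D.incl_image i (face_subset_region _ hT hET), shear_image_face, hE', Finset.image_insert,
      Finset.image_singleton, map_add]
    rfl
  constructor
  · rintro ⟨S, ⟨w, hS⟩, rfl⟩
    refine ⟨shearMap i w, ?_⟩
    rcases hS with rfl | rfl | rfl
    · rw [key _ _ ⟨w, Or.inl rfl⟩, shearMap_one_zero]
      exact Or.inl rfl
    · rw [key _ _ ⟨w, Or.inr (Or.inl rfl)⟩, shearMap_zero_one]
      exact Or.inr (Or.inl rfl)
    · rw [key _ _ ⟨w, Or.inr (Or.inr rfl)⟩, shearMap_one_one]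
      exact Or.inr (Or.inr rfl)
  · rintro ⟨w, h⟩
    obtain ⟨w, rfl⟩ := (shearMap (i : ℤ)).surjective w
    rcases h with rfl | rfl | rfl
    · exact ⟨_, ⟨w, Or.inl rfl⟩, by rw [key _ _ ⟨w, Or.inl rfl⟩, shearMap_one_zero]⟩
    · exact ⟨_, ⟨w, Or.inr (Or.inl rfl)⟩, by
        rw [key _ _ ⟨w, Or.inr (Or.inl rfl)⟩, shearMap_zero_one]⟩
    · exact ⟨_, ⟨w, Or.inr (Or.inr rfl)⟩, by
        rw [key _ _ ⟨w, Or.inr (Or.inr rfl)⟩, shearMap_one_one]⟩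

end Developed
end DrilledAnanas

open Ananas.Frame
namespace DrilledAnanas
namespace Developed

variable {A : DrilledAnanas} {G : Frame} {ρ : (ℤ × ℤ) ≃+ (ℤ × ℤ)}

/-! ### The diagonal exchange -/

variable (A G) in
/-- The boundary edge of the `i`-th sub-ananas that is flipped. -/
def flipEdge (i : ℕ) : Set Cover := A.cell G (face {0, (1 - (i : ℤ), 1)})

variable (A G) in
/-- The edge dual to the flipped edge. -/
def dualEdge (i : ℕ) : Set Cover := A.cell G (face {(1, 0), (-(i : ℤ), 1)})

theorem isCell_up (i : ℤ) (w : ℤ × ℤ) : IsCell i (cone (triUp i w)) := Or.inr ⟨w, Or.inl rfl⟩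

theorem isCell_down (i : ℤ) (w : ℤ × ℤ) : IsCell i (cone (triDown i w)) := Or.inr ⟨w, Or.inr rfl⟩

theorem flip_subset_up (i : ℤ) : ({0, (1 - i, 1)} : Finset (ℤ × ℤ)) ⊆ triUp i 0 := by
  intro x
  simp only [triUp, zero_add, Finset.mem_insert, Finset.mem_singleton]
  tauto

theorem flip_subset_down (i : ℤ) : ({0, (1 - i, 1)} : Finset (ℤ × ℤ)) ⊆ triDown i 0 := by
  intro x
  simp only [triDown, zero_add, Finset.mem_insert, Finset.mem_singleton]
  tauto

theorem face_mono {S T : Finset (ℤ × ℤ)} (h : S ⊆ T) : face S ⊆ face T := Finset.map_subset_map.mpr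
    h

theorem mem_orbit_flipEdge (D : A.Developed G ρ) {i : ℕ} {C : Set Cover} :
    C ∈ orbit (flipEdge A G i) ↔ ∃ w, C = A.cell G (face {w, w + (1 - (i : ℤ), 1)}) := by
  rw [flipEdge, D.mem_orbit_face]
  simp only [Finset.image_insert, Finset.image_singleton, zero_add,
    add_comm (1 - (i : ℤ), (1 : ℤ))]

theorem mem_orbit_dualEdge (D : A.Developed G ρ) {i : ℕ} {C : Set Cover} :
    C ∈ orbit (dualEdge A G i) ↔
      ∃ w, C = A.cell G (face {w, w + (-((i + 1 : ℕ) : ℤ), 1)}) := by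
  rw [dualEdge, D.mem_orbit_face]
  have h : ∀ w : ℤ × ℤ, ({(1, 0), (-(i : ℤ), 1)} : Finset (ℤ × ℤ)).image (· + w) =
      {(1, 0) + w, (1, 0) + w + (-((i + 1 : ℕ) : ℤ), 1)} := by
    intro w
    rw [Finset.image_insert, Finset.image_singleton]
    congr 2
    ext
    · simp only [Prod.fst_add]
      push_cast
      ring
    · simp only [Prod.snd_add]
      ring
  simp only [h]
  exact exists_add_iff (f := fun w => A.cell G (face {w, w + (-((i + 1 : ℕ) : ℤ), 1)})) (1, 0)

theorem cell_edge_ne (D : A.Developed G ρ) {i : ℕ} {e w w' : ℤ × ℤ}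
    (he : e = (1, 0) ∨ e = (-(i : ℤ), 1)) :
    A.cell G (face {w, w + e}) ≠ A.cell G (face {w', w' + (1 - (i : ℤ), 1)}) := by
  intro h
  have hS : ∃ T, IsCell i (cone T) ∧ ({w, w + e} : Finset (ℤ × ℤ)) ⊆ T := by
    rcases he with rfl | rfl
    · refine ⟨_, isCell_up i w, ?_⟩
      intro x
      simp only [triUp, Finset.mem_insert, Finset.mem_singleton]
      tauto
    · refine ⟨_, isCell_down i w, ?_⟩
      intro x
      simp only [triDown, Finset.mem_insert, Finset.mem_singleton]
      tauto
  obtain ⟨T, hT, hsub⟩ := hS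
  have hsub' : ({w', w' + (1 - (i : ℤ), 1)} : Finset (ℤ × ℤ)) ⊆ triUp i w' := by
    intro x
    simp only [triUp, Finset.mem_insert, Finset.mem_singleton]
    tauto
  have h1 := D.image_cell hT ((face_mono hsub).trans (face_subset_cone T))
  have h2 := D.image_cell (isCell_up i w') ((face_mono hsub').trans (face_subset_cone _))
  rw [h, h2] at h1
  rw [image_face, image_face, Finset.coe_pair, Finset.coe_pair, image_pair, image_pair] at h1
  have hinj : Function.Injective fun w => G.ideal (some w) :=
    G.ideal_injective.comp (Option.some_injective _)
  have hp := pair_eq_of_hull_eq (fun h0 => ?_) (fun h0 => ?_) h1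
  · rw [← image_pair (fun w => G.ideal (some w)), ← image_pair (fun w => G.ideal (some w)),
      hinj.image_injective.eq_iff, ← Finset.coe_pair, ← Finset.coe_pair, Finset.coe_inj] at hp
    exact pair_add_ne he rfl hp.symm
  · have h0' := hinj h0
    simp [Prod.ext_iff] at h0'
  · have h0' := hinj h0
    rcases he with rfl | rfl <;> simp [Prod.ext_iff] at h0'

theorem boundaryEdges_succ (D : A.Developed G ρ) (i : ℕ) :
    (D.subAnanas (i + 1)).boundaryEdges =
      ((D.subAnanas i).boundaryEdges \ orbit (flipEdge A G i)) ∪ orbit (dualEdge A G i) := by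
  ext C
  rw [mem_union, Set.mem_sdiff, D.mem_orbit_flipEdge, D.mem_orbit_dualEdge, D.mem_boundaryEdges,
    D.mem_boundaryEdges]
  have hcast : (1 - ((i + 1 : ℕ) : ℤ)) = -(i : ℤ) := by
    push_cast
    ring
  rw [hcast]
  constructor
  · rintro ⟨w, rfl | rfl | rfl⟩
    · exact Or.inl ⟨⟨w, Or.inl rfl⟩, fun ⟨w', h⟩ => D.cell_edge_ne (Or.inl rfl) h⟩
    · exact Or.inr ⟨w, rfl⟩
    · exact Or.inl ⟨⟨w, Or.inr (Or.inl rfl)⟩, fun ⟨w', h⟩ => D.cell_edge_ne (Or.inr rfl) h⟩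
  · rintro (⟨⟨w, rfl | rfl | rfl⟩, h⟩ | ⟨w, rfl⟩)
    · exact ⟨w, Or.inl rfl⟩
    · exact ⟨w, Or.inr (Or.inr rfl)⟩
    · exact absurd ⟨w, rfl⟩ h
    · exact ⟨w, Or.inr (Or.inl rfl)⟩

theorem exists_cuspTets (D : A.Developed G ρ) (i : ℕ) : ∃ τ τ', τ' ∉ orbit τ ∧
    cuspTets (D.triangulation i) = orbit τ ∪ orbit τ' := by
  refine ⟨A.cell G (cone (triUp i 0)), A.cell G (cone (triDown i 0)), ?_, ?_⟩
  · rw [D.mem_orbit_up]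
    rintro ⟨w, h⟩
    exact triUp_ne_triDown _ _ _ (cone_injective (D.cell_injective (isCell_down _ _)
      (isCell_up _ _) h)).symm
  · ext C
    rw [D.mem_cuspTets, mem_union, D.mem_orbit_up, D.mem_orbit_down, exists_or]

theorem flipEdge_mem (D : A.Developed G ρ) (i : ℕ) :
    flipEdge A G i ∈ (D.subAnanas i).boundaryEdges :=
  D.mem_boundaryEdges.mpr ⟨0, Or.inr (Or.inr (by rw [zero_add]; rfl))⟩

theorem norm_pt_sub_sq (F : Frame) (q r : ℝ × ℝ) : ‖F.pt q - F.pt r‖ ^ 2 = F.quad (q - r) := by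
  rw [F.quad_eq]
  congr 2
  simp only [pt, Prod.fst_sub, Prod.snd_sub]
  push_cast
  ring

theorem dihedral_lt (D : A.Developed G ρ) (i : ℕ) {d : ℤ × ℤ}
    (hd : d = (1, 0) ∨ d = (-(i : ℤ), 1)) :
    dihedral (G.ideal (some 0)) (G.ideal (some (1 - (i : ℤ), 1))) (G.ideal none)
      (G.ideal (some d)) < Real.pi / 2 := by
  have hinj : ∀ w w' : ℤ × ℤ, w ≠ w' → G.pt (cast w) ≠ G.pt (cast w') := fun w w' h h' =>
    h (cast_injective (G.pt_injective h'))
  simp only [ideal_some, ideal_none]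
  have hneg : G.inn - i * Complex.normSq G.u < 0 := by
    have := D.inn_neg
    have h2 : (0 : ℝ) ≤ i * Complex.normSq G.u :=
      mul_nonneg (by positivity) (Complex.normSq_nonneg _)
    linarith
  refine dihedral_infty_lt (hinj _ _ ?_) (hinj _ _ ?_) (hinj _ _ ?_) ?_
  · simp [Prod.ext_iff]
  · rcases hd with rfl | rfl <;> simp [Prod.ext_iff]
  · rcases hd with rfl | rfl
    · simp [Prod.ext_iff]
    · simp only [ne_eq, Prod.ext_iff]
      omega
  · rw [norm_pt_sub_sq, norm_pt_sub_sq, norm_pt_sub_sq]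
    rcases hd with rfl | rfl <;>
    · simp only [quad, Frame.cast, Prod.fst_sub, Prod.snd_sub, Prod.fst_zero, Prod.snd_zero]
      push_cast
      linarith

theorem cell_up_ne_down (D : A.Developed G ρ) (i : ℕ) (w w' : ℤ × ℤ) :
    A.cell G (cone (triUp i w)) ≠ A.cell G (cone (triDown i w')) := fun h =>
  triUp_ne_triDown _ _ _ (cone_injective (D.cell_injective (isCell_up _ _) (isCell_down _ _) h))

theorem nontrivial_flip (i : ℤ) : (face {0, (1 - i, 1)}).Nontrivial :=
  ⟨some 0, by simp, some (1 - i, 1), by simp, by simp [Prod.ext_iff]⟩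

/-- The tetrahedra at the cusp that contain the flipped edge are the two cones over its
triangles. -/
theorem flipEdge_subset (D : A.Developed G ρ) (i : ℕ) {C : Set Cover} :
    C ∈ cuspTets (D.triangulation i) ∧ flipEdge A G i ⊆ C ↔
      C = A.cell G (cone (triUp i 0)) ∨ C = A.cell G (cone (triDown i 0)) := by
  have hup : face {0, (1 - (i : ℤ), 1)} ⊆ cone (triUp i 0) :=
    (face_mono (flip_subset_up i)).trans (face_subset_cone _)
  have hdown : face {0, (1 - (i : ℤ), 1)} ⊆ cone (triDown i 0) :=
    (face_mono (flip_subset_down i)).trans (face_subset_cone _)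
  constructor
  · rintro ⟨hC, hsub⟩
    obtain ⟨w, rfl | rfl⟩ := D.mem_cuspTets.mp hC
    · have h := D.subset_of_cell_subset (isCell_up i 0) (isCell_up i w) hup (nontrivial_flip i) hsub
      have h1 := some_mem_cone.mp (h (some_mem_face.mpr (Finset.mem_insert_self _ _)))
      have h2 := some_mem_cone.mp (h (some_mem_face.mpr
        (Finset.mem_insert_of_mem (Finset.mem_singleton_self _))))
      rw [eq_zero_of_mem_triUp h1 h2]
      exact Or.inl rfl
    · have h := D.subset_of_cell_subset (isCell_up i 0) (isCell_down i w) hup (nontrivial_flip i)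
        hsub
      have h1 := some_mem_cone.mp (h (some_mem_face.mpr (Finset.mem_insert_self _ _)))
      have h2 := some_mem_cone.mp (h (some_mem_face.mpr
        (Finset.mem_insert_of_mem (Finset.mem_singleton_self _))))
      rw [eq_zero_of_mem_triDown h1 h2]
      exact Or.inr rfl
  · rintro (rfl | rfl)
    · exact ⟨D.mem_cuspTets.mpr ⟨0, Or.inl rfl⟩,
        preimage_mono (hull_mono (image_mono (Finset.coe_subset.mpr hup)))⟩
    · exact ⟨D.mem_cuspTets.mpr ⟨0, Or.inr rfl⟩,
        preimage_mono (hull_mono (image_mono (Finset.coe_subset.mpr hdown)))⟩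

theorem ideal_cone_triUp (G : Frame) (i : ℤ) : G.ideal '' cone (triUp i 0) =
    {G.ideal (some 0), G.ideal (some (1 - i, 1)), G.ideal none, G.ideal (some (1, 0))} := by
  rw [coe_cone, triUp]
  simp only [Finset.coe_insert, Finset.coe_singleton, image_insert_eq, image_singleton, zero_add]
  ext x
  simp only [mem_insert_iff, mem_singleton_iff]
  tauto

theorem ideal_cone_triDown (G : Frame) (i : ℤ) : G.ideal '' cone (triDown i 0) =
    {G.ideal (some 0), G.ideal (some (1 - i, 1)), G.ideal none, G.ideal (some (-i, 1))} := by
  rw [coe_cone, triDown]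
  simp only [Finset.coe_insert, Finset.coe_singleton, image_insert_eq, image_singleton, zero_add]
  ext x
  simp only [mem_insert_iff, mem_singleton_iff]
  tauto

theorem isIdealCell_flipEdge (D : A.Developed G ρ) (i : ℕ) : IsIdealCell A.dev (flipEdge A G i)
    {G.ideal (some 0), G.ideal (some (1 - (i : ℤ), 1))} := by
  have h := D.isIdealCell_cell (isCell_up i 0)
    ((face_mono (flip_subset_up i)).trans (face_subset_cone _))
  rwa [image_face, Finset.coe_pair, image_pair] at h

/-- At the flipped edge, the interior angle is the sum of the two angles opposite to the diagonal
of a parallelogram at the vertices where the angle is acute. -/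
theorem hasInteriorAngle (D : A.Developed G ρ) (i : ℕ) :
    ∃ θ < Real.pi, HasInteriorAngle (D.triangulation i) (flipEdge A G i) θ := by
  classical
  set τ := A.cell G (cone (triUp i 0)) with hτ
  set τ' := A.cell G (cone (triDown i 0)) with hτ'
  have hne : τ ≠ τ' := D.cell_up_ne_down i 0 0
  let d : Set Cover → Ideal := fun C =>
    if C = τ then G.ideal (some (1, 0)) else G.ideal (some (-(i : ℤ), 1))
  have hd : d τ = G.ideal (some (1, 0)) := if_pos rfl
  have hd' : d τ' = G.ideal (some (-(i : ℤ), 1)) := if_neg hne.symm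
  refine ⟨∑ C ∈ ({τ, τ'} : Finset (Set Cover)), dihedral (G.ideal (some 0))
    (G.ideal (some (1 - (i : ℤ), 1))) (G.ideal none) (d C), ?_, G.ideal (some 0),
    G.ideal (some (1 - (i : ℤ), 1)), {τ, τ'}, fun _ => G.ideal none, d, D.isIdealCell_flipEdge i,
    fun C => ?_, fun C hC => ?_, rfl⟩
  · rw [Finset.sum_pair hne, hd, hd']
    have h1 := D.dihedral_lt i (Or.inl rfl)
    have h2 := D.dihedral_lt i (Or.inr rfl)
    linarith
  · rw [D.flipEdge_subset, Finset.mem_insert, Finset.mem_singleton]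
  · rw [Finset.mem_insert, Finset.mem_singleton] at hC
    rcases hC with rfl | rfl
    · rw [hd, ← ideal_cone_triUp]
      exact D.isTet_cell (isCell_up i 0)
    · rw [hd', ← ideal_cone_triDown]
      exact D.isTet_cell (isCell_down i 0)

variable (A G) in
/-- The face along which the move is made. -/
def flipFace (i : ℕ) : Set Cover := A.cell G (cone {0, (1 - (i : ℤ), 1)})

theorem ideal_cone_flip (G : Frame) (i : ℤ) : G.ideal '' cone {0, (1 - i, 1)} =
    {G.ideal (some 0), G.ideal (some (1 - i, 1)), OnePoint.infty} := by
  rw [coe_cone]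
  simp only [Finset.coe_insert, Finset.coe_singleton, image_insert_eq, image_singleton, ideal_none]
  ext x
  simp only [mem_insert_iff, mem_singleton_iff]
  tauto

theorem isIdealCell_flipFace (D : A.Developed G ρ) (i : ℕ) : IsIdealCell A.dev (flipFace A G i)
    {G.ideal (some 0), G.ideal (some (1 - (i : ℤ), 1)), OnePoint.infty} := by
  rw [← ideal_cone_flip]
  exact D.isIdealCell_cell (isCell_up i 0) (cone_mono (flip_subset_up i))

theorem isJoinWithCusp (D : A.Developed G ρ) (i : ℕ) :
    IsJoinWithCusp A (flipFace A G i) (flipEdge A G i) :=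
  ⟨_, _, D.isIdealCell_flipEdge i, D.isIdealCell_flipFace i,
    preimage_mono (hull_mono (image_mono (Finset.coe_subset.mpr (face_subset_cone _))))⟩

/-! #### The tetrahedra of the move -/

theorem isCell_quadr (i : ℕ) (w : ℤ × ℤ) : IsCell ((i + 1 : ℕ) : ℤ) (face (quadr i w)) :=
  Or.inl ⟨i, w, by positivity, by push_cast; linarith, rfl⟩

theorem inter_old (i : ℤ) : cone (triUp i 0) ∩ cone (triDown i 0) = cone {0, (1 - i, 1)} := by
  ext o
  cases o with
  | none => simp
  | some w =>
    simp only [Finset.mem_inter, some_mem_cone, triUp, triDown, zero_add, Finset.mem_insert,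
      Finset.mem_singleton, Prod.ext_iff, Prod.fst_zero, Prod.snd_zero]
    omega

theorem inter_new (i : ℤ) : face (quadr i 0) ∩ cone (triDown (i + 1) (1, 0)) ∩
    cone (triUp (i + 1) 0) = face {(1, 0), (-i, 1)} := by
  ext o
  cases o with
  | none => simp
  | some w =>
    simp only [Finset.mem_inter, some_mem_cone, some_mem_face, triUp, triDown, quadr, zero_add,
      Finset.mem_insert, Finset.mem_singleton, Prod.ext_iff, Prod.fst_zero, Prod.snd_zero,
      Prod.mk_add_mk]
    omega

theorem ideal_quadr (G : Frame) (i : ℤ) : G.ideal '' face (quadr i 0) =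
    {G.ideal (some (1, 0)), G.ideal (some (-i, 1)), G.ideal (some 0),
      G.ideal (some (1 - i, 1))} := by
  rw [image_face, quadr]
  simp only [Finset.coe_insert, Finset.coe_singleton, image_insert_eq, image_singleton, zero_add]
  ext x
  simp only [mem_insert_iff, mem_singleton_iff]
  tauto

theorem ideal_cone_triDown_succ (G : Frame) (i : ℤ) : G.ideal '' cone (triDown (i + 1) (1, 0)) =
    {G.ideal (some (1, 0)), G.ideal (some (-i, 1)), G.ideal (some (1 - i, 1)), G.ideal none} := by
  have h := triDown_succ i 0
  simp only [zero_add] at h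
  rw [coe_cone, h]
  simp only [Finset.coe_insert, Finset.coe_singleton, image_insert_eq, image_singleton]
  ext x
  simp only [mem_insert_iff, mem_singleton_iff]
  tauto

theorem ideal_cone_triUp_succ (G : Frame) (i : ℤ) : G.ideal '' cone (triUp (i + 1) 0) =
    {G.ideal (some (1, 0)), G.ideal (some (-i, 1)), G.ideal none, G.ideal (some 0)} := by
  have h := triUp_succ i 0
  simp only [zero_add] at h
  rw [coe_cone, h]
  simp only [Finset.coe_insert, Finset.coe_singleton, image_insert_eq, image_singleton]
  ext x
  simp only [mem_insert_iff, mem_singleton_iff]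
  tauto

/-- Passing to the next triangulation replaces the orbits of two tetrahedra by those of three. -/
theorem tets_succ (D : A.Developed G ρ) (i : ℕ) : (D.triangulation (i + 1)).tets =
    ((D.triangulation i).tets \
      (orbit (A.cell G (cone (triUp i 0))) ∪ orbit (A.cell G (cone (triDown i 0))))) ∪
      (orbit (A.cell G (face (quadr i 0))) ∪
        orbit (A.cell G (cone (triDown ((i : ℤ) + 1) (1, 0)))) ∪
        orbit (A.cell G (cone (triUp ((i : ℤ) + 1) 0)))) := by
  ext C
  simp only [mem_union, Set.mem_sdiff, D.mem_orbit_up, D.mem_orbit_down, D.mem_orbit_quadr,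
      D.mem_tets]
  constructor
  · rintro ⟨S, hS, rfl⟩
    rcases hS with ⟨j, w, hj, hji, rfl⟩ | ⟨w, rfl | rfl⟩
    · have hji' : j ≤ i := by
        push_cast at hji
        omega
      rcases hji'.eq_or_lt with rfl | hlt
      · exact Or.inr (Or.inl (Or.inl ⟨w, rfl⟩))
      · have hq : IsCell i (face (quadr j w)) := Or.inl ⟨j, w, hj, hlt, rfl⟩
        refine Or.inl ⟨⟨_, hq, rfl⟩, ?_⟩
        rintro (⟨w', h⟩ | ⟨w', h⟩)
        · exact face_ne_cone _ _ (D.cell_injective hq (isCell_up _ _) h)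
        · exact face_ne_cone _ _ (D.cell_injective hq (isCell_down _ _) h)
    · exact Or.inr (Or.inr ⟨w, by push_cast; rfl⟩)
    · exact Or.inr (Or.inl (Or.inr ⟨w, by push_cast; rfl⟩))
  · rintro (⟨⟨S, hS, rfl⟩, h⟩ | (⟨w, rfl⟩ | ⟨w, rfl⟩) | ⟨w, rfl⟩)
    · rcases hS with ⟨j, w, hj, hji, rfl⟩ | ⟨w, rfl | rfl⟩
      · exact ⟨_, Or.inl ⟨j, w, hj, by push_cast; omega, rfl⟩, rfl⟩
      · exact absurd (Or.inl ⟨w, rfl⟩) h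
      · exact absurd (Or.inr ⟨w, rfl⟩) h
    · exact ⟨_, isCell_quadr i w, rfl⟩
    · exact ⟨_, by exact_mod_cast isCell_down ((i + 1 : ℕ) : ℤ) w, rfl⟩
    · exact ⟨_, by exact_mod_cast isCell_up ((i + 1 : ℕ) : ℤ) w, rfl⟩

theorem isTwoThreeMove (D : A.Developed G ρ) (i : ℕ) :
    IsTwoThreeMove (D.triangulation i) (D.triangulation (i + 1)) (flipFace A G i)
      (dualEdge A G i) := by
  have hcast : ((i + 1 : ℕ) : ℤ) = (i : ℤ) + 1 := by push_cast; rfl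
  have hq := isCell_quadr i 0
  have hdn : IsCell ((i + 1 : ℕ) : ℤ) (cone (triDown ((i : ℤ) + 1) (1, 0))) := by
    rw [hcast]
    exact isCell_down _ _
  have hup : IsCell ((i + 1 : ℕ) : ℤ) (cone (triUp ((i : ℤ) + 1) 0)) := by
    rw [hcast]
    exact isCell_up _ _
  refine ⟨A.cell G (cone (triUp i 0)), A.cell G (cone (triDown i 0)), A.cell G (face (quadr i 0)),
    A.cell G (cone (triDown ((i : ℤ) + 1) (1, 0))), A.cell G (cone (triUp ((i : ℤ) + 1) 0)),
    G.ideal none, G.ideal (some 0), G.ideal (some (1 - (i : ℤ), 1)), G.ideal (some (1, 0)),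
    G.ideal (some (-(i : ℤ), 1)), ⟨_, isCell_up _ _, rfl⟩, ⟨_, isCell_down _ _, rfl⟩, ?_, ?_, ?_,
        ?_,
    ?_, ?_, ?_, ?_, ?_, ?_, ?_, ?_, ?_, ?_, D.tets_succ i⟩
  · rw [D.mem_orbit_up]
    rintro ⟨w, h⟩
    exact D.cell_up_ne_down i w 0 h.symm
  · convert D.isTet_cell (isCell_up i 0) using 1
    rw [ideal_cone_triUp]
    ext x
    simp only [mem_insert_iff, mem_singleton_iff]
    tauto
  · convert D.isTet_cell (isCell_down i 0) using 1
    rw [ideal_cone_triDown]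
    ext x
    simp only [mem_insert_iff, mem_singleton_iff]
    tauto
  · rw [D.cell_inter (isCell_up i 0) (isCell_down i 0) subset_rfl subset_rfl, inter_old]
    rfl
  · convert D.isIdealCell_flipFace i using 1
    rw [ideal_none]
    ext x
    simp only [mem_insert_iff, mem_singleton_iff]
    tauto
  · rw [← ideal_quadr]
    exact D.isTet_cell hq
  · rw [← ideal_cone_triDown_succ]
    exact D.isTet_cell hdn
  · rw [← ideal_cone_triUp_succ]
    exact D.isTet_cell hup
  · rw [D.cell_inter hq hdn subset_rfl subset_rfl,
      D.cell_inter hq hup Finset.inter_subset_left subset_rfl, inter_new]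
    rfl
  · have h := D.isIdealCell_cell hq (T := face {(1, 0), (-(i : ℤ), 1)}) (face_mono fun x => by
      simp only [quadr, zero_add, Finset.mem_insert, Finset.mem_singleton]
      tauto)
    rwa [image_face, Finset.coe_pair, image_pair] at h
  · have h1 := hull_cone_quadr_old D.inn_neg (i := (i : ℤ)) (by positivity) 0
    have h2 := hull_cone_quadr_new D.inn_neg (i := (i : ℤ)) (by positivity) 0
    rw [zero_add] at h2
    simp only [cell, ← preimage_union]
    rw [← h1, ← h2]
  · rw [D.mem_orbit_quadr]
    rintro ⟨w, h⟩
    exact face_ne_cone _ _ (D.cell_injective (isCell_quadr i w) hdn h.symm)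
  · rw [D.mem_orbit_quadr]
    rintro ⟨w, h⟩
    exact face_ne_cone _ _ (D.cell_injective (isCell_quadr i w) hup h.symm)
  · rw [D.mem_orbit_down]
    rintro ⟨w, h⟩
    rw [← hcast] at h
    exact D.cell_up_ne_down (i + 1) _ _ h

end Developed
end DrilledAnanas

end Ananas

end

theorem lemma3p5 (A : Ananas.DrilledAnanas) :
    ∃ (𝒯 : ℕ → Ananas.GeometricTriangulation A) (N : ℕ → Ananas.SubAnanas A)
      (β β' : ℕ → Set Ananas.Cover),
      -- the triangulations are pairwise distinct, and the process starts with all of `N`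
      Function.Injective (fun i => (𝒯 i).tets) ∧ (N 0).carrier = Set.univ ∧
      ∀ i,
        -- the sub-ananas `N i` is the union of the tetrahedra of `𝒯 i` at the cusp,
        (N i).carrier = ⋃₀ Ananas.cuspTets (𝒯 i) ∧
        -- of which there are exactly two
        (∃ τ τ', τ' ∉ Ananas.orbit τ ∧
          Ananas.cuspTets (𝒯 i) = Ananas.orbit τ ∪ Ananas.orbit τ') ∧
        -- `β i` is a boundary edge of `N i` with interior angle less than `π`
        β i ∈ (N i).boundaryEdges ∧
        (∃ θ < Real.pi, Ananas.HasInteriorAngle (𝒯 i) (β i) θ) ∧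
        -- `𝒯 (i + 1)` is the result of a 2-3 move along the face between `β i` and the cusp,
        (∃ F, Ananas.IsJoinWithCusp A F (β i) ∧
          Ananas.IsTwoThreeMove (𝒯 i) (𝒯 (i + 1)) F (β' i)) ∧
        -- and the boundary of `N (i + 1)` has the dual edge `β' i` in place of `β i`
        (N (i + 1)).boundaryEdges =
          ((N i).boundaryEdges \ Ananas.orbit (β i)) ∪ Ananas.orbit (β' i) := by
  obtain ⟨G, ρ, D⟩ := A.exists_developed
  refine ⟨D.triangulation, D.subAnanas, Ananas.DrilledAnanas.Developed.flipEdge A G,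
    Ananas.DrilledAnanas.Developed.dualEdge A G, D.triangulation_injective, ?_,
    fun i => ⟨D.carrier_eq_sUnion i, D.exists_cuspTets i, D.flipEdge_mem i, D.hasInteriorAngle i,
      ⟨_, D.isJoinWithCusp i, D.isTwoThreeMove i⟩, D.boundaryEdges_succ i⟩⟩
  rw [D.carrier_subAnanas, Nat.cast_zero, Ananas.Frame.shear_zero, ← D.range_eq, preimage_range]
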